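/- **Setting.** Let $n\ge 1$. All functions are complex valued on $\mathbb R^n$ (with the Euclidean norm and Lebesgue measure), and measurable functions are identified when they agree almost everywhere. For a measurable $E\subseteq\mathbb R^n$, $0<p<\infty$ and $0<q\le\infty$, put $f^*(\tau)=\inf\{s\ge 0: |\{x\in E:|f(x)|>s\}|\le \tau\}$ and $$\|f\|_{L^{p,q}(E)}=\Big(\int_0^\infty(\tau^{1/p}f^*(\tau))^q\,\tfrac{d\tau}{\tau}\Big)^{1/q}\ (q<\infty),\qquad \|f\|_{L^{p,\infty}(E)}=\sup_{\tau>0}\tau^{1/p}f^*(\tau).$$ Let $Q_{j,m}=\prod_{i=1}^n[2^{-j}m_i,2^{-j}(m_i+1))$, $(j,m)\in\mathbb Z\times\mathbb Z^n$, be the dyadic cubes. The Bourgain–Morrey–Lorentz space $M^{t,r}_{p,q}(\mathbb R^n)$ consists of all measurable $f$ with $$\|f\|_{M^{t,r}_{p,q}}=\Big\|\big(|Q_{j,m}|^{1/t-1/p}\|f\|_{L^{p,q}(Q_{j,m})}\big)_{(j,m)}\Big\|_{\ell^r}<\infty .$$ Primes denote conjugate exponents. The block space $\mathcal H^{t',r'}_{p',q'}(\mathbb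 R^n)$ consists of all measurable $f$ that can be written as $f=\sum_{(j,m)}\lambda_{j,m}b_{j,m}$ with convergence in $L^1_{\rm loc}$, where $(\lambda_{j,m})\in\ell^{r'}$ and each $b_{j,m}$ vanishes outside $Q_{j,m}$ and satisfies $\|b_{j,m}\|_{L^{p',q'}(\mathbb R^n)}\le|Q_{j,m}|^{1/p'-1/t'}$; its norm is the infimum of $\|\lambda\|_{\ell^{r'}}$ over all such representations. A function $K$ on $\{(x,y):x\ne y\}$ is a standard kernel if for some $\delta,A>0$: $|K(x,y)|\le A|x-y|^{-n}$; $|K(x,y)-K(x',y)|\le A|x-x'|^\delta(|x-y|+|x'-y|)^{-n-\delta}$ whenever $|x-x'|\le\frac12\max(|x-y|,|x'-y|)$; and $|K(x,y)-K(x,y')|\le A|y-y'|^\delta(|x-y|+|x-y'|)^{-n-\delta}$ whenever $|y-y'|\le\frac12\max(|x-y|,|x-y'|)$. A Calderón–Zygmund operator associated with $K$ is a continuous linear operator $T:\mathscr S(\mathbb R^n)\to\mathscr S'(\mathbb R^n)$ that extends to a bounded linear operator $T$ on $L^2(\mathbb R^n)$ and satisfies $Tf(x)=\int K(x,y)f(y)\,dy$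 for all $f\in C_c^\infty(\mathbb R^n)$ and almost every $x\notin\operatorname{supp}f$. Let $T^\dagger$ be the Hilbert space adjoint of $T$ on $L^2(\mathbb R^n)$. **Theorem.** Let $1<p<t<r<\infty$ or $1<p\le t<r=\infty$, and let $T$ be a Calderón–Zygmund operator associated with a standard kernel. 1. If $1\le q\le\infty$, then $T$ extends to a bounded linear operator $\widetilde T$ on $M^{t,r}_{p,q}(\mathbb R^n)$. 2. If $1<q<\infty$, then $T$ extends to a bounded linear operator $\widetilde T$ on $\mathcal H^{t',r'}_{p',q'}(\mathbb R^n)$. In both cases, with $X$ the space in question, "extends" means that $\widetilde Tf=Tf$ for all $f\in X\cap L^2(\mathbb R^n)$ and that $$\int_{\mathbb R^n}\widetilde Tf\;\overline{\varphi}\,dx=\int_{\mathbb R^n}f\;\overline{T^\dagger\varphi}\,dx\qquad\text{for all } f\in X,\ \varphi\in C_c^\infty(\mathbb R^n),$$ both integrals being absolutely convergent (so that $\widetilde T$ is uniquely determined). -/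

import Mathlib

open MeasureTheory Filter Topology
open scoped ENNReal NNReal SchwartzMap ComplexConjugate

noncomputable section

namespace BML

/-- `ℝⁿ` with the Euclidean norm. -/
abbrev Rn (n : ℕ) : Type := EuclideanSpace ℝ (Fin n)

/-- `L⁰(ℝⁿ)`: complex measurable functions modulo equality almost everywhere. -/
abbrev L0 (n : ℕ) : Type := Rn n →ₘ[(volume : Measure (Rn n))] ℂ

/-- `L²(ℝⁿ)`. -/
abbrev L2 (n : ℕ) : Type := Lp ℂ 2 (volume : Measure (Rn n))

/-! ### Lorentz spaces -/

/-- The decreasing rearrangement `f^*(τ) = inf {s ≥ 0 : μ {|f| > s} ≤ τ}`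
(`s = ∞` always qualifies, which is the convention `inf ∅ = ∞`). -/
def rearrangement {X : Type*} [MeasurableSpace X] (f : X → ℂ) (μ : Measure X) (τ : ℝ≥0∞) :
    ℝ≥0∞ :=
  sInf {s : ℝ≥0∞ | μ {x | s < ‖f x‖ₑ} ≤ τ}

/-- The Lorentz quasi-norm `‖f‖_{L^{p,q}(μ)}`, for `0 < p < ∞` and `0 < q ≤ ∞`. -/
def lorentzNorm {X : Type*} [MeasurableSpace X] (p : ℝ) (q : ℝ≥0∞) (f : X → ℂ)
    (μ : Measure X) : ℝ≥0∞ :=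
  if q = ∞ then
    ⨆ (τ : ℝ) (_ : 0 < τ), ENNReal.ofReal τ ^ (1 / p) * rearrangement f μ (ENNReal.ofReal τ)
  else
    (∫⁻ τ in Set.Ioi (0 : ℝ),
      (ENNReal.ofReal τ ^ (1 / p) * rearrangement f μ (ENNReal.ofReal τ)) ^ q.toReal
        / ENNReal.ofReal τ) ^ (1 / q.toReal)

/-! ### Dyadic cubes and Bourgain-Morrey-Lorentz spaces -/

/-- The `ℓ^r` (quasi-)norm of a family of extended nonnegative numbers, `0 < r ≤ ∞`. -/
def ellNorm {ι : Type*} (r : ℝ≥0∞) (a : ι → ℝ≥0∞) : ℝ≥0∞ :=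
  if r = ∞ then ⨆ i, a i else (∑' i, a i ^ r.toReal) ^ (1 / r.toReal)

/-- The index set of the dyadic cubes. -/
abbrev DyadicIndex (n : ℕ) : Type := ℤ × (Fin n → ℤ)

/-- The dyadic cube `Q_{j,m} = ∏ᵢ [2^{-j} mᵢ, 2^{-j} (mᵢ + 1))`, for the index `(j, m)`. -/
def dyadicCube {n : ℕ} (jm : DyadicIndex n) : Set (Rn n) :=
  {x | ∀ i, (2 : ℝ) ^ (-jm.1) * (jm.2 i : ℝ) ≤ x i ∧
    x i < (2 : ℝ) ^ (-jm.1) * ((jm.2 i : ℝ) + 1)}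

/-- The quasi-norm of the Bourgain-Morrey-Lorentz space `M^{t,r}_{p,q}(ℝⁿ)`; the space consists
of the `f ∈ L⁰(ℝⁿ)` for which it is finite. -/
def bmlNorm {n : ℕ} (p : ℝ) (q : ℝ≥0∞) (t : ℝ) (r : ℝ≥0∞) (f : L0 n) : ℝ≥0∞ :=
  ellNorm r fun jm : DyadicIndex n =>
    volume (dyadicCube jm) ^ (1 / t - 1 / p) *
      lorentzNorm p q f (volume.restrict (dyadicCube jm))

/-! ### Block spaces (written for arbitrary exponents; to be used with conjugate exponents) -/

/-- `b` is a `(p, q, t)`-block supported on `Q`. -/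
def IsBlock {n : ℕ} (p : ℝ) (q : ℝ≥0∞) (t : ℝ) (Q : Set (Rn n)) (b : L0 n) : Prop :=
  (∀ᵐ x, x ∉ Q → b x = 0) ∧ lorentzNorm p q b volume ≤ volume Q ^ (1 / p - 1 / t)

/-- `f = ∑ λ_{j,m} b_{j,m}`, converging in `L¹_loc`, with `λ ∈ ℓ^r` and each `b_{j,m}` a
`(p, q, t)`-block supported on `Q_{j,m}`. -/
structure IsBlockDecomposition {n : ℕ} (p : ℝ) (q : ℝ≥0∞) (t : ℝ) (r : ℝ≥0∞) (f : L0 n)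
    (c : DyadicIndex n → ℂ) (b : DyadicIndex n → L0 n) : Prop where
  coeff : ellNorm r (fun jm => ‖c jm‖ₑ) < ∞
  block : ∀ jm, IsBlock p q t (dyadicCube jm) (b jm)
  converges : ∀ A : Set (Rn n), IsCompact A →
    Tendsto (fun s : Finset (DyadicIndex n) =>
      ∫⁻ x in A, ‖(f - ∑ jm ∈ s, c jm • b jm : L0 n) x‖ₑ) atTop (𝓝 0)

/-- The norm of the block space `H^{t,r}_{p,q}(ℝⁿ)`; it is `∞` when `f` has no decomposition,
so the space consists of the `f ∈ L⁰(ℝⁿ)` for which it is finite. -/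
def blockNorm {n : ℕ} (p : ℝ) (q : ℝ≥0∞) (t : ℝ) (r : ℝ≥0∞) (f : L0 n) : ℝ≥0∞ :=
  ⨅ (c : DyadicIndex n → ℂ) (b : DyadicIndex n → L0 n)
    (_ : IsBlockDecomposition p q t r f c b), ellNorm r (fun jm => ‖c jm‖ₑ)

/-! ### Calderón-Zygmund operators -/

/-- `K ∈ SK(δ, A)`. The values of `K` on the diagonal are irrelevant. -/
structure IsStandardKernel {n : ℕ} (δ A : ℝ) (K : Rn n → Rn n → ℂ) : Prop where
  size : ∀ x y, x ≠ y → ‖K x y‖ ≤ A / ‖x - y‖ ^ n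
  regular_left : ∀ x x' y, x ≠ y → x' ≠ y → ‖x - x'‖ ≤ max ‖x - y‖ ‖x' - y‖ / 2 →
    ‖K x y - K x' y‖ ≤ A * ‖x - x'‖ ^ δ / (‖x - y‖ + ‖x' - y‖) ^ ((n : ℝ) + δ)
  regular_right : ∀ x y y', x ≠ y → x ≠ y' → ‖y - y'‖ ≤ max ‖x - y‖ ‖x - y'‖ / 2 →
    ‖K x y - K x y'‖ ≤ A * ‖y - y'‖ ^ δ / (‖x - y‖ + ‖x - y'‖) ^ ((n : ℝ) + δ)

/-- The continuous linear operator `T : 𝓢(ℝⁿ) → 𝓢'(ℝⁿ)` is a Calderón-Zygmund operator associated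
with `K`, and `T₂` is its (unique) bounded extension to `L²(ℝⁿ)`. -/
structure IsCalderonZygmund {n : ℕ} (K : Rn n → Rn n → ℂ)
    (T : 𝓢(Rn n, ℂ) →L[ℂ] 𝓢'(Rn n, ℂ)) (T₂ : L2 n →L[ℂ] L2 n) : Prop where
  kernel : ∃ δ A : ℝ, 0 < δ ∧ 0 < A ∧ IsStandardKernel δ A K
  extension : ∀ φ ψ : 𝓢(Rn n, ℂ), T φ ψ = ∫ x, T₂ (φ.toLp 2) x * ψ x
  off_support : ∀ φ : 𝓢(Rn n, ℂ), HasCompactSupport φ →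
    ∀ᵐ x, x ∉ tsupport φ → T₂ (φ.toLp 2) x = ∫ y, K x y * φ y

/-! ### Extension to a space `{f ∈ L⁰(ℝⁿ) : N f < ∞}` -/

/-- `S` restricts to a bounded linear operator on the space `{f : N f < ∞}`. -/
structure IsBoundedLinearOn {n : ℕ} (N : L0 n → ℝ≥0∞) (S : L0 n → L0 n) : Prop where
  map_add : ∀ f g, N f < ∞ → N g < ∞ → S (f + g) = S f + S g
  map_smul : ∀ (c : ℂ) f, N f < ∞ → S (c • f) = c • S f
  bound : ∃ C : ℝ≥0, ∀ f, N f < ∞ → N (S f) ≤ C * N f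

/-- On the space `{f : N f < ∞}`, `S` extends the `L²`-bounded operator `T₂`: the two agree on
`L²`, and `S` is given by duality, `⟨S f, φ⟩ = ⟨f, T₂^* φ⟩` for all `φ ∈ C_c^∞`, with absolutely
convergent pairings. The latter determines `S f` almost everywhere, also where `C_c^∞` is not
dense. -/
structure IsExtensionOn {n : ℕ} (T₂ : L2 n →L[ℂ] L2 n) (N : L0 n → ℝ≥0∞)
    (S : L0 n → L0 n) : Prop where
  agrees : ∀ f : L2 n, N (f : L0 n) < ∞ → S (f : L0 n) = (T₂ f : L0 n)
  dual : ∀ f : L0 n, N f < ∞ → ∀ φ : 𝓢(Rn n, ℂ), HasCompactSupport φ →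
    Integrable (fun x => S f x * conj (φ x)) ∧
    Integrable (fun x => f x * conj (ContinuousLinearMap.adjoint T₂ (φ.toLp 2) x)) ∧
    ∫ x, S f x * conj (φ x) = ∫ x, f x * conj (ContinuousLinearMap.adjoint T₂ (φ.toLp 2) x)

end BML

end

noncomputable section

namespace BML

/-! ### Decreasing rearrangements -/

section Rearrangement

variable {X : Type*} [MeasurableSpace X] {μ : Measure X} {f g : X → ℂ}

/-! A Calderón–Zygmund operator is bounded on `L^{p,q}` for `1 < p < ∞`, and its kernel decays like
`|x - y|^{-n}`. Both parts of the theorem combine these two facts cube by cube; the condition `t <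
r` makes the losses summable over generations of dyadic cubes.

Lorentz bounds. Weak type `(1,1)` (`HasKernel.exists_weak_type_one`) and, by duality, weak type
`(p₁,p₁)` for `p₁ > 2` (`HasKernel.exists_weak_type_of_adjoint`) give
`HasKernel.exists_rearrangement_le`: `(T f)^*(2τ)` is dominated by a weighted sum of dilates
`f^*(aτ)`. The norm of `L^q(dτ/τ)` is dilation invariant and satisfies Minkowski's inequality, so
`lorentzNorm_le_of_rearrangement_le` turns this into a norm bound for all `1 ≤ q ≤ ∞` at once, with
no Hardy inequality.

Extension. Test functions need not be dense, so the image of `f` is specified by duality: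
`IsTransform T f g` says that `⟨g, ψ⟩ = ⟨f, T†ψ⟩` for all bounded `ψ` of bounded support. Such a `g`
is unique almost everywhere, the relation is linear, it can be checked cube by cube, and it passes
to absolutely convergent sums. It therefore suffices to find, for each `f`, one `g` with the right
norm (`exists_extension`).

Part 1. Fix a cube `Q`. The part of `f` on the triple of `Q` is handled by the Lorentz bound. The
rest is cut into annuli between the triples of successive ancestors, and the size of the kernel
bounds its image pointwise on `Q`. The coefficient of `g` at `Q` is thus at most a constant times
the sum over `k` of `2^{-nk/t}` times the coefficients of `f` at the neighbours of the `k`-th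
ancestor (`IsCZ.exists_isTransformOn`). Passing to `k`-th ancestors costs `2^{nk/r}` in `ℓ^r`, and
the series converges because `t < r`.

Part 2. The image of a block on `Q` is no longer supported on `Q`. A point `x` at distance about
`2^k` side lengths from `Q` is assigned to the dyadic cube `R` containing `x` that is `k`
generations larger than `Q` (`annulusCube`). What is assigned to `R` adds up to a multiple of a
block on `R`, with coefficient at most a constant times the sum over `k` of `2^{-nk/t}` times the
`|λ_Q|` over the `k`-th descendants of the neighbours of `R` (`exists_majorant`). Summing over
descendants costs `2^{nk(1 - 1/r')} = 2^{nk/r}` in `ℓ^{r'}`, so the same series appears. The duality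
relation survives the summation because `T†ψ` lies in `M^{t,r}_{p,q}`, by Part 1 for the adjoint. -/

theorem measure_rearrangement_lt_le (f : X → ℂ) (μ : Measure X) (τ : ℝ≥0∞) :
    μ {x | rearrangement f μ τ < ‖f x‖ₑ} ≤ τ := by
  rcases eq_or_ne (rearrangement f μ τ) ∞ with h | h
  · simp [h]
  obtain ⟨u, hu, hlt, hlim⟩ := exists_seq_strictAnti_tendsto' (lt_top_iff_ne_top.2 h)
  have hmem : ∀ k, μ {x | u k < ‖f x‖ₑ} ≤ τ := by
    intro k
    obtain ⟨s, hs, hsu⟩ := sInf_lt_iff.1 (hlt k).1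
    exact (measure_mono fun x hx => hsu.trans hx).trans hs
  have heq : {x | rearrangement f μ τ < ‖f x‖ₑ} = ⋃ k, {x | u k < ‖f x‖ₑ} := by
    ext x
    simp only [Set.mem_ofPred_eq, Set.mem_iUnion]
    constructor
    · intro hx
      exact (hlim.eventually_lt_const hx).exists
    · rintro ⟨k, hk⟩
      exact (hlt k).1.trans hk
  have hmono : Monotone fun k => {x | u k < ‖f x‖ₑ} := fun k l hkl x hx =>
    (hu.antitone hkl).trans_lt hx
  rw [heq, hmono.measure_iUnion]
  exact iSup_le hmem

/-- Because the infimum is attained, the rearrangement is adjoint to the distribution function; most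
later facts go through this equivalence instead of the infimum. -/
theorem rearrangement_le_iff {τ s : ℝ≥0∞} :
    rearrangement f μ τ ≤ s ↔ μ {x | s < ‖f x‖ₑ} ≤ τ :=
  ⟨fun h => (measure_mono fun _ hx => h.trans_lt hx).trans (measure_rearrangement_lt_le f μ τ),
    fun h => sInf_le h⟩

theorem lt_rearrangement_iff {τ s : ℝ≥0∞} :
    s < rearrangement f μ τ ↔ τ < μ {x | s < ‖f x‖ₑ} := by
  rw [← not_le, ← not_le, rearrangement_le_iff]

theorem rearrangement_antitone (f : X → ℂ) (μ : Measure X) : Antitone (rearrangement f μ) :=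
  fun _ _ h => rearrangement_le_iff.2 ((measure_rearrangement_lt_le f μ _).trans h)

theorem rearrangement_mono_ae (h : ∀ᵐ x ∂μ, ‖f x‖ₑ ≤ ‖g x‖ₑ) (τ : ℝ≥0∞) :
    rearrangement f μ τ ≤ rearrangement g μ τ := by
  refine rearrangement_le_iff.2 (le_trans (measure_mono_ae ?_) (measure_rearrangement_lt_le g μ τ))
  filter_upwards [h] with x hx h' using lt_of_lt_of_le h' hx

theorem rearrangement_congr_ae (h : f =ᵐ[μ] g) (τ : ℝ≥0∞) :
    rearrangement f μ τ = rearrangement g μ τ :=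
  le_antisymm (rearrangement_mono_ae (h.mono fun x hx => by rw [hx]) τ)
    (rearrangement_mono_ae (h.mono fun x hx => by rw [hx]) τ)

/-- Outside `{|f| > f^*(τ)} ∪ {|g| > g^*(σ)}` the sum is at most `f^*(τ) + g^*(σ)`, and the two
exceptional sets have total measure at most `τ + σ`. -/
theorem rearrangement_add_le (f g : X → ℂ) (μ : Measure X) (τ σ : ℝ≥0∞) :
    rearrangement (f + g) μ (τ + σ) ≤ rearrangement f μ τ + rearrangement g μ σ := by
  refine rearrangement_le_iff.2 ?_
  refine le_trans (measure_mono ?_) ((measure_union_le _ _).trans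
    (add_le_add (measure_rearrangement_lt_le f μ τ) (measure_rearrangement_lt_le g μ σ)))
  intro x hx
  by_contra hcon
  simp only [Set.mem_union, Set.mem_ofPred_eq, not_or, not_lt] at hcon
  exact absurd hx (not_lt.2 ((enorm_add_le _ _).trans (add_le_add hcon.1 hcon.2)))

theorem rearrangement_indicator {Q : Set X} (hQ : MeasurableSet Q) (f : X → ℂ) (μ : Measure X)
    (τ : ℝ≥0∞) : rearrangement (Q.indicator f) μ τ = rearrangement f (μ.restrict Q) τ := by
  unfold rearrangement
  congr 1
  ext s
  simp only [Set.mem_ofPred_eq]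
  rw [Measure.restrict_apply' hQ]
  have : {x | s < ‖Q.indicator f x‖ₑ} = {x | s < ‖f x‖ₑ} ∩ Q := by
    ext x
    by_cases hx : x ∈ Q <;> simp [hx]
  rw [this]

theorem rearrangement_const_smul_le (c : ℂ) (f : X → ℂ) (μ : Measure X) (τ : ℝ≥0∞) :
    rearrangement (c • f) μ τ ≤ ‖c‖ₑ * rearrangement f μ τ := by
  refine rearrangement_le_iff.2 (le_trans (measure_mono ?_) (measure_rearrangement_lt_le f μ τ))
  intro x hx
  by_contra hcon
  simp only [Set.mem_ofPred_eq, not_lt, Pi.smul_apply, smul_eq_mul, enorm_mul] at hcon hx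
  exact absurd hx (not_lt.2 (by gcongr))

theorem rearrangement_le_of_bounded {M : ℝ≥0∞} {E : Set X} (hM : ∀ᵐ x ∂μ, ‖f x‖ₑ ≤ M)
    (hE : ∀ᵐ x ∂μ, x ∉ E → f x = 0) (τ : ℝ≥0∞) :
    rearrangement f μ τ ≤ if τ < μ E then M else 0 := by
  refine rearrangement_le_iff.2 ?_
  split_ifs with h
  · rw [measure_eq_zero_iff_ae_notMem.2]
    · exact zero_le
    · filter_upwards [hM] with x hx using not_lt.2 hx
  · refine (measure_mono_ae ?_).trans (not_lt.1 h)
    filter_upwards [hE] with x hx h'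
    by_contra hc
    have hz := hx hc
    exact absurd (show (0 : ℝ≥0∞) < ‖f x‖ₑ from h') (by simp [hz])

theorem measurable_rearrangement (f : X → ℂ) (μ : Measure X) :
    Measurable fun τ : ℝ => rearrangement f μ (ENNReal.ofReal τ) :=
  Antitone.measurable fun _ _ h => rearrangement_antitone f μ (ENNReal.ofReal_le_ofReal h)

end Rearrangement

/-! ### Minkowski's inequality for series -/

theorem lintegral_rpow_sum_le {α : Type*} [MeasurableSpace α] (μ : Measure α) {q : ℝ}
    (hq : 1 ≤ q) {φ : ℕ → α → ℝ≥0∞} (hφ : ∀ k, Measurable (φ k)) (N : ℕ) :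
    (∫⁻ x, (∑ k ∈ Finset.range N, φ k x) ^ q ∂μ) ^ (1 / q) ≤
      ∑ k ∈ Finset.range N, (∫⁻ x, φ k x ^ q ∂μ) ^ (1 / q) := by
  induction N with
  | zero =>
    have : (0 : ℝ) < q := by linarith
    simp [ENNReal.zero_rpow_of_pos, this]
  | succ N ih =>
    simp_rw [Finset.sum_range_succ]
    refine le_trans ?_ (add_le_add_left ih _)
    exact ENNReal.lintegral_Lp_add_le (f := fun x => ∑ k ∈ Finset.range N, φ k x) (g := φ N)
      (Finset.measurable_fun_sum _ fun k _ => hφ k).aemeasurable (hφ N).aemeasurable hq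

theorem lintegral_rpow_tsum_nat_le {α : Type*} [MeasurableSpace α] (μ : Measure α) {q : ℝ}
    (hq : 1 ≤ q) {φ : ℕ → α → ℝ≥0∞} (hφ : ∀ k, Measurable (φ k)) :
    (∫⁻ x, (∑' k, φ k x) ^ q ∂μ) ^ (1 / q) ≤ ∑' k, (∫⁻ x, φ k x ^ q ∂μ) ^ (1 / q) := by
  have hq0 : 0 ≤ q := by linarith
  have h1 : Tendsto (fun N => ∫⁻ x, (∑ k ∈ Finset.range N, φ k x) ^ q ∂μ) atTop
      (𝓝 (∫⁻ x, (∑' k, φ k x) ^ q ∂μ)) := by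
    apply lintegral_tendsto_of_tendsto_of_monotone
    · exact fun N => ((Finset.measurable_fun_sum _ fun k _ => hφ k).pow_const q).aemeasurable
    · refine ae_of_all _ fun x N M hNM => ENNReal.rpow_le_rpow ?_ hq0
      exact Finset.sum_le_sum_of_subset (Finset.range_mono hNM)
    · exact ae_of_all _ fun x => (ENNReal.continuous_rpow_const.tendsto _).comp
        (ENNReal.tendsto_nat_tsum _)
  refine le_of_tendsto' ((ENNReal.continuous_rpow_const.tendsto _).comp h1) fun N => ?_
  exact (lintegral_rpow_sum_le μ hq hφ N).trans (ENNReal.sum_le_tsum _)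

theorem lintegral_rpow_tsum_le {α β : Type*} [MeasurableSpace α] [Denumerable β] (μ : Measure α)
    {q : ℝ} (hq : 1 ≤ q) {φ : β → α → ℝ≥0∞} (hφ : ∀ k, Measurable (φ k)) :
    (∫⁻ x, (∑' k, φ k x) ^ q ∂μ) ^ (1 / q) ≤ ∑' k, (∫⁻ x, φ k x ^ q ∂μ) ^ (1 / q) := by
  rw [← (Denumerable.eqv β).symm.tsum_eq fun k => (∫⁻ x, φ k x ^ q ∂μ) ^ (1 / q)]
  simp_rw [← fun x => (Denumerable.eqv β).symm.tsum_eq fun k => φ k x]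
  exact lintegral_rpow_tsum_nat_le μ hq fun k => hφ _

/-! ### The `L^q` norm with respect to `dτ/τ` -/

/-- The norm of `L^q((0, ∞), dτ/τ)`. -/
def mulNorm (q : ℝ≥0∞) (φ : ℝ → ℝ≥0∞) : ℝ≥0∞ :=
  if q = ∞ then ⨆ (τ : ℝ) (_ : 0 < τ), φ τ
  else (∫⁻ τ in Set.Ioi (0 : ℝ), φ τ ^ q.toReal / ENNReal.ofReal τ) ^ (1 / q.toReal)

theorem lorentzNorm_eq_mulNorm {X : Type*} [MeasurableSpace X] (p : ℝ) (q : ℝ≥0∞) (f : X → ℂ)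
    (μ : Measure X) : lorentzNorm p q f μ =
      mulNorm q fun τ => ENNReal.ofReal τ ^ (1 / p) * rearrangement f μ (ENNReal.ofReal τ) := rfl

theorem one_le_toReal {q : ℝ≥0∞} (hq : 1 ≤ q) (hq' : q ≠ ∞) : 1 ≤ q.toReal := by
  simpa using (ENNReal.toReal_le_toReal ENNReal.one_ne_top hq').2 hq

theorem mulNorm_mono {q : ℝ≥0∞} {φ ψ : ℝ → ℝ≥0∞} (h : ∀ τ, 0 < τ → φ τ ≤ ψ τ) :
    mulNorm q φ ≤ mulNorm q ψ := by
  unfold mulNorm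
  split_ifs with hq
  · exact iSup₂_mono h
  · refine ENNReal.rpow_le_rpow (setLIntegral_mono' measurableSet_Ioi fun τ hτ => ?_)
      (by positivity)
    gcongr
    exact h τ hτ

theorem mulNorm_const_mul {q : ℝ≥0∞} (hq : 1 ≤ q) {c : ℝ≥0∞} (hc : c ≠ ∞) (φ : ℝ → ℝ≥0∞) :
    mulNorm q (fun τ => c * φ τ) = c * mulNorm q φ := by
  unfold mulNorm
  split_ifs with h
  · simp_rw [ENNReal.mul_iSup]
  · have h1 := one_le_toReal hq h
    have h0 : q.toReal ≠ 0 := by linarith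
    simp_rw [ENNReal.mul_rpow_of_nonneg _ _ (zero_le_one.trans h1), mul_div_assoc]
    rw [lintegral_const_mul' _ _ (by simp [hc, ENNReal.rpow_eq_top_iff, zero_le_one.trans h1]),
      ENNReal.mul_rpow_of_nonneg _ _ (by positivity), ← ENNReal.rpow_mul, mul_one_div_cancel h0,
      ENNReal.rpow_one]

theorem mulNorm_tsum_le {β : Type*} [Denumerable β] {q : ℝ≥0∞} (hq : 1 ≤ q)
    {φ : β → ℝ → ℝ≥0∞} (hφ : ∀ k, Measurable (φ k)) :
    mulNorm q (fun τ => ∑' k, φ k τ) ≤ ∑' k, mulNorm q (φ k) := by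
  unfold mulNorm
  split_ifs with h
  · exact iSup₂_le fun τ hτ => ENNReal.tsum_le_tsum fun k =>
      le_iSup₂ (f := fun (τ : ℝ) (_ : 0 < τ) => φ k τ) τ hτ
  · have h1 := one_le_toReal hq h
    -- The weight `1/τ` is absorbed into the measure, so that Minkowski's inequality for a general
    -- measure applies.
    have key : ∀ ψ : ℝ → ℝ≥0∞, Measurable ψ →
        ∫⁻ τ in Set.Ioi (0 : ℝ), ψ τ ^ q.toReal / ENNReal.ofReal τ =
        ∫⁻ τ, ψ τ ^ q.toReal
          ∂((volume.restrict (Set.Ioi (0 : ℝ))).withDensity fun τ => (ENNReal.ofReal τ)⁻¹) := by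
      intro ψ hψ
      rw [lintegral_withDensity_eq_lintegral_mul _ (by fun_prop) (hψ.pow_const _)]
      simp only [Pi.mul_apply, div_eq_mul_inv, mul_comm]
    rw [key _ (Measurable.tsum hφ)]
    simp_rw [fun k => key _ (hφ k)]
    exact lintegral_rpow_tsum_le _ h1 hφ

/-- Dilation invariance of `dτ/τ`. The change of variables is along a measurable equivalence, so `F`
may be arbitrary. -/
theorem lintegral_Ioi_comp_mul_left (F : ℝ → ℝ≥0∞) {a : ℝ} (ha : 0 < a) :
    ∫⁻ τ in Set.Ioi (0 : ℝ), F (a * τ) / ENNReal.ofReal τ =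
      ∫⁻ τ in Set.Ioi (0 : ℝ), F τ / ENNReal.ofReal τ := by
  rw [← lintegral_indicator measurableSet_Ioi, ← lintegral_indicator measurableSet_Ioi]
  conv_rhs => rw [← Real.smul_map_volume_mul_left ha.ne']
  rw [lintegral_smul_measure]
  have := lintegral_map_equiv (μ := (volume : Measure ℝ))
    ((Set.Ioi (0 : ℝ)).indicator fun τ => F τ / ENNReal.ofReal τ)
    (Homeomorph.mulLeft₀ a ha.ne').toMeasurableEquiv
  simp only [Homeomorph.toMeasurableEquiv_coe, Homeomorph.coe_mulLeft₀] at this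
  rw [this, smul_eq_mul, ← lintegral_const_mul' _ _ ENNReal.ofReal_ne_top]
  refine lintegral_congr fun τ => ?_
  by_cases hτ : 0 < τ
  · have hat : 0 < a * τ := mul_pos ha hτ
    rw [Set.indicator_of_mem (Set.mem_Ioi.2 hτ), Set.indicator_of_mem (Set.mem_Ioi.2 hat),
      abs_of_pos ha, ENNReal.ofReal_mul ha.le, div_eq_mul_inv, div_eq_mul_inv,
      ENNReal.mul_inv (by simp [ha]) (by simp), ← mul_assoc,
      mul_comm (ENNReal.ofReal a), mul_assoc (F _), ← mul_assoc (ENNReal.ofReal a),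
      ENNReal.mul_inv_cancel (by simpa using ha) ENNReal.ofReal_ne_top, one_mul]
  · have hat : ¬ 0 < a * τ := by
      rw [mul_pos_iff_of_pos_left ha]; exact hτ
    simp [Set.indicator, hτ, hat]

theorem mulNorm_comp_mul_left (q : ℝ≥0∞) (φ : ℝ → ℝ≥0∞) {a : ℝ} (ha : 0 < a) :
    mulNorm q (fun τ => φ (a * τ)) = mulNorm q φ := by
  unfold mulNorm
  split_ifs with h
  · apply le_antisymm
    · exact iSup₂_le fun τ hτ => le_iSup₂ (f := fun (τ : ℝ) (_ : 0 < τ) => φ τ) (a * τ)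
        (mul_pos ha hτ)
    · refine iSup₂_le fun τ hτ => ?_
      have := le_iSup₂ (f := fun (τ : ℝ) (_ : 0 < τ) => φ (a * τ)) (a⁻¹ * τ)
        (mul_pos (inv_pos.2 ha) hτ)
      rwa [mul_inv_cancel_left₀ ha.ne'] at this
  · rw [lintegral_Ioi_comp_mul_left (fun τ => φ τ ^ q.toReal) ha]

theorem lintegral_mul_div_le_mulNorm {q q' : ℝ≥0∞} [hqq : ENNReal.HolderConjugate q q']
    {φ ψ : ℝ → ℝ≥0∞} (hφ : Measurable φ) (hψ : Measurable ψ) :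
    ∫⁻ τ in Set.Ioi (0 : ℝ), φ τ * ψ τ / ENNReal.ofReal τ ≤ mulNorm q φ * mulNorm q' ψ := by
  -- The two endpoint pairs of exponents are one and the same estimate, a supremum times an
  -- integral, up to exchanging the factors.
  have key : ∀ (φ ψ : ℝ → ℝ≥0∞), Measurable ψ →
      ∫⁻ τ in Set.Ioi (0 : ℝ), φ τ * ψ τ / ENNReal.ofReal τ ≤ mulNorm ∞ φ * mulNorm 1 ψ := by
    intro φ ψ hψ
    simp only [mulNorm, if_true, ENNReal.one_ne_top, if_false, ENNReal.toReal_one,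
      ENNReal.rpow_one, div_one]
    rw [← lintegral_const_mul _ (by fun_prop)]
    refine setLIntegral_mono' measurableSet_Ioi fun τ hτ => ?_
    rw [mul_div_assoc]
    gcongr
    exact le_iSup₂ (f := fun (τ : ℝ) (_ : 0 < τ) => φ τ) τ hτ
  rcases eq_or_ne q ∞ with rfl | hq
  · have : q' = 1 := by
      have := hqq.inv_add_inv_eq_inv
      simpa using this
    subst this
    exact key φ ψ hψ
  rcases eq_or_ne q' ∞ with rfl | hq'
  · have : q = 1 := by
      have := hqq.inv_add_inv_eq_inv
      simpa using this
    subst this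
    rw [mul_comm]
    simp_rw [mul_comm (φ _)]
    exact key ψ φ hφ
  · have h := ENNReal.HolderConjugate.toReal_of_ne_top (p := q) (q := q') hq hq'
    simp only [mulNorm, hq, hq', if_false]
    have h2 := ENNReal.lintegral_mul_le_Lp_mul_Lq
      ((volume.restrict (Set.Ioi (0 : ℝ))).withDensity fun τ => (ENNReal.ofReal τ)⁻¹) h
      hφ.aemeasurable hψ.aemeasurable
    rw [lintegral_withDensity_eq_lintegral_mul _ (by fun_prop) (hφ.mul hψ),
      lintegral_withDensity_eq_lintegral_mul _ (by fun_prop) (hφ.pow_const _),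
      lintegral_withDensity_eq_lintegral_mul _ (by fun_prop) (hψ.pow_const _)] at h2
    simpa only [Pi.mul_apply, div_eq_mul_inv, mul_comm] using h2

/-! ### Lorentz quasi-norms -/

section Lorentz

variable {X : Type*} [MeasurableSpace X] {μ : Measure X} {f g : X → ℂ} {p : ℝ} {q : ℝ≥0∞}

theorem lorentzNorm_mono_rearrangement {Y : Type*} [MeasurableSpace Y] {ν : Measure Y} {h : Y → ℂ}
    (H : ∀ τ, rearrangement f μ τ ≤ rearrangement h ν τ) :
    lorentzNorm p q f μ ≤ lorentzNorm p q h ν := by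
  simp only [lorentzNorm_eq_mulNorm]
  refine mulNorm_mono fun τ _ => ?_
  gcongr
  exact H _

theorem lorentzNorm_mono_ae (h : ∀ᵐ x ∂μ, ‖f x‖ₑ ≤ ‖g x‖ₑ) :
    lorentzNorm p q f μ ≤ lorentzNorm p q g μ :=
  lorentzNorm_mono_rearrangement (rearrangement_mono_ae h)

theorem lorentzNorm_congr_ae (h : f =ᵐ[μ] g) : lorentzNorm p q f μ = lorentzNorm p q g μ :=
  le_antisymm (lorentzNorm_mono_rearrangement fun τ => (rearrangement_congr_ae h τ).le)
    (lorentzNorm_mono_rearrangement fun τ => (rearrangement_congr_ae h τ).ge)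

theorem lorentzNorm_indicator {Q : Set X} (hQ : MeasurableSet Q) (f : X → ℂ) (μ : Measure X) :
    lorentzNorm p q (Q.indicator f) μ = lorentzNorm p q f (μ.restrict Q) :=
  le_antisymm (lorentzNorm_mono_rearrangement fun τ => (rearrangement_indicator hQ f μ τ).le)
    (lorentzNorm_mono_rearrangement fun τ => (rearrangement_indicator hQ f μ τ).ge)

theorem lorentzNorm_const_smul_le (hq : 1 ≤ q) (c : ℂ) (f : X → ℂ) (μ : Measure X) :
    lorentzNorm p q (c • f) μ ≤ ‖c‖ₑ * lorentzNorm p q f μ := by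
  simp only [lorentzNorm_eq_mulNorm]
  rw [← mulNorm_const_mul hq enorm_ne_top]
  refine mulNorm_mono fun τ _ => ?_
  rw [mul_left_comm]
  gcongr
  exact rearrangement_const_smul_le c f μ _

theorem measurable_rpow_mul_rearrangement (p : ℝ) (f : X → ℂ) (μ : Measure X) :
    Measurable fun τ : ℝ =>
      ENNReal.ofReal τ ^ (1 / p) * rearrangement f μ (ENNReal.ofReal τ) :=
  (Measurable.pow_const (by fun_prop) _).mul (measurable_rearrangement f μ)

/-- Writing `τ^{1/p} = a^{-1/p} (aτ)^{1/p}` leaves a dilate of the Lorentz integrand, whose norm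
does not change. -/
theorem mulNorm_rearrangement_comp_mul (hq : 1 ≤ q) (p : ℝ) (f : X → ℂ) (μ : Measure X) {a : ℝ}
    (ha : 0 < a) : mulNorm q (fun τ => ENNReal.ofReal τ ^ (1 / p) *
      rearrangement f μ (ENNReal.ofReal (a * τ))) =
      ENNReal.ofReal a ^ (-(1 / p)) * lorentzNorm p q f μ := by
  have h0 : ENNReal.ofReal a ≠ 0 := by simpa using ha
  rw [lorentzNorm_eq_mulNorm]
  conv_rhs => rw [← mulNorm_comp_mul_left q _ ha]
  rw [← mulNorm_const_mul hq (ENNReal.rpow_ne_top_of_ne_zero h0 ENNReal.ofReal_ne_top)]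
  congr 1
  ext τ
  rw [ENNReal.ofReal_mul ha.le, ENNReal.mul_rpow_of_ne_top ENNReal.ofReal_ne_top
    ENNReal.ofReal_ne_top, ← mul_assoc, ← mul_assoc, ← ENNReal.rpow_add _ _ h0
    ENNReal.ofReal_ne_top]
  simp

/-- A pointwise bound of a rearrangement by a superposition of dilations of another one. -/
theorem lorentzNorm_le_of_rearrangement_le {β : Type*} [Denumerable β] (hq : 1 ≤ q)
    {Y : Type*} [MeasurableSpace Y] {ν : Measure Y} {g : Y → ℂ}
    {w : β → ℝ≥0∞} (hw : ∀ k, w k ≠ ∞) {a : β → ℝ} (ha : ∀ k, 0 < a k)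
    (h : ∀ τ : ℝ, 0 < τ → rearrangement g ν (ENNReal.ofReal (2 * τ)) ≤
      ∑' k, w k * rearrangement f μ (ENNReal.ofReal (a k * τ))) :
    lorentzNorm p q g ν ≤
      2 ^ (1 / p) * (∑' k, w k * ENNReal.ofReal (a k) ^ (-(1 / p))) * lorentzNorm p q f μ := by
  -- The factor `2^{1/p}` pays for the dilation by 2 in the hypothesis on `g`.
  have h1 := mulNorm_rearrangement_comp_mul hq p g ν (a := 2) two_pos
  have h2 : lorentzNorm p q g ν = 2 ^ (1 / p) * mulNorm q (fun τ => ENNReal.ofReal τ ^ (1 / p) *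
      rearrangement g ν (ENNReal.ofReal (2 * τ))) := by
    rw [h1, ← mul_assoc, show ENNReal.ofReal 2 = 2 by simp, ← ENNReal.rpow_add _ _ (by simp)
      (by simp)]
    simp
  rw [h2, mul_assoc]
  gcongr
  rw [← ENNReal.tsum_mul_right]
  calc _ ≤ mulNorm q (fun τ => ∑' k, w k * (ENNReal.ofReal τ ^ (1 / p) *
        rearrangement f μ (ENNReal.ofReal (a k * τ)))) := by
        refine mulNorm_mono fun τ hτ => ?_
        simp_rw [mul_left_comm (w _)]
        rw [ENNReal.tsum_mul_left]
        gcongr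
        exact h τ hτ
    _ ≤ _ := mulNorm_tsum_le hq fun k => ((Measurable.pow_const (by fun_prop) _).mul
        ((measurable_rearrangement f μ).comp (measurable_const_mul (a k)))).const_mul _
    _ = _ := by
        refine tsum_congr fun k => ?_
        rw [mulNorm_const_mul hq (hw k), mulNorm_rearrangement_comp_mul hq p f μ (ha k), mul_assoc]

theorem mulNorm_add_le (hq : 1 ≤ q) {φ ψ : ℝ → ℝ≥0∞} (hφ : Measurable φ) (hψ : Measurable ψ) :
    mulNorm q (fun τ => φ τ + ψ τ) ≤ mulNorm q φ + mulNorm q ψ := by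
  have h0 : mulNorm q (fun _ => 0) = 0 := by
    simpa using mulNorm_const_mul hq ENNReal.zero_ne_top (fun _ => 0)
  -- The two terms are padded with zeros to a series over `ℕ`.
  have := mulNorm_tsum_le hq (φ := fun k : ℕ => if k = 0 then φ else if k = 1 then ψ
    else fun _ => 0) (fun k => by split_ifs <;> fun_prop)
  have h2 : ∀ τ, ∑' k : ℕ, (if k = 0 then φ else if k = 1 then ψ else fun _ => 0) τ =
      φ τ + ψ τ := by
    intro τ
    rw [tsum_eq_sum (s := {0, 1})]
    · simp
    · intro k hk
      simp only [Finset.mem_insert, Finset.mem_singleton, not_or] at hk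
      simp [hk.1, hk.2]
  have h3 : ∑' k : ℕ, mulNorm q (if k = 0 then φ else if k = 1 then ψ else fun _ => 0) =
      mulNorm q φ + mulNorm q ψ := by
    rw [tsum_eq_sum (s := {0, 1})]
    · simp
    · intro k hk
      simp only [Finset.mem_insert, Finset.mem_singleton, not_or] at hk
      simp [hk.1, hk.2, h0]
  simp_rw [h2] at this
  rwa [h3] at this

/-- Splitting `τ = τ/2 + τ/2` gives `(f+g)^*(τ) ≤ f^*(τ/2) + g^*(τ/2)`; undoing the dilation by
`1/2` produces the constant. -/
theorem lorentzNorm_add_le (hq : 1 ≤ q) (p : ℝ) (f g : X → ℂ) (μ : Measure X) :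
    lorentzNorm p q (f + g) μ ≤ 2 ^ (1 / p) * (lorentzNorm p q f μ + lorentzNorm p q g μ) := by
  have hs : ∀ h : X → ℂ, 2 ^ (1 / p) * lorentzNorm p q h μ =
      mulNorm q (fun τ => ENNReal.ofReal τ ^ (1 / p) *
        rearrangement h μ (ENNReal.ofReal (2⁻¹ * τ))) := by
    intro h
    rw [mulNorm_rearrangement_comp_mul hq p h μ (a := 2⁻¹) (by norm_num)]
    congr 1
    rw [ENNReal.ofReal_inv_of_pos two_pos, ENNReal.inv_rpow, ← ENNReal.rpow_neg]
    simp
  rw [mul_add, hs, hs, lorentzNorm_eq_mulNorm]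
  have hm : ∀ h : X → ℂ, Measurable fun τ : ℝ => ENNReal.ofReal τ ^ (1 / p) *
      rearrangement h μ (ENNReal.ofReal (2⁻¹ * τ)) := fun h =>
    (Measurable.pow_const (by fun_prop) _).mul
        ((measurable_rearrangement h μ).comp (measurable_const_mul _))
  refine le_trans (mulNorm_mono fun τ hτ => ?_) (mulNorm_add_le hq (hm f) (hm g))
  rw [← mul_add]
  gcongr
  refine le_trans (le_of_eq ?_) (rearrangement_add_le f g μ _ _)
  rw [← ENNReal.ofReal_add (by positivity) (by positivity)]
  congr 2
  ring

theorem lorentzNorm_zero (hq : 1 ≤ q) : lorentzNorm p q (0 : X → ℂ) μ = 0 := by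
  simpa using lorentzNorm_const_smul_le (p := p) hq 0 (0 : X → ℂ) μ

/-- The constant is exponential in the number of terms. This is harmless, since the sums in question
run over the neighbours of one cube, a number that depends only on `n`. -/
theorem lorentzNorm_sum_le {ι : Type*} (hq : 1 ≤ q) (hp : 0 < p) (s : Finset ι) (F : ι → X → ℂ)
    (μ : Measure X) : lorentzNorm p q (∑ i ∈ s, F i) μ ≤
      (2 ^ (1 / p)) ^ s.card * ∑ i ∈ s, lorentzNorm p q (F i) μ := by
  classical
  induction s using Finset.induction_on with
  | empty => simp [lorentzNorm_zero hq]
  | insert i s hi ih =>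
    rw [Finset.sum_insert hi, Finset.sum_insert hi, Finset.card_insert_of_notMem hi, pow_succ',
      mul_assoc]
    have h1 : (1 : ℝ≥0∞) ≤ (2 ^ (1 / p)) ^ s.card :=
      one_le_pow₀ (ENNReal.one_le_rpow one_le_two (by positivity))
    refine (lorentzNorm_add_le hq p _ _ μ).trans ?_
    gcongr
    rw [mul_add]
    gcongr
    exact le_mul_of_one_le_left' h1

theorem lintegral_Ioi_ite_lt (a : ℝ≥0∞) : ∫⁻ s in Set.Ioi (0 : ℝ),
    (if ENNReal.ofReal s < a then 1 else 0 : ℝ≥0∞) = a := by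
  have : ∀ s : ℝ, (if ENNReal.ofReal s < a then 1 else 0 : ℝ≥0∞) =
      {s : ℝ | ENNReal.ofReal s < a}.indicator (fun _ => (1 : ℝ≥0∞)) s := fun s => by
    simp [Set.indicator]
  simp_rw [this]
  have hm : MeasurableSet {s : ℝ | ENNReal.ofReal s < a} :=
    measurableSet_lt (by fun_prop) measurable_const
  rw [lintegral_indicator hm, setLIntegral_one, Measure.restrict_apply hm]
  rcases eq_or_ne a ∞ with rfl | ha
  · simp
  · have : {s : ℝ | ENNReal.ofReal s < a} ∩ Set.Ioi 0 = Set.Ioo 0 a.toReal := by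
      ext s
      simp only [Set.mem_inter_iff, Set.mem_ofPred_eq, Set.mem_Ioi, Set.mem_Ioo]
      constructor
      · rintro ⟨h1, h2⟩
        exact ⟨h2, (ENNReal.ofReal_lt_iff_lt_toReal h2.le ha).1 h1⟩
      · rintro ⟨h1, h2⟩
        exact ⟨(ENNReal.ofReal_lt_iff_lt_toReal h1.le ha).2 h2, h1⟩
    rw [this]
    simp [ha]

theorem measurable_ite_ofReal_lt {α : Type*} [MeasurableSpace α] {h : α → ℝ≥0∞}
    (hh : Measurable h) : Measurable fun z : α × ℝ => (if ENNReal.ofReal z.2 < h z.1 then 1 else 0 : ℝ≥0∞) :=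
  Measurable.ite (measurableSet_lt (by fun_prop) (by fun_prop)) measurable_const
    measurable_const

/-- Layer-cake representation of both factors followed by Tonelli. Applied to both sides of the
Hardy–Littlewood inequality, it reduces that inequality to indicator functions. -/
theorem lintegral_mul_eq_lintegral_ite {α : Type*} [MeasurableSpace α] (ν : Measure α) [SFinite ν]
    {F G : α → ℝ≥0∞} (hF : Measurable F) (hG : Measurable G) : ∫⁻ x, F x * G x ∂ν =
    ∫⁻ s in Set.Ioi (0 : ℝ), ∫⁻ u in Set.Ioi (0 : ℝ), ∫⁻ x,
      (if ENNReal.ofReal s < F x then 1 else 0 : ℝ≥0∞) *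
      (if ENNReal.ofReal u < G x then 1 else 0 : ℝ≥0∞) ∂ν := by
  have m2 : Measurable fun z : (ℝ × ℝ) × α => (if ENNReal.ofReal z.1.1 < F z.2 then 1 else 0 :
      ℝ≥0∞) * (if ENNReal.ofReal z.1.2 < G z.2 then 1 else 0 : ℝ≥0∞) :=
    ((measurable_ite_ofReal_lt hF).comp (g := fun z : α × ℝ => _) (f := fun z : (ℝ × ℝ) × α => (z.2, z.1.1))
      (by fun_prop)).mul ((measurable_ite_ofReal_lt hG).comp (g := fun z : α × ℝ => _)
        (f := fun z : (ℝ × ℝ) × α => (z.2, z.1.2)) (by fun_prop))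
  have m3 : Measurable fun z : ℝ × α => (if ENNReal.ofReal z.1 < F z.2 then 1 else 0 :
      ℝ≥0∞) * G z.2 :=
    ((measurable_ite_ofReal_lt hF).comp (g := fun z : α × ℝ => _) (f := fun z : ℝ × α => (z.2, z.1))
      (by fun_prop)).mul (by fun_prop)
  have inner : ∀ s : ℝ, ∫⁻ u in Set.Ioi (0 : ℝ), ∫⁻ x,
      (if ENNReal.ofReal s < F x then 1 else 0 : ℝ≥0∞) *
      (if ENNReal.ofReal u < G x then 1 else 0 : ℝ≥0∞) ∂ν =
      ∫⁻ x, (if ENNReal.ofReal s < F x then 1 else 0 : ℝ≥0∞) * G x ∂ν := by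
    intro s
    rw [lintegral_lintegral_swap]
    · refine lintegral_congr fun x => ?_
      rw [lintegral_const_mul' _ _ (by split_ifs <;> simp), lintegral_Ioi_ite_lt]
    · exact (m2.comp (f := fun z : ℝ × α => ((s, z.1), z.2)) (by fun_prop)).aemeasurable
  simp_rw [inner]
  rw [lintegral_lintegral_swap]
  · refine lintegral_congr fun x => ?_
    rw [lintegral_mul_const'' _ ?_, lintegral_Ioi_ite_lt]
    exact ((measurable_ite_ofReal_lt hF).comp (g := fun z : α × ℝ => _) (f := fun s : ℝ => (x, s))
      (by fun_prop)).aemeasurable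
  · exact m3.aemeasurable

/-- The Hardy-Littlewood rearrangement inequality. -/
theorem lintegral_mul_le_lintegral_rearrangement [SFinite μ] (hf : Measurable f)
    (hg : Measurable g) : ∫⁻ x, ‖f x‖ₑ * ‖g x‖ₑ ∂μ ≤
      ∫⁻ τ in Set.Ioi (0 : ℝ), rearrangement f μ (ENNReal.ofReal τ) *
        rearrangement g μ (ENNReal.ofReal τ) := by
  have step : ∀ s u : ℝ, ∫⁻ x, (if ENNReal.ofReal s < ‖f x‖ₑ then 1 else 0 : ℝ≥0∞) *
      (if ENNReal.ofReal u < ‖g x‖ₑ then 1 else 0 : ℝ≥0∞) ∂μ ≤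
      ∫⁻ τ in Set.Ioi (0 : ℝ), (if ENNReal.ofReal s < rearrangement f μ (ENNReal.ofReal τ)
        then 1 else 0 : ℝ≥0∞) * (if ENNReal.ofReal u < rearrangement g μ (ENNReal.ofReal τ)
        then 1 else 0 : ℝ≥0∞) := by
    intro s u
    set A := {x | ENNReal.ofReal s < ‖f x‖ₑ}
    set B := {x | ENNReal.ofReal u < ‖g x‖ₑ}
    have hA : MeasurableSet A := measurableSet_lt measurable_const hf.enorm
    have hB : MeasurableSet B := measurableSet_lt measurable_const hg.enorm
    have e1 : ∀ x, (if ENNReal.ofReal s < ‖f x‖ₑ then 1 else 0 : ℝ≥0∞) *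
      (if ENNReal.ofReal u < ‖g x‖ₑ then 1 else 0 : ℝ≥0∞) =
        (A ∩ B).indicator (fun _ => (1 : ℝ≥0∞)) x := by
      intro x
      by_cases h1 : ENNReal.ofReal s < ‖f x‖ₑ <;> by_cases h2 : ENNReal.ofReal u < ‖g x‖ₑ <;>
        simp [Set.indicator, A, B, h1, h2]
    simp_rw [e1]
    rw [lintegral_indicator (hA.inter hB), setLIntegral_one]
    simp_rw [lt_rearrangement_iff]
    -- For level sets the right-hand side is exactly `min (μ A) (μ B)`, which dominates `μ (A ∩ B)`.
    have e2 : ∀ τ : ℝ, (if ENNReal.ofReal τ < μ A then 1 else 0 : ℝ≥0∞) *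
        (if ENNReal.ofReal τ < μ B then 1 else 0 : ℝ≥0∞) =
        (if ENNReal.ofReal τ < min (μ A) (μ B) then 1 else 0 : ℝ≥0∞) := by
      intro τ
      by_cases h1 : ENNReal.ofReal τ < μ A <;> by_cases h2 : ENNReal.ofReal τ < μ B <;>
        simp [h1, h2]
    change _ ≤ ∫⁻ τ in Set.Ioi (0 : ℝ), (if ENNReal.ofReal τ < μ A then 1 else 0 : ℝ≥0∞) *
        (if ENNReal.ofReal τ < μ B then 1 else 0 : ℝ≥0∞)
    simp_rw [e2]
    rw [lintegral_Ioi_ite_lt]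
    exact le_min (measure_mono Set.inter_subset_left) (measure_mono Set.inter_subset_right)
  rw [lintegral_mul_eq_lintegral_ite μ hf.enorm hg.enorm,
    lintegral_mul_eq_lintegral_ite _ (measurable_rearrangement f μ) (measurable_rearrangement g μ)]
  exact lintegral_mono fun s => lintegral_mono fun u => step s u

theorem lintegral_mul_le_lorentzNorm_of_measurable [SFinite μ] {p' : ℝ} {q' : ℝ≥0∞}
    (hp : p.HolderConjugate p') [ENNReal.HolderConjugate q q'] (hf : Measurable f)
    (hg : Measurable g) :
    ∫⁻ x, ‖f x‖ₑ * ‖g x‖ₑ ∂μ ≤ lorentzNorm p q f μ * lorentzNorm p' q' g μ := by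
  refine (lintegral_mul_le_lintegral_rearrangement hf hg).trans ?_
  refine le_trans (le_of_eq ?_) (lintegral_mul_div_le_mulNorm (q := q) (q' := q')
    (measurable_rpow_mul_rearrangement p f μ) (measurable_rpow_mul_rearrangement p' g μ))
  refine setLIntegral_congr_fun measurableSet_Ioi fun τ hτ => ?_
  have h0 : ENNReal.ofReal τ ≠ 0 := by simpa using hτ
  have h1 : ENNReal.ofReal τ ^ (1 / p) * ENNReal.ofReal τ ^ (1 / p') = ENNReal.ofReal τ := by
    rw [← ENNReal.rpow_add _ _ h0 ENNReal.ofReal_ne_top, one_div, one_div,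
      hp.inv_add_inv_eq_one, ENNReal.rpow_one]
  rw [mul_mul_mul_comm, h1, mul_comm (ENNReal.ofReal τ), ENNReal.mul_div_cancel_right h0 ENNReal.ofReal_ne_top]

/-- Hölder's inequality in Lorentz spaces. -/
theorem lintegral_mul_le_lorentzNorm [SFinite μ] {p' : ℝ} {q' : ℝ≥0∞}
    (hp : p.HolderConjugate p') [ENNReal.HolderConjugate q q'] (hf : AEMeasurable f μ)
    (hg : AEMeasurable g μ) :
    ∫⁻ x, ‖f x‖ₑ * ‖g x‖ₑ ∂μ ≤ lorentzNorm p q f μ * lorentzNorm p' q' g μ := by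
  rw [lorentzNorm_congr_ae hf.ae_eq_mk, lorentzNorm_congr_ae hg.ae_eq_mk]
  refine le_trans (le_of_eq (lintegral_congr_ae ?_))
    (lintegral_mul_le_lorentzNorm_of_measurable hp hf.measurable_mk hg.measurable_mk)
  filter_upwards [hf.ae_eq_mk, hg.ae_eq_mk] with x h1 h2
  rw [h1, h2]

/-- This is the embedding of `L^{p,q}` into `L^{p,∞}`. Since `f^*` decreases, the integrand on
`(τ/2, τ)` is at least its value with `f^*(τ)` and `(τ/2)^{1/p}`, and that interval has `dτ/τ`-mass
at least `1/2`. The constant is `2^{1/p} 2^{1/q} ≤ 4`. -/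
theorem rpow_mul_rearrangement_le_lorentzNorm (hp : 1 ≤ p) (hq : 1 ≤ q) {τ : ℝ} (hτ : 0 < τ) :
    ENNReal.ofReal τ ^ (1 / p) * rearrangement f μ (ENNReal.ofReal τ) ≤
      4 * lorentzNorm p q f μ := by
  have hp' : 0 ≤ 1 / p := by positivity
  by_cases h : q = ∞
  · simp only [lorentzNorm, h, if_true]
    refine le_trans (le_iSup₂ (f := fun (τ : ℝ) (_ : 0 < τ) =>
      ENNReal.ofReal τ ^ (1 / p) * rearrangement f μ (ENNReal.ofReal τ)) τ hτ) ?_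
    exact le_mul_of_one_le_left' (by norm_num)
  · have h1 := one_le_toReal hq h
    have hq0 : 0 < q.toReal := by linarith
    simp only [lorentzNorm, h, if_false]
    set L := ∫⁻ τ in Set.Ioi (0 : ℝ), (ENNReal.ofReal τ ^ (1 / p) *
      rearrangement f μ (ENNReal.ofReal τ)) ^ q.toReal / ENNReal.ofReal τ
    set a := ENNReal.ofReal (τ / 2) ^ (1 / p) * rearrangement f μ (ENNReal.ofReal τ)
    have h0 : ENNReal.ofReal τ ≠ 0 := by simpa using hτ
    have key : a ^ q.toReal * 2⁻¹ ≤ L := by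
      calc a ^ q.toReal * 2⁻¹ = ∫⁻ _ in Set.Ioo (τ / 2) τ, a ^ q.toReal / ENNReal.ofReal τ := by
            rw [setLIntegral_const, Real.volume_Ioo, div_eq_mul_inv, mul_assoc]
            congr 1
            rw [show τ - τ / 2 = 2⁻¹ * τ by ring, ENNReal.ofReal_mul (by norm_num), mul_comm,
              mul_assoc, ENNReal.mul_inv_cancel h0 ENNReal.ofReal_ne_top, mul_one,
              ENNReal.ofReal_inv_of_pos two_pos]
            simp
        _ ≤ ∫⁻ s in Set.Ioo (τ / 2) τ, (ENNReal.ofReal s ^ (1 / p) *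
            rearrangement f μ (ENNReal.ofReal s)) ^ q.toReal / ENNReal.ofReal s := by
            refine setLIntegral_mono' measurableSet_Ioo fun s hs => ?_
            have hs1 := hs.1.le
            have hs2 := hs.2.le
            gcongr
            simp only [a]
            gcongr
            exact rearrangement_antitone f μ (ENNReal.ofReal_le_ofReal hs2)
        _ ≤ L := lintegral_mono_set fun s hs => (half_pos hτ).trans hs.1
    have ha : a ≤ 2 * L ^ (1 / q.toReal) := by
      have : a ^ q.toReal ≤ 2 * L := by
        rw [mul_comm] at key
        rwa [ENNReal.inv_mul_le_iff (by simp) (by simp)] at key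
      calc a = (a ^ q.toReal) ^ (1 / q.toReal) := by
            rw [← ENNReal.rpow_mul, mul_one_div_cancel hq0.ne', ENNReal.rpow_one]
        _ ≤ (2 * L) ^ (1 / q.toReal) := by gcongr
        _ = 2 ^ (1 / q.toReal) * L ^ (1 / q.toReal) := ENNReal.mul_rpow_of_nonneg _ _ (by positivity)
        _ ≤ _ := by
            gcongr
            calc (2 : ℝ≥0∞) ^ (1 / q.toReal) ≤ 2 ^ (1 : ℝ) :=
                  ENNReal.rpow_le_rpow_of_exponent_le one_le_two
                    (by rw [div_le_one hq0]; exact h1)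
              _ = 2 := ENNReal.rpow_one 2
    calc ENNReal.ofReal τ ^ (1 / p) * rearrangement f μ (ENNReal.ofReal τ)
        = 2 ^ (1 / p) * a := by
          simp only [a]
          rw [← mul_assoc, ← ENNReal.mul_rpow_of_nonneg _ _ hp', ← ENNReal.ofReal_ofNat 2,
            ← ENNReal.ofReal_mul (by norm_num)]
          congr 3
          ring
      _ ≤ 2 ^ (1 : ℝ) * (2 * L ^ (1 / q.toReal)) := by
          refine mul_le_mul' (ENNReal.rpow_le_rpow_of_exponent_le one_le_two ?_) ha
          rw [div_le_one (by linarith)]; exact hp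
      _ = _ := by rw [ENNReal.rpow_one, ← mul_assoc]; norm_num

theorem lintegral_Ioo_rpow_div {s : ℝ} (hs : 0 < s) {a : ℝ} (ha : 0 ≤ a) :
    ∫⁻ τ in Set.Ioo (0 : ℝ) a, ENNReal.ofReal τ ^ s / ENNReal.ofReal τ =
      ENNReal.ofReal (a ^ s / s) := by
  have h1 : ∫⁻ τ in Set.Ioo (0 : ℝ) a, ENNReal.ofReal τ ^ s / ENNReal.ofReal τ =
      ∫⁻ τ in Set.Ioo (0 : ℝ) a, ENNReal.ofReal (τ ^ (s - 1)) := by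
    refine setLIntegral_congr_fun measurableSet_Ioo fun τ hτ => ?_
    rw [← ENNReal.ofReal_rpow_of_pos hτ.1, ENNReal.rpow_sub _ _ (by simpa using hτ.1)
      ENNReal.ofReal_ne_top, ENNReal.rpow_one]
  have hint : IntegrableOn (fun τ : ℝ => τ ^ (s - 1)) (Set.Ioo 0 a) := by
    have := (intervalIntegral.intervalIntegrable_rpow' (a := 0) (b := a) (r := s - 1)
      (by linarith)).1
    exact this.mono_set Set.Ioo_subset_Ioc_self
  rw [h1, ← ofReal_integral_eq_lintegral_ofReal hint]
  · rw [← integral_Ioc_eq_integral_Ioo, ← intervalIntegral.integral_of_le ha,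
      integral_rpow (Or.inl (by linarith))]
    simp [hs.ne']
  · exact (ae_restrict_iff' measurableSet_Ioo).2 (ae_of_all _ fun τ hτ =>
      Real.rpow_nonneg hτ.1.le _)

/-- The Lorentz norm of a bounded function supported on a set of finite measure. -/
theorem exists_lorentzNorm_le_of_bounded (hp : 1 ≤ p) (hq : 1 ≤ q) : ∃ C : ℝ≥0,
    ∀ {X : Type} [MeasurableSpace X] (μ : Measure X) (f : X → ℂ) (M : ℝ≥0∞) (E : Set X),
      M ≠ ∞ → μ E ≠ ∞ → (∀ᵐ x ∂μ, ‖f x‖ₑ ≤ M) → (∀ᵐ x ∂μ, x ∉ E → f x = 0) →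
      lorentzNorm p q f μ ≤ C * M * μ E ^ (1 / p) := by
  have hp' : 0 < 1 / p := by positivity
  -- For finite `q` this is the `q`-th root of `∫₀¹ τ^{q/p} dτ/τ = p/q`.
  refine ⟨if q = ∞ then 1 else ((p / q.toReal) ^ (1 / q.toReal)).toNNReal, ?_⟩
  intro X _ μ f M E hMtop hE hM hfE
  have hr := rearrangement_le_of_bounded hM hfE
  by_cases h : q = ∞
  · simp only [lorentzNorm, h, if_true, ENNReal.coe_one, one_mul]
    refine iSup₂_le fun τ hτ => ?_
    rw [mul_comm]
    refine (mul_le_mul_left (hr _) _).trans ?_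
    split_ifs with h2
    · gcongr
    · simp
  · have h1 := one_le_toReal hq h
    have hq0 : 0 < q.toReal := by linarith
    rw [lorentzNorm_eq_mulNorm]
    calc _ ≤ mulNorm q (fun τ => M * (ENNReal.ofReal τ ^ (1 / p) *
          if ENNReal.ofReal τ < μ E then 1 else 0)) := by
          refine mulNorm_mono fun τ hτ => ?_
          rw [mul_left_comm]
          gcongr
          refine (hr _).trans ?_
          split_ifs <;> simp
      _ = M * mulNorm q (fun τ => (ENNReal.ofReal τ ^ (1 / p) *
          if ENNReal.ofReal τ < μ E then 1 else 0)) := mulNorm_const_mul hq hMtop _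
      _ ≤ _ := by
          rw [mul_comm _ M, mul_assoc]
          gcongr
          simp only [mulNorm, h, if_false]
          have e : ∫⁻ τ in Set.Ioi (0 : ℝ), (ENNReal.ofReal τ ^ (1 / p) *
              if ENNReal.ofReal τ < μ E then 1 else 0) ^ q.toReal / ENNReal.ofReal τ =
              ∫⁻ τ in Set.Ioo (0 : ℝ) (μ E).toReal,
                ENNReal.ofReal τ ^ (q.toReal / p) / ENNReal.ofReal τ := by
            rw [← lintegral_indicator measurableSet_Ioi, ← lintegral_indicator measurableSet_Ioo]
            refine lintegral_congr fun τ => ?_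
            by_cases h3 : 0 < τ
            · by_cases h4 : τ < (μ E).toReal
              · have h5 := (ENNReal.ofReal_lt_iff_lt_toReal h3.le hE).2 h4
                rw [Set.indicator_of_mem (Set.mem_Ioi.2 h3), Set.indicator_of_mem (Set.mem_Ioo.2 ⟨h3, h4⟩)]
                simp only [h5, if_true, mul_one]
                rw [← ENNReal.rpow_mul]
                congr 2
                ring
              · have h5 := mt (ENNReal.ofReal_lt_iff_lt_toReal h3.le hE).1 h4
                rw [Set.indicator_of_mem (Set.mem_Ioi.2 h3),
                  Set.indicator_of_notMem (fun h => h4 (Set.mem_Ioo.1 h).2)]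
                simp [h5, hq0]
            · rw [Set.indicator_of_notMem (fun h => h3 (Set.mem_Ioi.1 h)),
                Set.indicator_of_notMem (fun h => h3 (Set.mem_Ioo.1 h).1)]
          rw [e, lintegral_Ioo_rpow_div (by positivity) ENNReal.toReal_nonneg,
            show (μ E).toReal ^ (q.toReal / p) / (q.toReal / p) =
              p / q.toReal * (μ E).toReal ^ (q.toReal / p) by field_simp,
            ENNReal.ofReal_mul (by positivity), ENNReal.mul_rpow_of_nonneg _ _ (by positivity)]
          refine le_of_eq ?_
          congr 1
          · rw [ENNReal.ofReal_rpow_of_nonneg (by positivity) (by positivity)]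
            rfl
          · rw [← ENNReal.ofReal_rpow_of_nonneg ENNReal.toReal_nonneg (by positivity),
              ENNReal.ofReal_toReal hE, ← ENNReal.rpow_mul]
            congr 1
            field_simp

end Lorentz

/-! ### Geometry of dyadic cubes -/

section Dyadic

variable {n : ℕ}

/-- The position, at scale `j`, of the dyadic cube containing `x`. -/
def cubeIdx (j : ℤ) (x : Rn n) : Fin n → ℤ := fun i => ⌊(2 : ℝ) ^ j * x i⌋

/-- The dyadic cube that is `k` generations above `Q`. -/
def ancestor (k : ℕ) (Q : DyadicIndex n) : DyadicIndex n := (Q.1 - k, fun i => Q.2 i / 2 ^ k)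

/-- The translate of `Q` by `e` times its side length. -/
def shift (e : Fin n → ℤ) (Q : DyadicIndex n) : DyadicIndex n := (Q.1, Q.2 + e)

/-- The positions of a cube and its neighbours. -/
def nbr (n : ℕ) : Finset (Fin n → ℤ) := Fintype.piFinset fun _ => Finset.Icc (-1) 1

/-- The union of a dyadic cube and its neighbours. -/
def triple (Q : DyadicIndex n) : Set (Rn n) := {x | ∀ i, |cubeIdx Q.1 x i - Q.2 i| ≤ 1}

theorem mem_dyadicCube_iff {Q : DyadicIndex n} {x : Rn n} :
    x ∈ dyadicCube Q ↔ cubeIdx Q.1 x = Q.2 := by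
  have h2 : (0 : ℝ) < 2 ^ Q.1 := by positivity
  simp only [dyadicCube, Set.mem_ofPred_eq, funext_iff, cubeIdx, Int.floor_eq_iff]
  refine forall_congr' fun i => ?_
  rw [zpow_neg, inv_mul_le_iff₀ h2, lt_inv_mul_iff₀ h2]

theorem mem_dyadicCube_cubeIdx (j : ℤ) (x : Rn n) : x ∈ dyadicCube (j, cubeIdx j x) :=
  mem_dyadicCube_iff.2 rfl

/-- The floor of `y / 2^k` is the integer quotient of the floor of `y` by `2^k`; this is why
ancestors are given by integer division. -/
theorem cubeIdx_sub (j : ℤ) (k : ℕ) (x : Rn n) :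
    cubeIdx (j - k) x = fun i => cubeIdx j x i / 2 ^ k := by
  ext i
  have := Int.floor_div_natCast ((2 : ℝ) ^ j * x i) (2 ^ k)
  simp only [cubeIdx]
  push_cast at this
  rw [← this, zpow_sub₀ two_ne_zero, zpow_natCast]
  congr 1
  ring

theorem mem_ancestor {Q : DyadicIndex n} {x : Rn n} (hx : x ∈ dyadicCube Q) (k : ℕ) :
    x ∈ dyadicCube (ancestor k Q) := by
  rw [mem_dyadicCube_iff] at hx ⊢
  simp only [ancestor]
  rw [cubeIdx_sub, hx]

theorem ancestor_zero (Q : DyadicIndex n) : ancestor 0 Q = Q := by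
  simp [ancestor]

theorem ancestor_of_mem {Q R : DyadicIndex n} {x : Rn n} (hQ : x ∈ dyadicCube Q)
    (hR : x ∈ dyadicCube R) {k : ℕ} (h : R.1 = Q.1 - k) : ancestor k Q = R := by
  have h1 := mem_dyadicCube_iff.1 (mem_ancestor hQ k)
  have h2 := mem_dyadicCube_iff.1 hR
  refine Prod.ext h.symm ?_
  rw [← h1, ← h2, h]
  rfl

theorem eq_of_mem {Q R : DyadicIndex n} {x : Rn n} (hQ : x ∈ dyadicCube Q)
    (hR : x ∈ dyadicCube R) (h : Q.1 = R.1) : Q = R := by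
  rw [← ancestor_of_mem hQ hR (k := 0) (by simp [h]), ancestor_zero]

theorem measurable_cubeIdx (j : ℤ) : Measurable (cubeIdx j : Rn n → Fin n → ℤ) := by
  refine measurable_pi_lambda _ fun i => ?_
  exact Int.measurable_floor.comp (by fun_prop)

theorem measurableSet_dyadicCube (Q : DyadicIndex n) : MeasurableSet (dyadicCube Q) := by
  have : dyadicCube Q = cubeIdx Q.1 ⁻¹' {Q.2} := by
    ext x
    simp [mem_dyadicCube_iff]
  rw [this]
  exact measurable_cubeIdx _ (measurableSet_singleton _)

theorem measurableSet_triple (Q : DyadicIndex n) : MeasurableSet (triple Q) := by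
  have : triple Q = cubeIdx Q.1 ⁻¹' {m | ∀ i, |m i - Q.2 i| ≤ 1} := rfl
  rw [this]
  exact measurable_cubeIdx _ (Set.to_countable _).measurableSet

theorem volume_dyadicCube (Q : DyadicIndex n) :
    volume (dyadicCube Q) = ENNReal.ofReal (2 ^ (-Q.1)) ^ n := by
  have h : dyadicCube Q = WithLp.ofLp ⁻¹' (Set.univ.pi fun i =>
      Set.Ico ((2 : ℝ) ^ (-Q.1) * (Q.2 i : ℝ)) ((2 : ℝ) ^ (-Q.1) * ((Q.2 i : ℝ) + 1))) := by
    ext x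
    simp [dyadicCube]
  rw [h, (PiLp.volume_preserving_ofLp (Fin n)).measure_preimage
    (MeasurableSet.univ_pi fun _ => measurableSet_Ico).nullMeasurableSet, Real.volume_pi_Ico]
  simp [← mul_sub]

theorem volume_dyadicCube_pos (Q : DyadicIndex n) : 0 < volume (dyadicCube Q) := by
  rw [volume_dyadicCube]
  exact ENNReal.pow_pos (by simp only [ENNReal.ofReal_pos]; positivity) _

theorem volume_dyadicCube_ne_zero (Q : DyadicIndex n) : volume (dyadicCube Q) ≠ 0 :=
  (volume_dyadicCube_pos Q).ne'

theorem volume_dyadicCube_ne_top (Q : DyadicIndex n) : volume (dyadicCube Q) ≠ ∞ := by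
  rw [volume_dyadicCube]
  exact ENNReal.pow_ne_top ENNReal.ofReal_ne_top

theorem volume_dyadicCube_eq_of_scale {Q R : DyadicIndex n} (h : Q.1 = R.1) :
    volume (dyadicCube Q) = volume (dyadicCube R) := by
  rw [volume_dyadicCube, volume_dyadicCube, h]

theorem volume_dyadicCube_of_scale_add {Q R : DyadicIndex n} {k : ℕ} (h : Q.1 = R.1 + k) :
    volume (dyadicCube R) = (2 ^ n) ^ k * volume (dyadicCube Q) := by
  have h2 : ENNReal.ofReal (2 ^ (-R.1)) = 2 ^ k * ENNReal.ofReal (2 ^ (-Q.1)) := by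
    rw [h, neg_add, zpow_add₀ two_ne_zero, ENNReal.ofReal_mul (by positivity), mul_left_comm]
    rw [zpow_neg 2 (k : ℤ), ENNReal.ofReal_inv_of_pos (by positivity), zpow_natCast,
      ENNReal.ofReal_pow (by norm_num)]
    simp only [ENNReal.ofReal_ofNat]
    rw [ENNReal.mul_inv_cancel (by simp) (by simp), mul_one]
  rw [volume_dyadicCube, volume_dyadicCube, h2, mul_pow, ← pow_mul, ← pow_mul, mul_comm k n]

theorem triple_eq_iUnion (Q : DyadicIndex n) :
    triple Q = ⋃ e ∈ nbr n, dyadicCube (shift e Q) := by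
  ext x
  simp only [triple, Set.mem_ofPred_eq, Set.mem_iUnion, mem_dyadicCube_iff, shift, nbr,
    Fintype.mem_piFinset, Finset.mem_Icc, exists_prop]
  constructor
  · intro h
    exact ⟨cubeIdx Q.1 x - Q.2, fun i => by simpa [abs_le] using h i, by simp⟩
  · rintro ⟨e, he, h⟩ i
    rw [h]
    simpa [abs_le] using he i

theorem mem_triple_iff {Q : DyadicIndex n} {x : Rn n} :
    x ∈ triple Q ↔ ∃ e ∈ nbr n, x ∈ dyadicCube (shift e Q) := by
  rw [triple_eq_iUnion]
  simp

theorem neg_mem_nbr {e : Fin n → ℤ} (he : e ∈ nbr n) : -e ∈ nbr n := by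
  simp only [nbr, Fintype.mem_piFinset, Finset.mem_Icc, Pi.neg_apply] at he ⊢
  intro i
  have := he i
  constructor <;> linarith

theorem shift_neg_shift (e : Fin n → ℤ) (Q : DyadicIndex n) : shift (-e) (shift e Q) = Q := by
  simp [shift]

/-- Integers that differ by at most 1 have quotients by `2^k` that differ by at most 1. -/
theorem triple_subset_ancestor (Q : DyadicIndex n) (k : ℕ) : triple Q ⊆ triple (ancestor k Q) := by
  intro x hx i
  have := hx i
  simp only [ancestor]
  rw [cubeIdx_sub]
  beta_reduce
  have hN : (0 : ℤ) < 2 ^ k := by positivity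
  generalize cubeIdx Q.1 x i = a at *
  generalize Q.2 i = b at *
  rw [abs_le] at this ⊢
  have h1 : a / 2 ^ k ≤ (b + 1 * 2 ^ k) / 2 ^ k := Int.ediv_le_ediv hN (by linarith)
  have h2 : b / 2 ^ k ≤ (a + 1 * 2 ^ k) / 2 ^ k := Int.ediv_le_ediv hN (by linarith)
  rw [Int.add_mul_ediv_right _ _ hN.ne'] at h1 h2
  constructor <;> linarith

theorem ancestor_ancestor (k l : ℕ) (Q : DyadicIndex n) :
    ancestor k (ancestor l Q) = ancestor (l + k) Q := by
  refine Prod.ext ?_ ?_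
  · simp only [ancestor]; push_cast; ring
  · ext i
    simp only [ancestor]
    rw [Int.ediv_ediv_of_nonneg (by positivity), pow_add]

theorem triple_ancestor_mono (Q : DyadicIndex n) {k l : ℕ} (h : k ≤ l) :
    triple (ancestor k Q) ⊆ triple (ancestor l Q) := by
  obtain ⟨d, rfl⟩ := Nat.exists_eq_add_of_le h
  rw [← ancestor_ancestor]
  exact triple_subset_ancestor _ _

theorem le_dist_of_notMem_triple {Q : DyadicIndex n} {x y : Rn n} (hx : x ∈ dyadicCube Q)
    (hy : y ∉ triple Q) : (2 : ℝ) ^ (-Q.1) ≤ ‖x - y‖ := by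
  simp only [triple, Set.mem_ofPred_eq, not_forall, not_le] at hy
  obtain ⟨i, hi⟩ := hy
  have hxi := congrFun (mem_dyadicCube_iff.1 hx) i
  rw [← hxi] at hi
  simp only [cubeIdx] at hi
  have h2 : (0 : ℝ) < 2 ^ Q.1 := by positivity
  have h3 : 1 ≤ |(2 : ℝ) ^ Q.1 * y i - 2 ^ Q.1 * x i| := by
    have a1 := Int.floor_le ((2 : ℝ) ^ Q.1 * y i)
    have a2 := Int.lt_floor_add_one ((2 : ℝ) ^ Q.1 * y i)
    have b1 := Int.floor_le ((2 : ℝ) ^ Q.1 * x i)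
    have b2 := Int.lt_floor_add_one ((2 : ℝ) ^ Q.1 * x i)
    generalize ⌊(2 : ℝ) ^ Q.1 * y i⌋ = a at *
    generalize ⌊(2 : ℝ) ^ Q.1 * x i⌋ = b at *
    rw [le_abs]
    rcases lt_abs.1 hi with h | h
    · left
      have : (2 : ℝ) ≤ a - b := by exact_mod_cast (by linarith : (2 : ℤ) ≤ a - b)
      linarith
    · right
      have : (2 : ℝ) ≤ -(a - b) := by exact_mod_cast (by linarith : (2 : ℤ) ≤ -(a - b))
      linarith
  rw [← mul_sub, abs_mul, abs_of_pos h2] at h3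
  rw [zpow_neg, inv_le_iff_one_le_mul₀' h2]
  refine h3.trans ?_
  gcongr
  rw [abs_sub_comm]
  have := PiLp.norm_apply_le (p := 2) (x - y) i
  simpa using this

/-- The ancestors of a cube never leave its orthant and so need not exhaust space; their triples do.
Once `2^k` exceeds the distance of the indices, the quotients are equal or adjacent. -/
theorem exists_mem_triple_ancestor (Q : DyadicIndex n) (y : Rn n) :
    ∃ k, y ∈ triple (ancestor k Q) := by
  obtain ⟨k, hk⟩ : ∃ k : ℕ, ∀ i, |cubeIdx Q.1 y i - Q.2 i| ≤ 2 ^ k := by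
    have h1 : ∀ i, ∃ k : ℕ, |cubeIdx Q.1 y i - Q.2 i| ≤ 2 ^ k := fun i => by
      refine ⟨(|cubeIdx Q.1 y i - Q.2 i|).toNat, ?_⟩
      have := Nat.lt_two_pow_self (n := (|cubeIdx Q.1 y i - Q.2 i|).toNat)
      zify at this
      rw [Int.toNat_of_nonneg (abs_nonneg _)] at this
      exact this.le
    choose K hK using h1
    refine ⟨∑ i, K i, fun i => (hK i).trans ?_⟩
    exact pow_le_pow_right₀ (by norm_num)
      (Finset.single_le_sum (fun _ _ => Nat.zero_le _) (Finset.mem_univ i))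
  refine ⟨k, fun i => ?_⟩
  have := hk i
  simp only [ancestor]
  rw [cubeIdx_sub]
  beta_reduce
  have hN : (0 : ℤ) < 2 ^ k := by positivity
  generalize cubeIdx Q.1 y i = a at *
  generalize Q.2 i = b at *
  rw [abs_le] at this ⊢
  have h1 : a / 2 ^ k ≤ (b + 1 * 2 ^ k) / 2 ^ k := Int.ediv_le_ediv hN (by linarith)
  have h2 : b / 2 ^ k ≤ (a + 1 * 2 ^ k) / 2 ^ k := Int.ediv_le_ediv hN (by linarith)
  rw [Int.add_mul_ediv_right _ _ hN.ne'] at h1 h2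
  constructor <;> linarith

/-- The first generation `k` for which `x` belongs to the triple of the ancestor of `Q`. -/
def annulusIdx (Q : DyadicIndex n) (x : Rn n) : ℕ :=
  open Classical in Nat.find (exists_mem_triple_ancestor Q x)

theorem mem_triple_annulusIdx (Q : DyadicIndex n) (x : Rn n) :
    x ∈ triple (ancestor (annulusIdx Q x) Q) := by
  classical
  exact Nat.find_spec (exists_mem_triple_ancestor Q x)

theorem annulusIdx_le_iff {Q : DyadicIndex n} {x : Rn n} {k : ℕ} :
    annulusIdx Q x ≤ k ↔ x ∈ triple (ancestor k Q) := by
  classical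
  exact ⟨fun h => triple_ancestor_mono Q h (mem_triple_annulusIdx Q x), fun h =>
    Nat.find_min' (exists_mem_triple_ancestor Q x) h⟩

theorem annulusIdx_eq_zero_iff {Q : DyadicIndex n} {x : Rn n} :
    annulusIdx Q x = 0 ↔ x ∈ triple Q := by
  rw [← Nat.le_zero, annulusIdx_le_iff, ancestor_zero]

theorem measurable_annulusIdx (Q : DyadicIndex n) : Measurable (annulusIdx Q) := by
  refine measurable_of_Iic fun k => ?_
  have : annulusIdx Q ⁻¹' Set.Iic k = triple (ancestor k Q) := by
    ext x
    simp [annulusIdx_le_iff]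
  rw [this]
  exact measurableSet_triple _

/-- By minimality, `y` is outside the triple of the ancestor one generation earlier, hence at least
that ancestor's side length away; this accounts for the `-1` in the exponent. -/
theorem scale_le_dist_of_annulusIdx {Q : DyadicIndex n} {x y : Rn n} (hx : x ∈ dyadicCube Q)
    (hy : annulusIdx Q y ≠ 0) : (2 : ℝ) ^ (annulusIdx Q y - Q.1 - 1 : ℤ) ≤ ‖x - y‖ := by
  obtain ⟨k, hk⟩ := Nat.exists_eq_succ_of_ne_zero hy
  have h1 : y ∉ triple (ancestor k Q) := by
    rw [← annulusIdx_le_iff, hk]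
    simp
  have := le_dist_of_notMem_triple (mem_ancestor hx k) h1
  refine le_of_eq_of_le ?_ this
  rw [hk]
  simp only [ancestor]
  congr 1
  push_cast
  ring

/-- The size condition of a kernel, between a cube and a far away point. -/
theorem inv_norm_pow_le_of_annulusIdx {Q : DyadicIndex n} {x y : Rn n} (hx : x ∈ dyadicCube Q)
    (hy : annulusIdx Q y ≠ 0) : ENNReal.ofReal (1 / ‖x - y‖ ^ n) ≤
      2 ^ n * (volume (dyadicCube (ancestor (annulusIdx Q y) Q)))⁻¹ := by
  have h := scale_le_dist_of_annulusIdx hx hy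
  set s : ℝ := (2 : ℝ) ^ (annulusIdx Q y - Q.1 - 1 : ℤ) with hs
  have hs0 : 0 < s := by positivity
  rw [volume_dyadicCube]
  have e : (2 : ℝ) ^ (-(ancestor (annulusIdx Q y) Q).1) = 2 * s := by
    simp only [ancestor, hs]
    rw [← zpow_one_add₀ two_ne_zero]
    congr 1
    ring
  rw [e, ENNReal.ofReal_mul (by norm_num), mul_pow, ENNReal.mul_inv (by simp) (by simp),
    ← mul_assoc, ENNReal.ofReal_ofNat, ENNReal.mul_inv_cancel (by simp) (by simp), one_mul,
    ← ENNReal.ofReal_pow hs0.le, ← ENNReal.ofReal_inv_of_pos (by positivity), one_div]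
  gcongr

theorem norm_sub_le_of_mem {Q : DyadicIndex n} {x y : Rn n} (hx : x ∈ dyadicCube Q)
    (hy : y ∈ dyadicCube Q) : ‖x - y‖ ≤ √n * 2 ^ (-Q.1) := by
  have h0 : (0 : ℝ) ≤ 2 ^ (-Q.1) := by positivity
  rw [EuclideanSpace.norm_eq]
  calc √(∑ i, ‖(x - y) i‖ ^ 2) ≤ √(∑ _i : Fin n, ((2 : ℝ) ^ (-Q.1)) ^ 2) := by
        gcongr with i
        have h1 := hx i
        have h2 := hy i
        simp only [PiLp.sub_apply, Real.norm_eq_abs]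
        rw [abs_le]
        constructor <;> nlinarith
    _ = _ := by
        rw [Finset.sum_const, Finset.card_univ, Fintype.card_fin, nsmul_eq_mul,
          Real.sqrt_mul (by positivity), Real.sqrt_sq h0]

theorem isBounded_dyadicCube (Q : DyadicIndex n) : Bornology.IsBounded (dyadicCube Q) :=
  Metric.isBounded_iff.2 ⟨√n * 2 ^ (-Q.1), fun x hx y hy => by
    rw [dist_eq_norm]; exact norm_sub_le_of_mem hx hy⟩

theorem isBounded_triple (Q : DyadicIndex n) : Bornology.IsBounded (triple Q) := by
  rw [triple_eq_iUnion]
  exact (Bornology.isBounded_biUnion_finset _).2 fun e _ => isBounded_dyadicCube _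

/-- The descendants of a cube, `k` generations below. -/
def child (k : ℕ) (d : Fin n → Fin (2 ^ k)) (R : DyadicIndex n) : DyadicIndex n :=
  (R.1 + k, fun i => 2 ^ k * R.2 i + (d i : ℕ))

theorem ancestor_child (k : ℕ) (d : Fin n → Fin (2 ^ k)) (R : DyadicIndex n) :
    ancestor k (child k d R) = R := by
  refine Prod.ext ?_ ?_
  · simp [ancestor, child]
  · ext i
    simp only [ancestor, child]
    have hN : (0 : ℤ) < 2 ^ k := by positivity
    rw [add_comm, Int.add_mul_ediv_left _ _ hN.ne', Int.ediv_eq_zero_of_lt (by positivity)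
      (by exact_mod_cast (d i).2), zero_add]

/-- Every cube is the descendant, `k` generations below, of exactly one cube. -/
def childEquiv (n k : ℕ) : DyadicIndex n × (Fin n → Fin (2 ^ k)) ≃ DyadicIndex n where
  toFun z := child k z.2 z.1
  invFun Q := (ancestor k Q, fun i => ⟨(Q.2 i % 2 ^ k).toNat, by
    have hN : (0 : ℤ) < 2 ^ k := by positivity
    have h1 := Int.emod_nonneg (Q.2 i) hN.ne'
    have h2 := Int.emod_lt_of_pos (Q.2 i) hN
    zify
    rw [Int.toNat_of_nonneg h1]
    exact h2⟩)
  left_inv z := by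
    refine Prod.ext (ancestor_child _ _ _) ?_
    ext i
    simp only [child]
    have hN : (0 : ℤ) < 2 ^ k := by positivity
    rw [add_comm, Int.add_mul_emod_self_left, Int.emod_eq_of_lt (by positivity)
      (by exact_mod_cast (z.2 i).2)]
    simp
  right_inv Q := by
    refine Prod.ext ?_ ?_
    · simp [ancestor, child]
    · ext i
      simp only [child, ancestor]
      have hN : (0 : ℤ) < 2 ^ k := by positivity
      have h1 := Int.emod_nonneg (Q.2 i) hN.ne'
      rw [Int.toNat_of_nonneg h1]
      exact Int.mul_ediv_add_emod _ _

/-- Translation of the cubes of all scales. -/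
def shiftEquiv (e : Fin n → ℤ) : DyadicIndex n ≃ DyadicIndex n where
  toFun := shift e
  invFun := shift (-e)
  left_inv := shift_neg_shift e
  right_inv Q := by simpa using shift_neg_shift (-e) Q

end Dyadic

/-! ### The sequence norms -/

section EllNorm

variable {ι : Type*} {r : ℝ≥0∞}

theorem ellNorm_mono {a b : ι → ℝ≥0∞} (h : ∀ i, a i ≤ b i) : ellNorm r a ≤ ellNorm r b := by
  unfold ellNorm
  split_ifs
  · exact iSup_mono h
  · refine ENNReal.rpow_le_rpow (ENNReal.tsum_le_tsum fun i => ?_) (by positivity)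
    gcongr
    exact h i

theorem ellNorm_const_mul (hr : 1 ≤ r) (c : ℝ≥0∞) (a : ι → ℝ≥0∞) :
    ellNorm r (fun i => c * a i) = c * ellNorm r a := by
  unfold ellNorm
  split_ifs with h
  · rw [ENNReal.mul_iSup]
  · have h1 := one_le_toReal hr h
    simp_rw [ENNReal.mul_rpow_of_nonneg _ _ (zero_le_one.trans h1)]
    rw [ENNReal.tsum_mul_left, ENNReal.mul_rpow_of_nonneg _ _ (by positivity), ← ENNReal.rpow_mul,
      mul_one_div_cancel (by linarith), ENNReal.rpow_one]

theorem ellNorm_tsum_le {β : Type*} [Denumerable β] (hr : 1 ≤ r) (a : β → ι → ℝ≥0∞) :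
    ellNorm r (fun i => ∑' k, a k i) ≤ ∑' k, ellNorm r (a k) := by
  unfold ellNorm
  split_ifs with h
  · exact iSup_le fun i => ENNReal.tsum_le_tsum fun k => le_iSup (a k) i
  · let _ : MeasurableSpace ι := ⊤
    have h1 := lintegral_rpow_tsum_le (Measure.count : Measure ι) (one_le_toReal hr h) (φ := a)
      (fun k => measurable_from_top)
    simpa only [lintegral_count] using h1

theorem ellNorm_add_le (hr : 1 ≤ r) (a b : ι → ℝ≥0∞) :
    ellNorm r (fun i => a i + b i) ≤ ellNorm r a + ellNorm r b := by
  unfold ellNorm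
  split_ifs with h
  · exact iSup_le fun i => add_le_add (le_iSup a i) (le_iSup b i)
  · let _ : MeasurableSpace ι := ⊤
    have h1 := ENNReal.lintegral_Lp_add_le (μ := (Measure.count : Measure ι)) (f := a) (g := b)
      measurable_from_top.aemeasurable measurable_from_top.aemeasurable (one_le_toReal hr h)
    simpa only [lintegral_count, Pi.add_apply] using h1

theorem ellNorm_zero (hr : 1 ≤ r) : ellNorm r (fun _ : ι => 0) = 0 := by
  simpa using ellNorm_const_mul hr 0 (fun _ : ι => 0)

theorem ellNorm_sum_le {κ : Type*} (hr : 1 ≤ r) (s : Finset κ) (a : κ → ι → ℝ≥0∞) :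
    ellNorm r (fun i => ∑ k ∈ s, a k i) ≤ ∑ k ∈ s, ellNorm r (a k) := by
  classical
  induction s using Finset.induction_on with
  | empty => simp [ellNorm_zero hr]
  | insert k s hk ih =>
    simp_rw [Finset.sum_insert hk]
    exact (ellNorm_add_le hr _ _).trans (by gcongr)

theorem ellNorm_comp_equiv {κ : Type*} (e : κ ≃ ι) (a : ι → ℝ≥0∞) :
    ellNorm r (fun k => a (e k)) = ellNorm r a := by
  unfold ellNorm
  split_ifs with h
  · exact e.iSup_comp
  · rw [e.tsum_eq (fun i => a i ^ r.toReal)]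

theorem le_ellNorm (hr : 1 ≤ r) (a : ι → ℝ≥0∞) (i : ι) : a i ≤ ellNorm r a := by
  unfold ellNorm
  split_ifs with h
  · exact le_iSup a i
  · have h1 := one_le_toReal hr h
    calc a i = (a i ^ r.toReal) ^ (1 / r.toReal) := by
          rw [← ENNReal.rpow_mul, mul_one_div_cancel (by linarith), ENNReal.rpow_one]
      _ ≤ _ := by
          gcongr
          exact ENNReal.le_tsum i

theorem tsum_mul_le_ellNorm {r' : ℝ≥0∞} [hrr : ENNReal.HolderConjugate r r'] (a b : ι → ℝ≥0∞) :
    ∑' i, a i * b i ≤ ellNorm r a * ellNorm r' b := by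
  have key : ∀ (a b : ι → ℝ≥0∞), ∑' i, a i * b i ≤ ellNorm ∞ a * ellNorm 1 b := by
    intro a b
    simp only [ellNorm, if_true, ENNReal.one_ne_top, if_false, ENNReal.toReal_one,
      ENNReal.rpow_one, div_one]
    rw [← ENNReal.tsum_mul_left]
    exact ENNReal.tsum_le_tsum fun i => by gcongr; exact le_iSup a i
  rcases eq_or_ne r ∞ with rfl | hr
  · have : r' = 1 := by simpa using hrr.inv_add_inv_eq_inv
    subst this
    exact key a b
  rcases eq_or_ne r' ∞ with rfl | hr'
  · have : r = 1 := by simpa using hrr.inv_add_inv_eq_inv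
    subst this
    rw [mul_comm]
    simp_rw [mul_comm (a _)]
    exact key b a
  · have h := ENNReal.HolderConjugate.toReal_of_ne_top (p := r) (q := r') hr hr'
    simp only [ellNorm, hr, hr', if_false]
    let _ : MeasurableSpace ι := ⊤
    have h1 := ENNReal.lintegral_mul_le_Lp_mul_Lq (Measure.count : Measure ι) h (f := a) (g := b)
      measurable_from_top.aemeasurable measurable_from_top.aemeasurable
    simpa only [lintegral_count, Pi.mul_apply] using h1

/-- Every cube is the `k`-th ancestor of exactly `2^{nk}` cubes, so each term of the `ℓ^r` sum is
repeated that often. -/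
theorem ellNorm_ancestor {n : ℕ} (hr : 1 ≤ r) (k : ℕ) (a : DyadicIndex n → ℝ≥0∞) :
    ellNorm r (fun Q => a (ancestor k Q)) ≤ ((2 ^ n) ^ k) ^ (1 / r.toReal) * ellNorm r a := by
  unfold ellNorm
  split_ifs with h
  -- With `∞.toReal = 0` and `1 / 0 = 0` the factor is 1, as it should be for a supremum.
  · simp only [h, ENNReal.toReal_top, div_zero, ENNReal.rpow_zero, one_mul]
    exact iSup_le fun Q => le_iSup a _
  · have h1 := one_le_toReal hr h
    rw [← ENNReal.mul_rpow_of_nonneg _ _ (by positivity)]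
    refine ENNReal.rpow_le_rpow (le_of_eq ?_) (by positivity)
    rw [← (childEquiv n k).tsum_eq]
    simp only [childEquiv, Equiv.coe_fn_mk, ancestor_child]
    rw [ENNReal.tsum_prod (f := fun R _ => a R ^ r.toReal), ← ENNReal.tsum_mul_left]
    refine tsum_congr fun R => ?_
    rw [tsum_fintype]
    simp only [Finset.sum_const, Finset.card_univ, Fintype.card_fun, Fintype.card_fin, nsmul_eq_mul]
    push_cast
    rw [← pow_mul, ← pow_mul, mul_comm n k]

/-- The power mean inequality for the `2^{nk}` descendants of `R` costs `2^{nk(r-1)}` before the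
`r`-th root; then every cube occurs exactly once as a descendant. -/
theorem ellNorm_child {n : ℕ} (hr : 1 ≤ r) (hr' : r ≠ ∞) (k : ℕ) (a : DyadicIndex n → ℝ≥0∞) :
    ellNorm r (fun R => ∑ d, a (child k d R)) ≤
      ((2 ^ n) ^ k) ^ (1 - 1 / r.toReal) * ellNorm r a := by
  have h1 := one_le_toReal hr hr'
  have h0 : r.toReal ≠ 0 := by linarith
  simp only [ellNorm, hr', if_false]
  have h3 : ((2 ^ n) ^ k : ℝ≥0∞) ^ (1 - 1 / r.toReal) =
      (((2 ^ n) ^ k : ℝ≥0∞) ^ (r.toReal - 1)) ^ (1 / r.toReal) := by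
    rw [← ENNReal.rpow_mul]
    congr 1
    field_simp
  rw [h3, ← ENNReal.mul_rpow_of_nonneg _ _ (by positivity)]
  refine ENNReal.rpow_le_rpow ?_ (by positivity)
  rw [← (childEquiv n k).tsum_eq (fun Q => a Q ^ r.toReal)]
  simp only [childEquiv, Equiv.coe_fn_mk]
  rw [ENNReal.tsum_prod (f := fun R d => a (child k d R) ^ r.toReal), ← ENNReal.tsum_mul_left]
  refine ENNReal.tsum_le_tsum fun R => ?_
  rw [tsum_fintype]
  refine (ENNReal.rpow_sum_le_const_mul_sum_rpow _ _ h1).trans (le_of_eq ?_)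
  simp only [Finset.card_univ, Fintype.card_fun, Fintype.card_fin]
  push_cast
  rw [← pow_mul, ← pow_mul, mul_comm n k]

/-- A geometric series of ratio `2^{n(θ - 1/t)}`. For ancestors in `ℓ^r` one takes `θ = 1/r`, for
descendants in `ℓ^{r'}` one takes `θ = 1 - 1/r'`, which is the same number. -/
theorem tsum_pow_mul_rpow_lt_top {n : ℕ} (hn : 0 < n) {t θ : ℝ} (hθ : θ < 1 / t) :
    ∑' k : ℕ, ((2 : ℝ≥0∞) ^ (-(n / t : ℝ))) ^ k * ((2 ^ n) ^ k) ^ θ < ∞ := by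
  have hn' : (0 : ℝ) < n := by exact_mod_cast hn
  have e : ∀ k : ℕ, ((2 : ℝ≥0∞) ^ (-(n / t : ℝ))) ^ k * ((2 ^ n) ^ k) ^ θ =
      ((2 : ℝ≥0∞) ^ (n * θ - n / t)) ^ k := by
    intro k
    rw [← ENNReal.rpow_natCast, ← ENNReal.rpow_natCast _ k, ← ENNReal.rpow_natCast _ n,
      ← ENNReal.rpow_mul, ← ENNReal.rpow_mul, ← ENNReal.rpow_mul, ← ENNReal.rpow_natCast _ k,
      ← ENNReal.rpow_mul, ← ENNReal.rpow_add _ _ (by simp) (by simp)]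
    congr 1
    ring
  simp_rw [e]
  rw [ENNReal.tsum_geometric]
  rw [ENNReal.inv_lt_top, tsub_pos_iff_lt]
  refine ENNReal.rpow_lt_one_of_one_lt_of_neg (by norm_num) ?_
  rw [div_eq_mul_one_div, ← mul_sub]
  exact mul_neg_of_pos_of_neg hn' (by linarith)

/-- Summation over the ancestors of a cube and their neighbours. -/
theorem exists_ellNorm_tsum_ancestor_le {n : ℕ} (hn : 0 < n) (hr : 1 ≤ r) {t : ℝ}
    (ht : 1 / r.toReal < 1 / t) : ∃ C : ℝ≥0, ∀ a : DyadicIndex n → ℝ≥0∞,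
      ellNorm r (fun Q => ∑' k : ℕ, ((2 : ℝ≥0∞) ^ (-(n / t : ℝ))) ^ k *
        ∑ e ∈ nbr n, a (shift e (ancestor k Q))) ≤ C * ellNorm r a := by
  have hfin := tsum_pow_mul_rpow_lt_top hn ht
  set D := ∑' k : ℕ, ((2 : ℝ≥0∞) ^ (-(n / t : ℝ))) ^ k * ((2 ^ n) ^ k) ^ (1 / r.toReal)
  refine ⟨(D * (nbr n).card).toNNReal, fun a => ?_⟩
  rw [ENNReal.coe_toNNReal (ENNReal.mul_ne_top hfin.ne (by simp))]
  refine (ellNorm_tsum_le hr _).trans ?_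
  rw [mul_assoc, ← ENNReal.tsum_mul_right]
  refine ENNReal.tsum_le_tsum fun k => ?_
  rw [ellNorm_const_mul hr, mul_assoc]
  gcongr
  refine (ellNorm_ancestor hr k (fun Q => ∑ e ∈ nbr n, a (shift e Q))).trans ?_
  gcongr
  refine (ellNorm_sum_le hr _ _).trans (le_of_eq ?_)
  simp [fun e => ellNorm_comp_equiv (r := r) (shiftEquiv e) a, show ∀ e, (fun Q => a (shift e Q)) =
    fun Q => a (shiftEquiv (n := n) e Q) from fun e => rfl]

/-- Summation over the descendants of a cube and its neighbours. -/
theorem exists_ellNorm_tsum_child_le {n : ℕ} (hn : 0 < n) (hr : 1 ≤ r) (hr' : r ≠ ∞) {t : ℝ}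
    (ht : 1 - 1 / r.toReal < 1 / t) : ∃ C : ℝ≥0, ∀ a : DyadicIndex n → ℝ≥0∞,
      ellNorm r (fun R => ∑' k : ℕ, ((2 : ℝ≥0∞) ^ (-(n / t : ℝ))) ^ k *
        ∑ e ∈ nbr n, ∑ d, a (child k d (shift e R))) ≤ C * ellNorm r a := by
  have hfin := tsum_pow_mul_rpow_lt_top hn ht
  set D := ∑' k : ℕ, ((2 : ℝ≥0∞) ^ (-(n / t : ℝ))) ^ k * ((2 ^ n) ^ k) ^ (1 - 1 / r.toReal)
  refine ⟨(D * (nbr n).card).toNNReal, fun a => ?_⟩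
  rw [ENNReal.coe_toNNReal (ENNReal.mul_ne_top hfin.ne (by simp))]
  refine (ellNorm_tsum_le hr _).trans ?_
  rw [mul_assoc, ← ENNReal.tsum_mul_right]
  refine ENNReal.tsum_le_tsum fun k => ?_
  rw [ellNorm_const_mul hr, mul_assoc]
  gcongr
  refine (ellNorm_sum_le hr _ _).trans ?_
  rw [← nsmul_eq_mul, mul_smul_comm]
  refine Finset.sum_le_card_nsmul _ _ _ fun e _ => ?_
  refine le_trans (le_of_eq ?_) (ellNorm_child hr hr' k a)
  exact ellNorm_comp_equiv (r := r) (shiftEquiv e) (fun R => ∑ d, a (child k d R))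

end EllNorm

/-! ### Operators on `L²` acting on functions -/

section OpFun

variable {n : ℕ} {T : L2 n →L[ℂ] L2 n} {f g : Rn n → ℂ}

open Classical in
/-- The action of an operator on `L²(ℝⁿ)` on a function; it is `0` outside of `L²`. -/
def opFun (T : L2 n →L[ℂ] L2 n) (f : Rn n → ℂ) : Rn n → ℂ :=
  if h : MemLp f 2 volume then T (h.toLp f) else 0

theorem opFun_of_memLp (T : L2 n →L[ℂ] L2 n) (h : MemLp f 2 volume) :
    opFun T f = T (h.toLp f) := dif_pos h

theorem memLp_opFun (T : L2 n →L[ℂ] L2 n) (f : Rn n → ℂ) : MemLp (opFun T f) 2 volume := by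
  unfold opFun
  split_ifs with h
  · exact Lp.memLp _
  · exact MemLp.zero

theorem opFun_coe (T : L2 n →L[ℂ] L2 n) (f : L2 n) : opFun T f = T f := by
  rw [opFun_of_memLp T (Lp.memLp f), Lp.toLp_coeFn]

theorem opFun_add (T : L2 n →L[ℂ] L2 n) (hf : MemLp f 2 volume) (hg : MemLp g 2 volume) :
    opFun T (f + g) =ᵐ[volume] opFun T f + opFun T g := by
  rw [opFun_of_memLp T hf, opFun_of_memLp T hg, opFun_of_memLp T (hf.add hg), MemLp.toLp_add hf hg,
    map_add]
  exact Lp.coeFn_add _ _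

theorem opFun_smul (T : L2 n →L[ℂ] L2 n) (c : ℂ) (hf : MemLp f 2 volume) :
    opFun T (c • f) =ᵐ[volume] c • opFun T f := by
  rw [opFun_of_memLp T hf, opFun_of_memLp T (hf.const_smul c), MemLp.toLp_const_smul c hf,
    map_smul]
  exact Lp.coeFn_smul _ _

theorem opFun_zero (T : L2 n →L[ℂ] L2 n) : opFun T 0 =ᵐ[volume] 0 := by
  have := opFun_smul T 0 (f := (0 : Rn n → ℂ)) MemLp.zero
  simpa using this

theorem opFun_sum {ι : Type*} (T : L2 n →L[ℂ] L2 n) (s : Finset ι) {F : ι → Rn n → ℂ}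
    (hF : ∀ i ∈ s, MemLp (F i) 2 volume) :
    opFun T (∑ i ∈ s, F i) =ᵐ[volume] ∑ i ∈ s, opFun T (F i) := by
  classical
  induction s using Finset.induction_on with
  | empty => simpa using opFun_zero T
  | insert i s hi ih =>
    rw [Finset.sum_insert hi, Finset.sum_insert hi]
    have h1 := ih fun j hj => hF j (Finset.mem_insert_of_mem hj)
    refine (opFun_add T (hF i (Finset.mem_insert_self _ _)) (memLp_finsetSum' s fun j hj =>
      hF j (Finset.mem_insert_of_mem hj))).trans ?_
    filter_upwards [h1] with x hx
    simp [hx]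

theorem eLpNorm_opFun_le (T : L2 n →L[ℂ] L2 n) (f : Rn n → ℂ) :
    eLpNorm (opFun T f) 2 volume ≤ ‖T‖ₑ * eLpNorm f 2 volume := by
  by_cases hf : MemLp f 2 volume
  · rw [opFun_of_memLp T hf, ← Lp.enorm_def, eLpNorm_congr_ae hf.coeFn_toLp.symm, ← Lp.enorm_def]
    exact ContinuousLinearMap.le_opENorm T _
  · simp [opFun, hf]

theorem lintegral_sq_eq_eLpNorm (f : Rn n → ℂ) :
    ∫⁻ x, ‖f x‖ₑ ^ 2 = eLpNorm f 2 volume ^ 2 := by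
  rw [eLpNorm_eq_lintegral_rpow_enorm_toReal (by simp) (by simp), ← ENNReal.rpow_natCast,
    ← ENNReal.rpow_mul]
  simp

theorem lintegral_opFun_sq_le (T : L2 n →L[ℂ] L2 n) (f : Rn n → ℂ) :
    ∫⁻ x, ‖opFun T f x‖ₑ ^ 2 ≤ ‖T‖ₑ ^ 2 * ∫⁻ x, ‖f x‖ₑ ^ 2 := by
  rw [lintegral_sq_eq_eLpNorm, lintegral_sq_eq_eLpNorm, ← mul_pow]
  gcongr
  exact eLpNorm_opFun_le T f

theorem integral_opFun_mul_conj (T : L2 n →L[ℂ] L2 n) (hf : MemLp f 2 volume)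
    (hg : MemLp g 2 volume) : ∫ x, opFun T f x * conj (g x) =
      ∫ x, f x * conj (opFun (ContinuousLinearMap.adjoint T) g x) := by
  have h := ContinuousLinearMap.adjoint_inner_left T (hf.toLp f) (hg.toLp g)
  rw [L2.inner_def, L2.inner_def] at h
  rw [opFun_of_memLp T hf, opFun_of_memLp _ hg]
  simp only [RCLike.inner_apply] at h
  refine Eq.trans (integral_congr_ae ?_) (h.symm.trans (integral_congr_ae ?_))
  · filter_upwards [hg.coeFn_toLp] with x hx
    rw [hx]
  · filter_upwards [hf.coeFn_toLp] with x hx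
    rw [hx]

theorem integrable_mul_conj (hf : MemLp f 2 volume) (hg : MemLp g 2 volume) :
    Integrable fun x => f x * conj (g x) := by
  have := (hf.integrable_mul (p := 2) (q := 2) hg.star)
  exact this

theorem memLp_two_of_bounded_support {E : Set (Rn n)} (hE : Bornology.IsBounded E) {M : ℝ}
    (hf : AEStronglyMeasurable f volume) (hM : ∀ x, ‖f x‖ ≤ M) (h0 : ∀ x, x ∉ E → f x = 0)
    (p : ℝ≥0∞) : MemLp f p volume := by
  obtain ⟨R, hR⟩ := hE.subset_closedBall 0
  have h1 : MemLp ((Metric.closedBall (0 : Rn n) R).indicator f) p volume := by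
    rw [memLp_indicator_iff_restrict Metric.isClosed_closedBall.measurableSet]
    have : IsFiniteMeasure (volume.restrict (Metric.closedBall (0 : Rn n) R)) :=
      ⟨by simpa using measure_closedBall_lt_top⟩
    exact MemLp.of_bound hf.restrict M (ae_of_all _ hM)
  rwa [Set.indicator_eq_self.2] at h1
  intro x hx
  by_contra hc
  exact hx (h0 x fun h => hc (hR h))

theorem integrable_of_memLp_bounded_support {E : Set (Rn n)} (hE : Bornology.IsBounded E)
    {p : ℝ≥0∞} (hp : 1 ≤ p) (hf : MemLp f p volume) (h0 : ∀ x, x ∉ E → f x = 0) :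
    Integrable f := by
  obtain ⟨R, hR⟩ := hE.subset_closedBall 0
  have : IsFiniteMeasure (volume.restrict (Metric.closedBall (0 : Rn n) R)) :=
      ⟨by simpa using measure_closedBall_lt_top⟩
  have h1 : IntegrableOn f (Metric.closedBall (0 : Rn n) R) := (hf.restrict _).integrable hp
  rw [← integrable_indicator_iff Metric.isClosed_closedBall.measurableSet] at h1
  rwa [Set.indicator_eq_self.2] at h1
  intro x hx
  by_contra hc
  exact hx (h0 x fun h => hc (hR h))

/-- Fubini's theorem for a kernel between two functions where it is controlled. -/
theorem integral_kernel_swap {k : Rn n → Rn n → ℂ} (hk : Measurable (Function.uncurry k))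
    {f ψ : Rn n → ℂ} {W : Rn n → ℝ} (hf : AEStronglyMeasurable f volume)
    (hW : Integrable fun y => W y * ‖f y‖) (hψ : Integrable ψ)
    (h : ∀ x y, ψ x ≠ 0 → f y ≠ 0 → ‖k x y‖ ≤ W y) :
    Integrable (fun x => (∫ y, k x y * f y) * ψ x) ∧
    Integrable (fun y => f y * ∫ x, k x y * ψ x) ∧
    ∫ x, (∫ y, k x y * f y) * ψ x = ∫ y, f y * ∫ x, k x y * ψ x := by
  have hI : Integrable (Function.uncurry fun x y => k x y * f y * ψ x)
      ((volume : Measure (Rn n)).prod volume) := by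
    have h1 : Integrable (fun z : Rn n × Rn n => ‖ψ z.1‖ * (W z.2 * ‖f z.2‖))
        ((volume : Measure (Rn n)).prod volume) := Integrable.mul_prod hψ.norm hW
    refine h1.mono ((hk.aestronglyMeasurable.mul hf.comp_snd).mul
      hψ.aestronglyMeasurable.comp_fst) (ae_of_all _ fun z => ?_)
    simp only [Function.uncurry, norm_mul, norm_norm]
    by_cases h1 : ψ z.1 = 0
    · simp [h1]
    by_cases h2 : f z.2 = 0
    · simp [h2]
    rw [mul_comm]
    gcongr
    exact (h _ _ h1 h2).trans (le_abs_self _)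
  refine ⟨?_, ?_, ?_⟩
  · have := hI.integral_prod_left
    simpa only [Function.uncurry, integral_mul_const] using this
  · have := hI.integral_prod_right
    simp only [Function.uncurry] at this
    refine this.congr (ae_of_all _ fun y => ?_)
    simp only
    rw [← integral_const_mul]
    congr 1
    ext x
    ring
  · have := integral_integral_swap hI
    simp only [integral_mul_const] at this
    rw [this]
    congr 1
    ext y
    rw [← integral_const_mul]
    congr 1
    ext x
    ring

end OpFun

/-! ### Operators with a kernel off the diagonal -/

/-- `T` is represented off the diagonal by the measurable kernel `K`, which satisfies the size
condition and is regular in the second variable. -/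
structure HasKernel {n : ℕ} (δ A : ℝ) (K : Rn n → Rn n → ℂ) (T : L2 n →L[ℂ] L2 n) : Prop where
  delta_pos : 0 < δ
  const_pos : 0 < A
  meas : Measurable (Function.uncurry K)
  size : ∀ x y, ‖K x y‖ ≤ A / ‖x - y‖ ^ n
  regular : ∀ x y c, x ≠ c → 2 * ‖y - c‖ ≤ ‖x - c‖ →
    ‖K x y - K x c‖ ≤ A * ‖y - c‖ ^ δ / ‖x - c‖ ^ ((n : ℝ) + δ)
  repr : ∀ (f : Rn n → ℂ) (E : Set (Rn n)) (ε : ℝ), MemLp f 2 volume → Bornology.IsBounded E →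
    (∀ x, x ∉ E → f x = 0) → 0 < ε →
    ∀ᵐ x, (∀ y ∈ E, ε ≤ dist x y) → opFun T f x = ∫ y, K x y * f y

section Kernel

variable {n : ℕ} {δ A : ℝ} {K : Rn n → Rn n → ℂ} {T : L2 n →L[ℂ] L2 n}

theorem HasKernel.norm_le (h : HasKernel δ A K T) {ε : ℝ} (hε : 0 < ε) {x y : Rn n}
    (hxy : ε ≤ dist x y) : ‖K x y‖ ≤ A / ε ^ n := by
  refine (h.size x y).trans ?_
  rw [dist_eq_norm] at hxy
  have := h.const_pos.le
  gcongr

/-- The adjoint of an operator with a kernel has the adjoint kernel. -/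
theorem HasKernel.adjoint (h : HasKernel δ A K T)
    (hreg : ∀ x y c, x ≠ c → 2 * ‖y - c‖ ≤ ‖x - c‖ →
      ‖K y x - K c x‖ ≤ A * ‖y - c‖ ^ δ / ‖x - c‖ ^ ((n : ℝ) + δ)) :
    HasKernel δ A (fun x y => conj (K y x)) (ContinuousLinearMap.adjoint T) where
  delta_pos := h.delta_pos
  const_pos := h.const_pos
  meas := Complex.continuous_conj.measurable.comp (h.meas.comp measurable_swap)
  size x y := by
    rw [RCLike.norm_conj, norm_sub_rev]
    exact h.size y x
  regular x y c hx hy := by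
    rw [← map_sub, RCLike.norm_conj]
    exact hreg x y c hx hy
  repr f E ε hf hE h0 hε := by
    have hf1 : Integrable f := integrable_of_memLp_bounded_support hE one_le_two hf h0
    set F : Set (Rn n) := {x | ∀ y ∈ E, ε ≤ dist x y} with hF
    have hFc : IsClosed F := by
      have : F = ⋂ y ∈ E, {x | ε ≤ dist x y} := by ext x; simp [hF]
      rw [this]
      exact isClosed_biInter fun y _ => isClosed_le continuous_const (by fun_prop)
    have hmK : Measurable (Function.uncurry fun x y => conj (K y x)) :=
      Complex.continuous_conj.measurable.comp (h.meas.comp measurable_swap)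
    -- the pairing with indicator functions of bounded subsets of `F`
    have key : ∀ S : Set (Rn n), MeasurableSet S → S ⊆ F → Bornology.IsBounded S →
        IntegrableOn (fun x => ∫ y, conj (K y x) * f y) S ∧
        ∫ x in S, opFun (ContinuousLinearMap.adjoint T) f x =
          ∫ x in S, ∫ y, conj (K y x) * f y := by
      intro S hS hSF hSb
      set i : Rn n → ℂ := S.indicator fun _ => 1 with hi
      have hi2 : ∀ p : ℝ≥0∞, MemLp i p volume := memLp_two_of_bounded_support hSb (M := 1)
        (measurable_const.indicator hS).aestronglyMeasurable
        (fun x => by by_cases hx : x ∈ S <;> simp [hi, hx])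
        (fun x hx => by simp [hi, hx])
      have hii : Integrable i := memLp_one_iff_integrable.1 (hi2 1)
      have hci : ∀ x, conj (i x) = i x := fun x => by by_cases hx : x ∈ S <;> simp [hi, hx]
      have mem_of : ∀ x, i x ≠ 0 → x ∈ S := fun x hx => by
        by_contra hc
        exact hx (by simp [hi, hc])
      have mem_of' : ∀ x, f x ≠ 0 → x ∈ E := fun x hx => by
        by_contra hc
        exact hx (h0 x hc)
      obtain ⟨s1, -, s3⟩ := integral_kernel_swap (k := fun x y => conj (K y x)) hmK
        (f := f) (ψ := i) (W := fun _ => A / ε ^ n) hf.1 (hf1.norm.const_mul _) hii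
        (fun x y hx hy => by
          rw [RCLike.norm_conj]
          refine h.norm_le hε ?_
          rw [dist_comm]
          exact hSF (mem_of x hx) y (mem_of' y hy))
      have to_set : ∀ G : Rn n → ℂ, (fun x => G x * i x) = S.indicator G := fun G => by
        ext x
        by_cases hx : x ∈ S <;> simp [hi, hx]
      rw [to_set] at s1
      refine ⟨(integrable_indicator_iff hS).1 s1, ?_⟩
      have e1 := integral_opFun_mul_conj T (hi2 2) hf
      have e2 : ∫ x in S, opFun (ContinuousLinearMap.adjoint T) f x =
          conj (∫ x, i x * conj (opFun (ContinuousLinearMap.adjoint T) f x)) := by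
        rw [← integral_conj, ← integral_indicator hS, ← to_set]
        congr 1
        ext x
        rw [map_mul, hci, Complex.conj_conj, mul_comm]
      rw [e2, ← e1, ← integral_indicator hS, ← to_set, s3, ← integral_conj]
      refine integral_congr_ae ?_
      -- The roles of the two sets are exchanged: `S` is at distance at least `ε` from `E`, so `T`
      -- applied to the indicator of `S` is given by its kernel at the points of `E`.
      filter_upwards [h.repr i S ε (hi2 2) hSb (fun x hx => by simp [hi, hx]) hε] with x hx
      simp only [map_mul, Complex.conj_conj]
      by_cases hxE : x ∈ E
      · rw [hx fun y hy => by rw [dist_comm]; exact hSF hy x hxE, ← integral_conj, mul_comm]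
        congr 2
        ext y
        rw [map_mul, hci]
      · simp [h0 x hxE]
    -- Two integrable functions with equal integrals over all measurable subsets agree almost
    -- everywhere; intersecting with balls provides integrability.
    have key2 : ∀ N : ℕ, ∀ᵐ x, x ∈ F ∩ Metric.closedBall 0 N →
        opFun (ContinuousLinearMap.adjoint T) f x = ∫ y, conj (K y x) * f y := by
      intro N
      have hm : MeasurableSet (F ∩ Metric.closedBall (0 : Rn n) N) :=
        hFc.measurableSet.inter Metric.isClosed_closedBall.measurableSet
      have hb : Bornology.IsBounded (F ∩ Metric.closedBall (0 : Rn n) N) :=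
        Metric.isBounded_closedBall.subset Set.inter_subset_right
      rw [← ae_restrict_iff' hm]
      have : IsFiniteMeasure (volume.restrict (F ∩ Metric.closedBall (0 : Rn n) N)) :=
        ⟨by simpa using hb.measure_lt_top⟩
      refine Integrable.ae_eq_of_forall_setIntegral_eq _ _
        (((memLp_opFun _ f).restrict _).integrable one_le_two)
        (key _ hm Set.inter_subset_left hb).1 fun s hs _ => ?_
      rw [Measure.restrict_restrict hs]
      exact (key _ (hs.inter hm) (Set.inter_subset_right.trans Set.inter_subset_left)
        (hb.subset Set.inter_subset_right)).2
    filter_upwards [ae_all_iff.2 key2] with x hx hxF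
    obtain ⟨N, hN⟩ := exists_nat_ge ‖x‖
    exact hx N ⟨hxF, by simpa using hN⟩

/-- The kernel `K`, with the value `0` on the diagonal. -/
def offDiag (K : Rn n → Rn n → ℂ) (x y : Rn n) : ℂ :=
  open Classical in if x = y then 0 else K x y

theorem offDiag_of_ne {x y : Rn n} (h : x ≠ y) : offDiag K x y = K x y := if_neg h

/-- On the diagonal the right-hand side is a division by zero, hence 0. The value 0 of `offDiag`
there lets the size condition hold at all points. -/
theorem IsStandardKernel.norm_offDiag_le (hn : 0 < n) (hK : IsStandardKernel δ A K) (x y : Rn n) :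
    ‖offDiag K x y‖ ≤ A / ‖x - y‖ ^ n := by
  by_cases h : x = y
  · simp [offDiag, h, hn.ne']
  · rw [offDiag_of_ne h]
    exact hK.size x y h

theorem IsStandardKernel.regular_offDiag_right (hδ : 0 < δ) (hA : 0 < A)
    (hK : IsStandardKernel δ A K) (x y c : Rn n)
    (hx : x ≠ c) (hy : 2 * ‖y - c‖ ≤ ‖x - c‖) :
    ‖offDiag K x y - offDiag K x c‖ ≤ A * ‖y - c‖ ^ δ / ‖x - c‖ ^ ((n : ℝ) + δ) := by
  have h0 : 0 < ‖x - c‖ := norm_pos_iff.2 (sub_ne_zero.2 hx)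
  have hxy : x ≠ y := by
    rintro rfl
    linarith
  rw [offDiag_of_ne hx, offDiag_of_ne hxy]
  refine (hK.regular_right x y c hxy hx ?_).trans ?_
  · linarith [le_max_right ‖x - y‖ ‖x - c‖]
  · gcongr
    linarith [norm_nonneg (x - y)]

theorem IsStandardKernel.regular_offDiag_left (hδ : 0 < δ) (hA : 0 < A)
    (hK : IsStandardKernel δ A K) (x y c : Rn n)
    (hx : x ≠ c) (hy : 2 * ‖y - c‖ ≤ ‖x - c‖) :
    ‖offDiag K y x - offDiag K c x‖ ≤ A * ‖y - c‖ ^ δ / ‖x - c‖ ^ ((n : ℝ) + δ) := by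
  have h0 : 0 < ‖x - c‖ := norm_pos_iff.2 (sub_ne_zero.2 hx)
  have hxy : x ≠ y := by
    rintro rfl
    linarith
  have hs := norm_sub_rev x c
  rw [offDiag_of_ne hx.symm, offDiag_of_ne hxy.symm]
  refine (hK.regular_left y c x hxy.symm hx.symm ?_).trans ?_
  · linarith [le_max_right ‖y - x‖ ‖c - x‖]
  · gcongr
    linarith [norm_nonneg (y - x)]

/-- A standard kernel is not assumed measurable, but the two regularity conditions make it
continuous off the diagonal: one moves first the left variable, then the right one. -/
theorem IsStandardKernel.measurable_offDiag (hδ : 0 < δ) (hA : 0 < A)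
    (hK : IsStandardKernel δ A K) : Measurable (Function.uncurry (offDiag K)) := by
  classical
  have hopen : IsOpen {z : Rn n × Rn n | z.1 ≠ z.2} :=
    isOpen_ne_fun continuous_fst continuous_snd
  have hc : ContinuousOn (Function.uncurry (offDiag K)) {z : Rn n × Rn n | z.1 ≠ z.2} := by
    rintro ⟨a, b⟩ hab
    refine ContinuousAt.continuousWithinAt ?_
    have hab' : a ≠ b := hab
    have h0 : 0 < ‖a - b‖ := norm_pos_iff.2 (sub_ne_zero.2 hab')
    have hbound : Tendsto (fun z : Rn n × Rn n => A * ‖z.1 - a‖ ^ δ / ‖z.2 - a‖ ^ ((n : ℝ) + δ) +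
        A * ‖z.2 - b‖ ^ δ / ‖a - b‖ ^ ((n : ℝ) + δ)) (𝓝 (a, b)) (𝓝 0) := by
      have hne : ‖(a, b).2 - a‖ ≠ 0 := by
        rw [norm_sub_rev]; exact h0.ne'
      have : ContinuousAt (fun z : Rn n × Rn n => A * ‖z.1 - a‖ ^ δ /
          ‖z.2 - a‖ ^ ((n : ℝ) + δ) + A * ‖z.2 - b‖ ^ δ / ‖a - b‖ ^ ((n : ℝ) + δ)) (a, b) := by
        refine ContinuousAt.add (ContinuousAt.div ?_ ?_ ?_) ?_
        · exact (continuousAt_const.mul (ContinuousAt.rpow_const (by fun_prop) (Or.inr hδ.le)))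
        · exact ContinuousAt.rpow_const (by fun_prop) (Or.inl hne)
        · exact (Real.rpow_pos_of_pos (lt_of_le_of_ne (norm_nonneg _) hne.symm) _).ne'
        · exact (continuousAt_const.mul (ContinuousAt.rpow_const (by fun_prop)
            (Or.inr hδ.le))).div_const _
      have h2 := this.tendsto
      simpa [Real.zero_rpow hδ.ne'] using h2
    rw [ContinuousAt, tendsto_iff_norm_sub_tendsto_zero]
    refine squeeze_zero' (Eventually.of_forall fun _ => norm_nonneg _) ?_ hbound
    have e1 : ∀ᶠ z : Rn n × Rn n in 𝓝 (a, b), 2 * ‖z.1 - a‖ < ‖z.2 - a‖ := by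
      refine Filter.Tendsto.eventually_lt (f := fun z : Rn n × Rn n => 2 * ‖z.1 - a‖)
        (y := 0) (z := ‖b - a‖) ?_ ?_ ?_
      · have : ContinuousAt (fun z : Rn n × Rn n => 2 * ‖z.1 - a‖) (a, b) := by fun_prop
        simpa using this.tendsto
      · have : ContinuousAt (fun z : Rn n × Rn n => ‖z.2 - a‖) (a, b) := by fun_prop
        simpa using this.tendsto
      · rw [norm_sub_rev]; exact h0
    have e2 : ∀ᶠ z : Rn n × Rn n in 𝓝 (a, b), 2 * ‖z.2 - b‖ < ‖a - b‖ := by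
      refine Filter.Tendsto.eventually_lt_const (v := 0) h0 ?_
      have : ContinuousAt (fun z : Rn n × Rn n => 2 * ‖z.2 - b‖) (a, b) := by fun_prop
      simpa using this.tendsto
    filter_upwards [e1, e2] with z h1 h2
    have hz : z.2 ≠ a := by
      intro h
      rw [h, sub_self, norm_zero] at h1
      linarith [norm_nonneg (z.1 - a)]
    have b1 := hK.regular_offDiag_left hδ hA z.2 z.1 a hz h1.le
    have b2 := hK.regular_offDiag_right hδ hA a z.2 b hab' h2.le
    calc ‖Function.uncurry (offDiag K) z - Function.uncurry (offDiag K) (a, b)‖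
        = ‖(offDiag K z.1 z.2 - offDiag K a z.2) + (offDiag K a z.2 - offDiag K a b)‖ := by
          simp only [Function.uncurry]; congr 1; ring
      _ ≤ _ := (norm_add_le _ _).trans (add_le_add b1 b2)
  have := hc.measurable_piecewise (g := fun _ => (0 : ℂ)) continuousOn_const hopen.measurableSet
  convert this using 1
  ext ⟨x, y⟩
  by_cases h : x = y <;> simp [Set.piecewise, Function.uncurry, offDiag, h]

/-- The kernel formula is given only for smooth functions of compact support. An `L²` function
supported in `E` is approximated in `L²` by such functions supported within `ε/2` of `E`. The
operator side converges almost everywhere along a subsequence. The kernel side converges because,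
for `x` at distance `ε` from `E`, the kernel is bounded on that neighbourhood. -/
theorem IsCalderonZygmund.repr (hn : 0 < n) (hδ : 0 < δ) (hA : 0 < A)
    (hK : IsStandardKernel δ A K) {S : 𝓢(Rn n, ℂ) →L[ℂ] 𝓢'(Rn n, ℂ)}
    (hT : IsCalderonZygmund K S T) (f : Rn n → ℂ) (E : Set (Rn n)) (ε : ℝ)
    (hf : MemLp f 2 volume) (hE : Bornology.IsBounded E) (h0 : ∀ x, x ∉ E → f x = 0)
    (hε : 0 < ε) :
    ∀ᵐ x, (∀ y ∈ E, ε ≤ dist x y) → opFun T f x = ∫ y, offDiag K x y * f y := by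
  -- a smooth cut-off function
  obtain ⟨χ, hχ0, hχ1, hχ⟩ := exists_contMDiffMap_zero_one_of_isClosed (n := ⊤)
    (modelWithCornersSelf ℝ (Rn n)) (s := (Metric.thickening (ε / 2) E)ᶜ) (t := closure E)
    Metric.isOpen_thickening.isClosed_compl isClosed_closure
    (Set.disjoint_compl_left_iff_subset.2 (Metric.closure_subset_thickening (by positivity) E))
  have hχs : ContDiff ℝ (⊤ : ℕ∞) χ := χ.contMDiff.contDiff
  set E' := Metric.cthickening (ε / 2) E with hE'
  have hE'b : Bornology.IsBounded E' := hE.cthickening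
  have hχsupp : ∀ x, x ∉ E' → χ x = 0 := fun x hx =>
    hχ0 fun h => hx (Metric.thickening_subset_cthickening _ _ h)
  -- smooth approximations
  have happ : ∀ k : ℕ, ∃ g : Rn n → ℂ, HasCompactSupport g ∧ ContDiff ℝ (⊤ : ℕ∞) g ∧
      eLpNorm (f - g) 2 volume ≤ ENNReal.ofReal (1 / (k + 1)) := fun k =>
    MemLp.exist_eLpNorm_sub_le (by simp) (by norm_num) hf (by positivity)
  choose g hgc hgs hgn using happ
  set φ : ℕ → Rn n → ℂ := fun k x => (χ x : ℂ) * g k x with hφ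
  have hφs : ∀ k, ContDiff ℝ (⊤ : ℕ∞) (φ k) := fun k =>
    (Complex.ofRealCLM.contDiff.comp hχs).mul (hgs k)
  have hφc : ∀ k, HasCompactSupport (φ k) := fun k => (hgc k).mul_left
  have hφt : ∀ k, tsupport (φ k) ⊆ E' := fun k => by
    refine closure_minimal ?_ Metric.isClosed_cthickening
    intro x hx
    by_contra hc
    exact hx (by simp [hφ, hχsupp x hc])
  have hφL : ∀ k, MemLp (φ k) 2 volume := fun k =>
    (hφs k).continuous.memLp_of_hasCompactSupport (hφc k)
  have hφn : ∀ k, eLpNorm (φ k - f) 2 volume ≤ ENNReal.ofReal (1 / (k + 1)) := fun k => by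
    refine le_trans (eLpNorm_mono_ae (ae_of_all _ fun x => ?_)) (hgn k)
    have hx : φ k x - f x = (χ x : ℂ) * (g k x - f x) := by
      by_cases hx : x ∈ E
      · have : χ x = 1 := hχ1 (subset_closure hx)
        simp [hφ, this]
      · simp [hφ, h0 x hx]
    simp only [Pi.sub_apply]
    rw [hx, norm_mul, norm_sub_rev]
    refine mul_le_of_le_one_left (norm_nonneg _) ?_
    rw [Complex.norm_real, Real.norm_of_nonneg (hχ x).1]
    exact (hχ x).2
  set ψ : ℕ → 𝓢(Rn n, ℂ) := fun k => (hφc k).toSchwartzMap (hφs k)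
  have hψ : ∀ k, (hφL k).toLp (φ k) = (ψ k).toLp 2 := fun k => by
    refine Lp.ext ?_
    filter_upwards [(hφL k).coeFn_toLp, (ψ k).coeFn_toLp 2] with x h1 h2
    rw [h1, h2]
    rfl
  have hlim : Tendsto (fun k => (hφL k).toLp (φ k)) atTop (𝓝 (hf.toLp f)) := by
    rw [Lp.tendsto_Lp_iff_tendsto_eLpNorm']
    have h1 : ∀ k, eLpNorm (((hφL k).toLp (φ k) : L2 n) - (hf.toLp f : L2 n) : Rn n → ℂ) 2 volume =
        eLpNorm (φ k - f) 2 volume := fun k => by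
      refine eLpNorm_congr_ae ?_
      filter_upwards [(hφL k).coeFn_toLp, hf.coeFn_toLp] with x h1 h2
      simp only [Pi.sub_apply, h1, h2]
    simp_rw [h1]
    refine tendsto_of_tendsto_of_tendsto_of_le_of_le tendsto_const_nhds ?_ (fun _ => zero_le) hφn
    have := ENNReal.tendsto_ofReal (tendsto_one_div_add_atTop_nhds_zero_nat (𝕜 := ℝ))
    simpa using this
  have hlimT : Tendsto (fun k => T ((ψ k).toLp 2)) atTop (𝓝 (T (hf.toLp f))) := by
    simp_rw [← hψ]
    exact (T.continuous.tendsto _).comp hlim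
  obtain ⟨ns, hns, hae⟩ := (tendstoInMeasure_of_tendsto_Lp hlimT).exists_seq_tendsto_ae
  have hoff : ∀ᵐ x, ∀ k, x ∉ tsupport (ψ k) → T ((ψ k).toLp 2) x = ∫ y, K x y * ψ k y :=
    ae_all_iff.2 fun k => hT.off_support (ψ k) (hφc k)
  filter_upwards [hae, hoff] with x hx1 hx2 hxE
  rw [opFun_of_memLp T hf]
  refine tendsto_nhds_unique hx1 ?_
  have hdist : ∀ y ∈ E', ε / 2 ≤ dist x y := by
    intro y hy
    by_contra hc
    rcases E.eq_empty_or_nonempty with rfl | hne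
    · simp [hE'] at hy
    have h1 : Metric.infDist y E ≤ ε / 2 :=
      ENNReal.toReal_le_of_le_ofReal (by positivity) (Metric.mem_cthickening_iff.1 hy)
    have h2 : ε ≤ Metric.infDist x E := (Metric.le_infDist hne).2 fun _ hz => hxE _ hz
    have h3 := Metric.infDist_le_infDist_add_dist (s := E) (x := x) (y := y)
    linarith
  -- The truncated slice of the kernel is in `L²`, so the kernel integral is an inner product and is
  -- continuous along `L²` convergence.
  set kx : Rn n → ℂ := E'.indicator fun y => conj (offDiag K x y) with hkx
  have hmK := hK.measurable_offDiag hδ hA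
  have hkxL : MemLp kx 2 volume := by
    refine memLp_two_of_bounded_support hE'b (M := A / (ε / 2) ^ n) ?_ ?_ ?_ 2
    · refine Measurable.aestronglyMeasurable ?_
      refine Measurable.indicator ?_ Metric.isClosed_cthickening.measurableSet
      exact Complex.continuous_conj.measurable.comp (hmK.comp measurable_prodMk_left)
    · intro y
      by_cases hy : y ∈ E'
      · simp only [hkx, Set.indicator_of_mem hy, RCLike.norm_conj]
        refine (hK.norm_offDiag_le hn x y).trans ?_
        have := hdist y hy
        rw [dist_eq_norm] at this
        gcongr
      · simp only [hkx, Set.indicator_of_notMem hy, norm_zero]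
        positivity
    · intro y hy
      simp [hkx, hy]
  have hinner : ∀ (u : Rn n → ℂ) (hu : MemLp u 2 volume), (∀ y, y ∉ E' → u y = 0) →
      inner ℂ (hkxL.toLp kx) (hu.toLp u) = ∫ y, offDiag K x y * u y := by
    intro u hu hu0
    rw [L2.inner_def]
    refine integral_congr_ae ?_
    filter_upwards [hkxL.coeFn_toLp, hu.coeFn_toLp] with y h1 h2
    rw [h1, h2, RCLike.inner_apply]
    by_cases hy : y ∈ E'
    · simp [hkx, hy, mul_comm]
    · simp [hu0 y hy]
  have hcont : Tendsto (fun k => inner ℂ (hkxL.toLp kx) ((hφL k).toLp (φ k))) atTop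
      (𝓝 (inner ℂ (hkxL.toLp kx) (hf.toLp f))) := tendsto_const_nhds.inner hlim
  rw [hinner f hf fun y hy => h0 y fun h => hy (Metric.self_subset_cthickening E h)] at hcont
  refine Tendsto.congr (fun k => ?_) (hcont.comp hns.tendsto_atTop)
  have hφ0 : ∀ k y, y ∉ E' → φ k y = 0 := fun k y hy => by simp [hφ, hχsupp y hy]
  simp only [Function.comp]
  rw [hinner _ (hφL _) (hφ0 _), hx2]
  · congr 1
    ext y
    by_cases hy : y ∈ E'
    · rw [offDiag_of_ne]
      · rfl
      · rintro rfl
        have := hdist _ hy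
        simp at this
        linarith
    · have : ψ (ns k) y = 0 := hφ0 _ y hy
      rw [this, hφ0 _ y hy]
      simp
  · intro h
    have := hdist x (hφt _ h)
    simp at this
    linarith

theorem IsCalderonZygmund.hasKernel (hn : 0 < n) {S : 𝓢(Rn n, ℂ) →L[ℂ] 𝓢'(Rn n, ℂ)}
    (hT : IsCalderonZygmund K S T) : ∃ (δ A : ℝ) (k : Rn n → Rn n → ℂ), HasKernel δ A k T ∧
      HasKernel δ A (fun x y => conj (k y x)) (ContinuousLinearMap.adjoint T) := by
  obtain ⟨δ, A, hδ, hA, hK⟩ := hT.kernel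
  have h : HasKernel δ A (offDiag K) T :=
    { delta_pos := hδ
      const_pos := hA
      meas := hK.measurable_offDiag hδ hA
      size := hK.norm_offDiag_le hn
      regular := hK.regular_offDiag_right hδ hA
      repr := fun f E ε hf hE h0 hε => hT.repr hn hδ hA hK f E ε hf hE h0 hε }
  exact ⟨δ, A, offDiag K, h, h.adjoint (hK.regular_offDiag_left hδ hA)⟩

end Kernel

/-! ### The weak type `(1,1)` estimate -/

section WeakType

variable {n : ℕ} {δ A : ℝ} {K : Rn n → Rn n → ℂ} {T : L2 n →L[ℂ] L2 n}

/-- For `|x - c| ≥ ρ` one has `|x - c| ≥ (ρ + |x - c|)/2`. After translation and scaling by `ρ`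
everything is bounded by the integral of `(1 + |x|)^{-(n+δ)}`, independently of `c` and `ρ`. -/
theorem exists_lintegral_tail_le (hδ : 0 < δ) : ∃ C : ℝ≥0, ∀ (c : Rn n) (ρ : ℝ), 0 < ρ →
    ∫⁻ x in {x | ρ ≤ ‖x - c‖}, ENNReal.ofReal (ρ ^ δ / ‖x - c‖ ^ ((n : ℝ) + δ)) ≤ C := by
  have hfin : ∫⁻ x : Rn n, ENNReal.ofReal ((1 + ‖x‖) ^ (-((n : ℝ) + δ))) < ∞ :=
    finite_integral_one_add_norm (by simp [hδ])
  have h2 : (0 : ℝ) ≤ 2 ^ ((n : ℝ) + δ) := by positivity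
  refine ⟨(ENNReal.ofReal (2 ^ ((n : ℝ) + δ)) *
    ∫⁻ x : Rn n, ENNReal.ofReal ((1 + ‖x‖) ^ (-((n : ℝ) + δ)))).toNNReal, fun c ρ hρ => ?_⟩
  rw [ENNReal.coe_toNNReal (ENNReal.mul_ne_top ENNReal.ofReal_ne_top hfin.ne)]
  set F : Rn n → ℝ≥0∞ := fun x => ENNReal.ofReal (2 ^ ((n : ℝ) + δ) * ρ ^ δ *
    (ρ + ‖x‖) ^ (-((n : ℝ) + δ))) with hF
  have hm : MeasurableSet {x : Rn n | ρ ≤ ‖x - c‖} :=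
    measurableSet_le measurable_const (by fun_prop)
  have h1 : ∫⁻ x in {x | ρ ≤ ‖x - c‖}, ENNReal.ofReal (ρ ^ δ / ‖x - c‖ ^ ((n : ℝ) + δ)) ≤
      ∫⁻ x, F (x - c) := by
    refine (setLIntegral_mono' hm fun x hx => ?_).trans (setLIntegral_le_lintegral _ _)
    have hx' : ρ ≤ ‖x - c‖ := hx
    refine ENNReal.ofReal_le_ofReal ?_
    have hpos : 0 < ‖x - c‖ := hρ.trans_le hx'
    rw [Real.rpow_neg (by positivity), mul_comm (2 ^ ((n : ℝ) + δ)), mul_assoc, div_eq_mul_inv]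
    gcongr
    rw [← div_eq_mul_inv, ← Real.div_rpow (by norm_num) (by positivity), ← Real.inv_rpow hpos.le]
    refine Real.rpow_le_rpow (by positivity) ?_ (by positivity)
    rw [inv_eq_one_div, div_le_div_iff₀ hpos (by positivity)]
    linarith
  refine h1.trans ?_
  rw [lintegral_sub_right_eq_self F c]
  have hscale : ∫⁻ x : Rn n, F x = ENNReal.ofReal (ρ ^ n) * ∫⁻ x : Rn n, F (ρ • x) := by
    have := Measure.map_addHaar_smul (volume : Measure (Rn n)) hρ.ne'
    have e : ∫⁻ x : Rn n, F (ρ • x) = ∫⁻ x, F x ∂(volume.map fun x : Rn n => ρ • x) := by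
      rw [lintegral_map (by fun_prop) (by fun_prop)]
    rw [e, this, lintegral_smul_measure, smul_eq_mul, ← mul_assoc, ← ENNReal.ofReal_mul
      (by positivity)]
    simp only [finrank_euclideanSpace, Fintype.card_fin]
    rw [abs_of_pos (by positivity), mul_inv_cancel₀ (by positivity)]
    simp
  rw [hscale, ← lintegral_const_mul _ (by fun_prop), ← lintegral_const_mul _ (by fun_prop)]
  refine lintegral_mono fun x => ?_
  rw [← ENNReal.ofReal_mul (by positivity), ← ENNReal.ofReal_mul (by positivity)]
  refine ENNReal.ofReal_le_ofReal (le_of_eq ?_)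
  rw [norm_smul, Real.norm_of_nonneg hρ.le, show ρ + ρ * ‖x‖ = ρ * (1 + ‖x‖) by ring,
    Real.mul_rpow hρ.le (by positivity), Real.rpow_neg hρ.le, Real.rpow_add hρ, Real.rpow_natCast]
  field_simp

/-- An operator with a regular kernel maps mean zero functions supported on a cube to functions
that are integrable away from the cube. -/
theorem HasKernel.exists_lintegral_far_le (hn : 0 < n) (hK : HasKernel δ A K T) :
    ∃ C : ℝ≥0, ∀ (Q : DyadicIndex n) (c : Rn n) (b : Rn n → ℂ), c ∈ dyadicCube Q →
      MemLp b 2 volume → (∀ x, x ∉ dyadicCube Q → b x = 0) → ∫ x, b x = 0 →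
      ∫⁻ x in {x | 2 * (√n * 2 ^ (-Q.1)) ≤ ‖x - c‖}, ‖opFun T b x‖ₑ ≤ C * ∫⁻ x, ‖b x‖ₑ := by
  obtain ⟨C, hC⟩ := exists_lintegral_tail_le (n := n) hK.delta_pos
  have hA := hK.const_pos
  have hδ := hK.delta_pos
  refine ⟨A.toNNReal * C, fun Q c b hc hb h0 hmean => ?_⟩
  set D : ℝ := √n * 2 ^ (-Q.1) with hD
  have hD0 : 0 < D := by
    have : (0 : ℝ) < n := by exact_mod_cast hn
    positivity
  have hbi : Integrable b :=
    integrable_of_memLp_bounded_support (isBounded_dyadicCube Q) one_le_two hb h0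
  have hm : MeasurableSet {x : Rn n | 2 * D ≤ ‖x - c‖} :=
    measurableSet_le measurable_const (by fun_prop)
  have hrep := hK.repr b (dyadicCube Q) D hb (isBounded_dyadicCube Q) h0 hD0
  have hpt : ∀ᵐ x, x ∈ {x : Rn n | 2 * D ≤ ‖x - c‖} → ‖opFun T b x‖ₑ ≤
      ENNReal.ofReal ((2 * D) ^ δ / ‖x - c‖ ^ ((n : ℝ) + δ)) *
        (ENNReal.ofReal A * ∫⁻ x, ‖b x‖ₑ) := by
    filter_upwards [hrep] with x hx hxm
    have hxm' : 2 * D ≤ ‖x - c‖ := hxm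
    have hdist : ∀ y ∈ dyadicCube Q, D ≤ dist x y := by
      intro y hy
      have h1 := norm_sub_le_of_mem hy hc
      have h2 := norm_sub_le_norm_sub_add_norm_sub x y c
      rw [dist_eq_norm]
      linarith
    have hmKx : Measurable fun y => K x y := hK.meas.comp measurable_prodMk_left
    have hint : Integrable fun y => K x y * b y := by
      refine (hbi.norm.const_mul (A / D ^ n)).mono (hmKx.aestronglyMeasurable.mul hb.1)
        (ae_of_all _ fun y => ?_)
      by_cases hy : y ∈ dyadicCube Q
      · rw [norm_mul, norm_mul, norm_norm]
        gcongr
        exact (hK.norm_le hD0 (hdist y hy)).trans (le_abs_self _)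
      · simp [h0 y hy]
    -- Cancellation: since `b` has mean zero, the constant `K x c` may be subtracted, and the
    -- regularity of the kernel gives an integrable tail.
    have e : opFun T b x = ∫ y, (K x y - K x c) * b y := by
      rw [hx hdist]
      simp_rw [sub_mul]
      rw [integral_sub hint (hbi.const_mul _), integral_const_mul, hmean, mul_zero, sub_zero]
    have hxc : x ≠ c := by
      rintro rfl
      simp at hxm'
      linarith
    rw [e]
    refine (enorm_integral_le_lintegral_enorm _).trans ?_
    rw [← mul_assoc, ← lintegral_const_mul' _ _ (by simp [ENNReal.mul_eq_top])]
    refine lintegral_mono fun y => ?_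
    by_cases hy : y ∈ dyadicCube Q
    · rw [enorm_mul]
      gcongr
      have h1 := norm_sub_le_of_mem hy hc
      have h2 := hK.regular x y c hxc (by linarith)
      rw [← ofReal_norm, ← ENNReal.ofReal_mul (by positivity)]
      refine ENNReal.ofReal_le_ofReal (h2.trans ?_)
      rw [mul_comm, mul_div_right_comm]
      gcongr
      linarith
    · simp [h0 y hy]
  calc ∫⁻ x in {x | 2 * D ≤ ‖x - c‖}, ‖opFun T b x‖ₑ
      ≤ ∫⁻ x in {x | 2 * D ≤ ‖x - c‖},
        ENNReal.ofReal ((2 * D) ^ δ / ‖x - c‖ ^ ((n : ℝ) + δ)) *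
          (ENNReal.ofReal A * ∫⁻ x, ‖b x‖ₑ) := by
        refine lintegral_mono_ae ?_
        rwa [ae_restrict_iff' hm]
    _ = (∫⁻ x in {x | 2 * D ≤ ‖x - c‖},
        ENNReal.ofReal ((2 * D) ^ δ / ‖x - c‖ ^ ((n : ℝ) + δ))) *
          (ENNReal.ofReal A * ∫⁻ x, ‖b x‖ₑ) := by
        rw [lintegral_mul_const _ (by fun_prop)]
    _ ≤ C * (ENNReal.ofReal A * ∫⁻ x, ‖b x‖ₑ) := by
        gcongr
        exact hC c (2 * D) (by positivity)
    _ = _ := by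
        rw [← mul_assoc, mul_comm (C : ℝ≥0∞)]
        push_cast
        rfl

/-- The radius is twice the diameter of the cube. Such a ball serves both to pass from balls to
cubes in Lebesgue's differentiation theorem and as the exceptional set around a bad cube. -/
theorem exists_volume_ball_le : ∃ C : ℝ≥0, ∀ (Q : DyadicIndex n) (c : Rn n),
    volume (Metric.closedBall c (2 * (√n * 2 ^ (-Q.1)))) ≤ C * volume (dyadicCube Q) := by
  refine ⟨(ENNReal.ofReal ((2 * √n) ^ n) * volume (Metric.ball (0 : Rn n) 1)).toNNReal,
    fun Q c => ?_⟩
  rw [ENNReal.coe_toNNReal (ENNReal.mul_ne_top ENNReal.ofReal_ne_top measure_ball_lt_top.ne),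
    Measure.addHaar_closedBall _ _ (by positivity), volume_dyadicCube,
    ← ENNReal.ofReal_pow (by positivity), mul_right_comm, ← ENNReal.ofReal_mul (by positivity)]
  simp only [finrank_euclideanSpace, Fintype.card_fin]
  rw [← mul_pow, mul_assoc]

/-- Almost everywhere, a function is bounded by its averages over dyadic cubes. -/
theorem ae_enorm_le_of_average_le (hn : 0 < n) {f : Rn n → ℂ} (hf : LocallyIntegrable f volume)
    (s : ℝ≥0∞) : ∀ᵐ x, (∀ j : ℤ, ∫⁻ y in dyadicCube (j, cubeIdx j x), ‖f y‖ₑ ≤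
      s * volume (dyadicCube (j, cubeIdx j x))) → ‖f x‖ₑ ≤ s := by
  obtain ⟨C, hC⟩ := exists_volume_ball_le (n := n)
  have hn' : (0 : ℝ) < n := by exact_mod_cast hn
  filter_upwards [(IsUnifLocDoublingMeasure.vitaliFamily (volume : Measure (Rn n))
    1).ae_tendsto_lintegral_enorm_sub_div hf] with x hx havg
  set ρ : ℕ → ℝ := fun j => 2 * (√n * 2 ^ (-(j : ℤ))) with hρ
  have hρ0 : ∀ j, 0 < ρ j := fun j => by positivity
  have hlim : Tendsto ρ atTop (𝓝[>] 0) := by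
    rw [tendsto_nhdsWithin_iff]
    refine ⟨?_, Eventually.of_forall hρ0⟩
    have : Tendsto (fun j : ℕ => 2 * √n * (2⁻¹ : ℝ) ^ j) atTop (𝓝 (2 * √n * 0)) :=
      (tendsto_pow_atTop_nhds_zero_of_lt_one (by norm_num) (by norm_num)).const_mul _
    rw [mul_zero] at this
    refine this.congr fun j => ?_
    simp only [hρ, zpow_neg, zpow_natCast, inv_pow]
    ring
  -- At a Lebesgue point `x` the mean oscillation over the balls of radius `ρ j` around `x` tends to
  -- 0. Each ball contains the dyadic cube of scale `j` at `x`, which fills a fixed proportion of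
  -- it.
  have h1 := hx.comp (IsUnifLocDoublingMeasure.tendsto_closedBall_filterAt
    (volume : Measure (Rn n)) (K := 1) (fun _ => x) ρ hlim
    (Eventually.of_forall fun j => by simp [(hρ0 j).le]))
  have h2 := (ENNReal.Tendsto.const_mul h1 (Or.inr (ENNReal.coe_ne_top (r := C)))).const_add s
  rw [mul_zero, add_zero] at h2
  refine ge_of_tendsto' h2 fun j => ?_
  set Q : DyadicIndex n := ((j : ℤ), cubeIdx j x) with hQ
  have hxQ : x ∈ dyadicCube Q := mem_dyadicCube_cubeIdx j x
  have hv0 := volume_dyadicCube_ne_zero Q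
  have hvt := volume_dyadicCube_ne_top Q
  have hsub : dyadicCube Q ⊆ Metric.closedBall x (ρ j) := fun y hy => by
    rw [Metric.mem_closedBall, dist_eq_norm]
    refine (norm_sub_le_of_mem hy hxQ).trans ?_
    have : 0 ≤ √n * (2 : ℝ) ^ (-Q.1) := by positivity
    simp only [hρ]
    linarith
  have hB0 : volume (Metric.closedBall x (ρ j)) ≠ 0 := (Metric.measure_closedBall_pos _ _ (hρ0 j)).ne'
  have hBt : volume (Metric.closedBall x (ρ j)) ≠ ∞ := measure_closedBall_lt_top.ne
  have key : ‖f x‖ₑ * volume (dyadicCube Q) ≤ (s + C * ((∫⁻ y in Metric.closedBall x (ρ j),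
      ‖f y - f x‖ₑ) / volume (Metric.closedBall x (ρ j)))) * volume (dyadicCube Q) := by
    calc ‖f x‖ₑ * volume (dyadicCube Q) = ∫⁻ _ in dyadicCube Q, ‖f x‖ₑ := by
          rw [setLIntegral_const]
      _ ≤ ∫⁻ y in dyadicCube Q, (‖f y‖ₑ + ‖f y - f x‖ₑ) := by
          refine lintegral_mono fun y => ?_
          have : f x = f y - (f y - f x) := by ring
          calc ‖f x‖ₑ = ‖f y - (f y - f x)‖ₑ := by rw [← this]
            _ ≤ _ := enorm_sub_le
      _ = (∫⁻ y in dyadicCube Q, ‖f y‖ₑ) + ∫⁻ y in dyadicCube Q, ‖f y - f x‖ₑ :=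
          lintegral_add_left' hf.aestronglyMeasurable.enorm.restrict _
      _ ≤ s * volume (dyadicCube Q) + ∫⁻ y in Metric.closedBall x (ρ j), ‖f y - f x‖ₑ :=
          add_le_add (havg j) (lintegral_mono_set hsub)
      _ ≤ _ := by
          rw [add_mul]
          gcongr
          set J := ∫⁻ y in Metric.closedBall x (ρ j), ‖f y - f x‖ₑ
          calc J = J / volume (Metric.closedBall x (ρ j)) * volume (Metric.closedBall x (ρ j)) :=
                (ENNReal.div_mul_cancel hB0 hBt).symm
            _ ≤ J / volume (Metric.closedBall x (ρ j)) * (C * volume (dyadicCube Q)) := by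
                gcongr
                exact hC Q x
            _ = _ := by ring
  exact (ENNReal.mul_le_mul_iff_left hv0 hvt).1 key

/-- A dyadic cube over which the average of `‖f‖` is larger than `s`. -/
def IsHeavy (f : Rn n → ℂ) (s : ℝ≥0∞) (Q : DyadicIndex n) : Prop :=
  s * volume (dyadicCube Q) < ∫⁻ y in dyadicCube Q, ‖f y‖ₑ

/-- The maximal heavy cubes, on which the Calderón-Zygmund decomposition is built. -/
def stoppingCubes (f : Rn n → ℂ) (s : ℝ≥0∞) : Set (DyadicIndex n) :=
  {Q | IsHeavy f s Q ∧ ∀ k : ℕ, 1 ≤ k → ¬ IsHeavy f s (ancestor k Q)}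

/-- Of two dyadic cubes that meet, the larger is an ancestor of the smaller; if it were a proper
one, its heaviness would contradict the maximality of the smaller. -/
theorem stoppingCubes_unique {f : Rn n → ℂ} {s : ℝ≥0∞} {Q R : DyadicIndex n}
    (hQ : Q ∈ stoppingCubes f s) (hR : R ∈ stoppingCubes f s) {x : Rn n}
    (hxQ : x ∈ dyadicCube Q) (hxR : x ∈ dyadicCube R) : Q = R := by
  wlog h : R.1 ≤ Q.1 generalizing Q R
  · exact (this hR hQ hxR hxQ (not_le.1 h).le).symm
  obtain ⟨k, hk⟩ := Int.le.dest h
  have h1 : ancestor k Q = R := ancestor_of_mem hxQ hxR (by linarith)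
  rcases Nat.eq_zero_or_pos k with rfl | hk0
  · rwa [ancestor_zero] at h1
  · exact absurd hR.1 (h1 ▸ hQ.2 k hk0)

theorem exists_mem_stoppingCubes (hn : 0 < n) {f : Rn n → ℂ} (hf : ∫⁻ x, ‖f x‖ₑ ≠ ∞) {s : ℝ≥0∞}
    (hs : s ≠ 0) {x : Rn n} {j : ℤ} (hj : IsHeavy f s (j, cubeIdx j x)) :
    ∃ Q ∈ stoppingCubes f s, x ∈ dyadicCube Q := by
  obtain ⟨N, hN⟩ := ENNReal.exists_nat_gt (ENNReal.div_ne_top hf hs)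
  have hst : s ≠ ∞ := by
    rintro rfl
    rw [IsHeavy, ENNReal.top_mul (volume_dyadicCube_ne_zero _)] at hj
    exact not_top_lt hj
  -- A heavy cube has volume at most `‖f‖₁ / s < N`, which bounds its side length, so among the
  -- heavy cubes containing `x` there is a largest one.
  have hbdd : ∃ b : ℤ, ∀ z : ℤ, IsHeavy f s (z, cubeIdx z x) → b ≤ z := by
    refine ⟨-N, fun z hz => ?_⟩
    by_contra hc
    push Not at hc
    have h1 : volume (dyadicCube (z, cubeIdx z x)) < N := by
      refine lt_of_le_of_lt ?_ hN
      rw [ENNReal.le_div_iff_mul_le (Or.inl hs) (Or.inl hst), mul_comm]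
      exact hz.le.trans (setLIntegral_le_lintegral _ _)
    rw [volume_dyadicCube] at h1
    have h2 : (N : ℝ) ≤ (2 : ℝ) ^ (-z) := by
      have h3 : (N : ℝ) ≤ 2 ^ N := by exact_mod_cast Nat.lt_two_pow_self.le
      refine h3.trans ?_
      rw [← zpow_natCast]
      exact zpow_le_zpow_right₀ (by norm_num) (by linarith)
    have h4 : (1 : ℝ) ≤ 2 ^ (-z) := one_le_zpow₀ (by norm_num) (by omega)
    have h5 : (N : ℝ≥0∞) ≤ ENNReal.ofReal (2 ^ (-z)) := by
      rw [← ENNReal.ofReal_natCast]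
      exact ENNReal.ofReal_le_ofReal h2
    have h6 : (1 : ℝ≥0∞) ≤ ENNReal.ofReal (2 ^ (-z)) := by simpa using h4
    exact absurd h1 (not_lt.2 (h5.trans (le_self_pow₀ h6 hn.ne')))
  obtain ⟨m, hm, hmin⟩ := Int.exists_least_of_bdd hbdd ⟨j, hj⟩
  refine ⟨(m, cubeIdx m x), ⟨hm, fun k hk hbad => ?_⟩, mem_dyadicCube_cubeIdx m x⟩
  have h1 : ancestor k (m, cubeIdx m x) = (m - k, cubeIdx (m - k) x) := by
    rw [cubeIdx_sub]
    rfl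
  rw [h1] at hbad
  have := hmin _ hbad
  omega

theorem enorm_average_mul_le (f : Rn n → ℂ) (Q : DyadicIndex n) :
    ‖⨍ y in dyadicCube Q, f y‖ₑ * volume (dyadicCube Q) ≤ ∫⁻ y in dyadicCube Q, ‖f y‖ₑ := by
  have h0 := volume_dyadicCube_ne_zero Q
  have ht := volume_dyadicCube_ne_top Q
  rw [setAverage_eq, enorm_smul, mul_right_comm]
  have : ‖((volume : Measure (Rn n)).real (dyadicCube Q))⁻¹‖ₑ * volume (dyadicCube Q) = 1 := by
    rw [enorm_inv (by simp [measureReal_def, ENNReal.toReal_eq_zero_iff, h0, ht]), measureReal_def,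
      Real.enorm_of_nonneg ENNReal.toReal_nonneg, ENNReal.ofReal_toReal ht,
      ENNReal.inv_mul_cancel h0 ht]
  rw [this, one_mul]
  exact enorm_integral_le_lintegral_enorm _

/-- The parent is not heavy and is only `2^n` times larger. -/
theorem enorm_average_le_of_mem_stoppingCubes {f : Rn n → ℂ} {s : ℝ≥0∞} {Q : DyadicIndex n}
    (hQ : Q ∈ stoppingCubes f s) : ‖⨍ y in dyadicCube Q, f y‖ₑ ≤ 2 ^ n * s := by
  have h0 := volume_dyadicCube_ne_zero Q
  have ht := volume_dyadicCube_ne_top Q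
  refine (ENNReal.mul_le_mul_iff_left h0 ht).1 ((enorm_average_mul_le f Q).trans ?_)
  have h1 := not_lt.1 (hQ.2 1 le_rfl)
  have h2 : volume (dyadicCube (ancestor 1 Q)) = (2 ^ n) ^ 1 * volume (dyadicCube Q) :=
    volume_dyadicCube_of_scale_add (by simp [ancestor])
  rw [h2, pow_one] at h1
  refine le_trans (lintegral_mono_set fun x hx => mem_ancestor hx 1) (h1.trans (le_of_eq ?_))
  ring

/-- The Calderón–Zygmund decomposition at height `s`, with only finitely many stopping cubes kept.
The good part is estimated in `L²`, the bad part by cancellation away from enlarged cubes, and the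
discarded cubes carry an arbitrarily small `L²` norm. Thus `T` is only ever applied to finite sums.
Each of the three terms gets the level `s`, hence `3 * s`. -/
theorem HasKernel.exists_weak_type_aux (hn : 0 < n) (hK : HasKernel δ A K T) :
    ∃ C : ℝ≥0, ∀ f : Rn n → ℂ, MemLp f 2 volume → ∫⁻ x, ‖f x‖ₑ ≠ ∞ →
      ∀ s : ℝ≥0∞, s ≠ 0 → s ≠ ∞ →
      s * volume {x | 3 * s < ‖opFun T f x‖ₑ} ≤ C * ∫⁻ x, ‖f x‖ₑ := by
  classical
  obtain ⟨C₁, hC₁⟩ := hK.exists_lintegral_far_le hn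
  obtain ⟨C₂, hC₂⟩ := exists_volume_ball_le (n := n)
  refine ⟨‖T‖₊ ^ 2 * (2 ^ n * 2) + (C₂ + C₁ * 2), fun f hf hI s hs0 hst => ?_⟩
  set I := ∫⁻ x, ‖f x‖ₑ with hIdef
  have hfi : Integrable f := ⟨hf.1, hI.lt_top⟩
  set Sel := stoppingCubes f s with hSel
  set q : Sel → Set (Rn n) := fun Q => dyadicCube Q.1 with hq
  set c : Sel → ℂ := fun Q => ⨍ y in q Q, f y with hc
  have hqm : ∀ Q, MeasurableSet (q Q) := fun Q => measurableSet_dyadicCube _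
  have hqu : ∀ {Q R : Sel} {x : Rn n}, x ∈ q Q → x ∈ q R → Q = R := fun {Q R x} hQ hR =>
    Subtype.ext (stoppingCubes_unique Q.2 R.2 hQ hR)
  have hqd : Pairwise fun Q R => Disjoint (q Q) (q R) := fun Q R hne =>
    Set.disjoint_left.2 fun x hQ hR => hne (hqu hQ hR)
  set G := ⋃ Q, q Q with hG
  have hGm : MeasurableSet G := MeasurableSet.iUnion hqm
  have hsum : ∑' Q, ∫⁻ y in q Q, ‖f y‖ₑ ≤ I := by
    rw [← lintegral_iUnion hqm hqd]
    exact setLIntegral_le_lintegral _ _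
  -- evaluation of sums over disjoint cubes
  have heval : ∀ (t : Finset Sel) (F : Sel → Rn n → ℂ) (Q : Sel) (x : Rn n), x ∈ q Q →
      (∑ R ∈ t, (q R).indicator (F R)) x = if Q ∈ t then F Q x else 0 := by
    intro t F Q x hx
    rw [Finset.sum_apply]
    split_ifs with h
    · rw [Finset.sum_eq_single_of_mem Q h, Set.indicator_of_mem hx]
      intro R _ hne
      exact Set.indicator_of_notMem (fun hR => hne (hqu hR hx)) _
    · refine Finset.sum_eq_zero fun R hR => Set.indicator_of_notMem (fun hR' => h ?_) _
      rwa [hqu hx hR']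
  have heval0 : ∀ (t : Finset Sel) (F : Sel → Rn n → ℂ) (x : Rn n), x ∉ G →
      (∑ R ∈ t, (q R).indicator (F R)) x = 0 := by
    intro t F x hx
    rw [Finset.sum_apply]
    refine Finset.sum_eq_zero fun R hR => Set.indicator_of_notMem (fun hR' => hx ?_) _
    exact Set.mem_iUnion.2 ⟨R, hR'⟩
  -- the error term
  have htail : Tendsto (fun t : Finset Sel => ‖T‖ₑ ^ 2 / s *
      ∑' Q : {Q // Q ∉ t}, ∫⁻ y in q Q, ‖f y‖ₑ ^ 2) atTop (𝓝 0) := by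
    have h1 : ∑' Q, ∫⁻ y in q Q, ‖f y‖ₑ ^ 2 ≠ ∞ := by
      rw [← lintegral_iUnion hqm hqd]
      refine ne_top_of_le_ne_top ?_ (setLIntegral_le_lintegral _ _)
      rw [lintegral_sq_eq_eLpNorm]
      exact ENNReal.pow_ne_top hf.2.ne
    have h2 := ENNReal.Tendsto.const_mul (ENNReal.tendsto_tsum_compl_atTop_zero h1)
      (Or.inr (ENNReal.div_ne_top (ENNReal.pow_ne_top enorm_ne_top) hs0 :
        ‖T‖ₑ ^ 2 / s ≠ ∞))
    rwa [mul_zero] at h2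
  refine ENNReal.le_of_forall_pos_le_add fun η hη _ => ?_
  obtain ⟨t, ht⟩ := (htail.eventually_lt_const (by exact_mod_cast hη :
    (0 : ℝ≥0∞) < η)).exists
  -- On a kept cube `f` is split into its average and a mean zero remainder. On a discarded cube
  -- both `g` and `b` vanish and all of `f` goes into `e`.
  set g : Rn n → ℂ := Gᶜ.indicator f + ∑ Q ∈ t, (q Q).indicator (fun _ => c Q) with hg
  set b : Rn n → ℂ := ∑ Q ∈ t, (q Q).indicator (fun x => f x - c Q) with hb
  set e : Rn n → ℂ := G.indicator f - ∑ Q ∈ t, (q Q).indicator f with he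
  have hconst : ∀ Q, MemLp ((q Q).indicator fun _ => c Q) 2 volume := fun Q =>
    memLp_indicator_const _ (hqm Q) _ (Or.inr (volume_dyadicCube_ne_top _))
  have hbQ : ∀ Q, MemLp ((q Q).indicator fun x => f x - c Q) 2 volume := fun Q => by
    have : (q Q).indicator (fun x => f x - c Q) =
        (q Q).indicator f - (q Q).indicator (fun _ => c Q) := Set.indicator_sub' _ _ _
    rw [this]
    exact (hf.indicator (hqm Q)).sub (hconst Q)
  have hgL : MemLp g 2 volume := (hf.indicator hGm.compl).add
    (memLp_finsetSum' _ fun Q _ => hconst Q)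
  have hbL : MemLp b 2 volume := memLp_finsetSum' _ fun Q _ => hbQ Q
  have heL : MemLp e 2 volume := (hf.indicator hGm).sub
    (memLp_finsetSum' _ fun Q _ => hf.indicator (hqm Q))
  have hdecomp : f = g + b + e := by
    ext x
    simp only [Pi.add_apply]
    by_cases hx : x ∈ G
    · obtain ⟨Q, hQ⟩ := Set.mem_iUnion.1 hx
      simp only [hg, hb, he, Pi.add_apply, Pi.sub_apply]
      rw [heval _ _ Q x hQ, heval _ _ Q x hQ, heval _ _ Q x hQ]
      split_ifs <;> simp [hx]
    · simp only [hg, hb, he, Pi.add_apply, Pi.sub_apply]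
      rw [heval0 _ _ x hx, heval0 _ _ x hx, heval0 _ _ x hx]
      simp [hx]
  have hT : opFun T f =ᵐ[volume] opFun T g + opFun T b + opFun T e := by
    rw [hdecomp]
    refine (opFun_add T (hgL.add hbL) heL).trans ?_
    filter_upwards [opFun_add T hgL hbL] with x hx
    simp [hx]
  have hlevel : volume {x | 3 * s < ‖opFun T f x‖ₑ} ≤ volume {x | s ≤ ‖opFun T g x‖ₑ} +
      volume {x | s ≤ ‖opFun T b x‖ₑ} + volume {x | s ≤ ‖opFun T e x‖ₑ} := by
    refine le_trans (measure_mono_ae ?_) ((measure_union_le _ _).trans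
      (add_le_add_left (measure_union_le _ _) _))
    filter_upwards [hT] with x hx h3
    have h3' : 3 * s < ‖opFun T f x‖ₑ := h3
    by_contra hcon
    have hcon' : ¬ ((s ≤ ‖opFun T g x‖ₑ ∨ s ≤ ‖opFun T b x‖ₑ) ∨ s ≤ ‖opFun T e x‖ₑ) := hcon
    push Not at hcon'
    obtain ⟨⟨a1, a2⟩, a3⟩ := hcon'
    refine absurd h3' (not_lt.2 ?_)
    rw [hx]
    calc _ ≤ ‖opFun T g x‖ₑ + ‖opFun T b x‖ₑ + ‖opFun T e x‖ₑ :=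
          (enorm_add_le _ _).trans (add_le_add_left (enorm_add_le _ _) _)
      _ ≤ s + s + s := add_le_add (add_le_add a1.le a2.le) a3.le
      _ = 3 * s := by ring
  have hcheb : ∀ u : Rn n → ℂ, s * volume {x | s ≤ ‖opFun T u x‖ₑ} ≤
      ‖T‖ₑ ^ 2 / s * ∫⁻ x, ‖u x‖ₑ ^ 2 := by
    intro u
    have h1 := mul_meas_ge_le_lintegral₀ (μ := volume) (f := fun x => ‖opFun T u x‖ₑ ^ 2)
      ((memLp_opFun T u).1.enorm.pow_const 2) (s ^ 2)
    have h2 : {x | s ≤ ‖opFun T u x‖ₑ} ⊆ {x | s ^ 2 ≤ ‖opFun T u x‖ₑ ^ 2} := fun x hx => by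
      simp only [Set.mem_ofPred_eq] at hx ⊢
      gcongr
    have h3 : s * (s * volume {x | s ≤ ‖opFun T u x‖ₑ}) ≤ ‖T‖ₑ ^ 2 * ∫⁻ x, ‖u x‖ₑ ^ 2 := by
      rw [← mul_assoc, ← sq]
      exact (mul_le_mul_right (measure_mono h2) _).trans (h1.trans (lintegral_opFun_sq_le T u))
    rw [← ENNReal.mul_div_right_comm, ENNReal.le_div_iff_mul_le (Or.inl hs0) (Or.inl hst),
      mul_comm]
    exact h3
  have hcQ : ∀ Q, ‖c Q‖ₑ * volume (q Q) ≤ ∫⁻ y in q Q, ‖f y‖ₑ := fun Q =>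
    enorm_average_mul_le f Q.1
  have hsumt : ∑ Q ∈ t, ∫⁻ y in q Q, ‖f y‖ₑ ≤ I := (ENNReal.sum_le_tsum t).trans hsum
  -- the good part
  have hgood : s * volume {x | s ≤ ‖opFun T g x‖ₑ} ≤ ‖T‖ₑ ^ 2 * (2 ^ n * 2) * I := by
    have h2n : s ≤ 2 ^ n * s := le_mul_of_one_le_left' (one_le_pow₀ (by norm_num))
    have hbound : ∀ᵐ x, ‖g x‖ₑ ≤ 2 ^ n * s := by
      filter_upwards [ae_enorm_le_of_average_le hn hfi.locallyIntegrable s] with x hx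
      by_cases hxG : x ∈ G
      · obtain ⟨Q, hQ⟩ := Set.mem_iUnion.1 hxG
        simp only [hg, Pi.add_apply]
        rw [heval _ _ Q x hQ]
        split_ifs
        · simpa [hxG] using enorm_average_le_of_mem_stoppingCubes Q.2
        · simp [hxG]
      · simp only [hg, Pi.add_apply]
        rw [heval0 _ _ x hxG, Set.indicator_of_mem hxG, add_zero]
        refine (hx fun j => ?_).trans h2n
        by_contra hcon
        obtain ⟨Q, hQ, hxQ⟩ := exists_mem_stoppingCubes hn hI hs0 (not_le.1 hcon)
        exact hxG (Set.mem_iUnion.2 ⟨⟨Q, hQ⟩, hxQ⟩)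
    have hg1 : ∫⁻ x, ‖g x‖ₑ ≤ 2 * I := by
      calc ∫⁻ x, ‖g x‖ₑ ≤ ∫⁻ x, (‖f x‖ₑ + ∑ Q ∈ t, (q Q).indicator (fun _ => ‖c Q‖ₑ) x) := by
            refine lintegral_mono fun x => ?_
            simp only [hg, Pi.add_apply, Finset.sum_apply]
            refine (enorm_add_le _ _).trans (add_le_add (enorm_indicator_le_enorm_self _ _) ?_)
            refine (enorm_sum_le _ _).trans (Finset.sum_le_sum fun Q _ => ?_)
            by_cases hx : x ∈ q Q <;> simp [hx]
        _ = I + ∑ Q ∈ t, ‖c Q‖ₑ * volume (q Q) := by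
            rw [lintegral_add_left' hf.1.enorm, lintegral_finsetSum' _
              fun Q _ => (measurable_const.indicator (hqm Q)).aemeasurable]
            congr 1
            refine Finset.sum_congr rfl fun Q _ => ?_
            rw [lintegral_indicator (hqm Q), setLIntegral_const]
        _ ≤ I + I := by
            gcongr
            exact (Finset.sum_le_sum fun Q _ => hcQ Q).trans hsumt
        _ = 2 * I := by ring
    have hg2 : ∫⁻ x, ‖g x‖ₑ ^ 2 ≤ 2 ^ n * s * (2 * I) := by
      calc ∫⁻ x, ‖g x‖ₑ ^ 2 ≤ ∫⁻ x, 2 ^ n * s * ‖g x‖ₑ := by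
            refine lintegral_mono_ae ?_
            filter_upwards [hbound] with x hx
            rw [sq]
            gcongr
        _ = 2 ^ n * s * ∫⁻ x, ‖g x‖ₑ := lintegral_const_mul' _ _
            (ENNReal.mul_ne_top (by simp) hst)
        _ ≤ _ := by gcongr
    refine (hcheb g).trans ?_
    calc ‖T‖ₑ ^ 2 / s * ∫⁻ x, ‖g x‖ₑ ^ 2 ≤ ‖T‖ₑ ^ 2 / s * (2 ^ n * s * (2 * I)) := by gcongr
      _ = ‖T‖ₑ ^ 2 / s * s * (2 ^ n * 2) * I := by ring
      _ = _ := by rw [ENNReal.div_mul_cancel hs0 hst]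
  have herr : s * volume {x | s ≤ ‖opFun T e x‖ₑ} ≤ η := by
    refine (hcheb e).trans (le_trans ?_ ht.le)
    gcongr
    calc ∫⁻ x, ‖e x‖ₑ ^ 2 ≤ ∫⁻ x, ∑' Q : {Q // Q ∉ t}, (q Q).indicator (fun y => ‖f y‖ₑ ^ 2) x := by
          refine lintegral_mono fun x => ?_
          by_cases hxG : x ∈ G
          · obtain ⟨Q, hQ⟩ := Set.mem_iUnion.1 hxG
            simp only [he, Pi.sub_apply]
            rw [heval _ _ Q x hQ]
            split_ifs with hQt
            · simp [hxG]
            · refine le_trans (le_of_eq ?_) (ENNReal.le_tsum ⟨Q, hQt⟩)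
              simp [hxG, hQ]
          · simp only [he, Pi.sub_apply]
            rw [heval0 _ _ x hxG]
            simp [hxG]
      _ = ∑' Q : {Q // Q ∉ t}, ∫⁻ y in q Q, ‖f y‖ₑ ^ 2 := by
          rw [lintegral_tsum fun Q : {Q // Q ∉ t} => (hf.1.enorm.pow_const 2).indicator (hqm Q.1)]
          exact tsum_congr fun Q => lintegral_indicator (hqm Q.1) _
  have hbad : s * volume {x | s ≤ ‖opFun T b x‖ₑ} ≤ (C₂ + C₁ * 2) * I := by
    have hne : ∀ Q : Sel, ∃ z, z ∈ q Q := fun Q =>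
      nonempty_of_measure_ne_zero (volume_dyadicCube_ne_zero Q.1)
    choose z hz using hne
    set B : Sel → Set (Rn n) := fun Q => Metric.closedBall (z Q) (2 * (√n * 2 ^ (-Q.1.1))) with hB
    set H := ⋃ Q, B Q with hH
    have hHm : MeasurableSet H := MeasurableSet.iUnion fun Q =>
      Metric.isClosed_closedBall.measurableSet
    have hvolH : s * volume H ≤ C₂ * I := by
      calc s * volume H ≤ s * ∑' Q, volume (B Q) := by gcongr; exact measure_iUnion_le _
        _ ≤ s * ∑' Q, C₂ * volume (q Q) := by
            gcongr with Q
            exact hC₂ Q.1 (z Q)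
        _ = C₂ * ∑' Q, s * volume (q Q) := by
            rw [ENNReal.tsum_mul_left, ENNReal.tsum_mul_left]; ring
        _ ≤ C₂ * ∑' Q, ∫⁻ y in q Q, ‖f y‖ₑ := by
            gcongr with Q
            exact Q.2.1.le
        _ ≤ C₂ * I := by gcongr
    -- Outside `H` a point is at least two diameters from the chosen point of every stopping cube,
    -- so the cancellation estimate applies to each bad piece. The factor 2 is for `∫ |f - c_Q| ≤ 2
    -- ∫ |f|` over a cube.
    have hfar : ∫⁻ x in Hᶜ, ‖opFun T b x‖ₑ ≤ C₁ * 2 * I := by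
      have hsumb : opFun T b =ᵐ[volume] ∑ Q ∈ t, opFun T ((q Q).indicator fun x => f x - c Q) :=
        opFun_sum T t fun Q _ => hbQ Q
      calc ∫⁻ x in Hᶜ, ‖opFun T b x‖ₑ ≤ ∫⁻ x in Hᶜ,
            ∑ Q ∈ t, ‖opFun T ((q Q).indicator fun x => f x - c Q) x‖ₑ := by
            refine lintegral_mono_ae (ae_restrict_of_ae ?_)
            filter_upwards [hsumb] with x hx
            rw [hx, Finset.sum_apply]
            exact enorm_sum_le _ _
        _ = ∑ Q ∈ t, ∫⁻ x in Hᶜ, ‖opFun T ((q Q).indicator fun x => f x - c Q) x‖ₑ :=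
            lintegral_finsetSum' _ fun Q _ => (memLp_opFun _ _).1.enorm.restrict
        _ ≤ ∑ Q ∈ t, C₁ * (2 * ∫⁻ y in q Q, ‖f y‖ₑ) := by
            refine Finset.sum_le_sum fun Q _ => ?_
            have hmean : ∫ x, (q Q).indicator (fun x => f x - c Q) x = 0 := by
              have hfin : IsFiniteMeasure (volume.restrict (q Q)) :=
                ⟨by simpa using (volume_dyadicCube_ne_top Q.1).lt_top⟩
              rw [integral_indicator (hqm Q), integral_sub hfi.integrableOn (integrable_const _)]
              simp only [hc]
              rw [setAverage_eq, setIntegral_const, smul_smul, mul_inv_cancel₀, one_smul, sub_self]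
              simp [measureReal_def, ENNReal.toReal_eq_zero_iff, hq, volume_dyadicCube_ne_zero,
                volume_dyadicCube_ne_top]
            have h1 := hC₁ Q.1 (z Q) _ (hz Q) (hbQ Q)
              (fun x hx => Set.indicator_of_notMem hx _) hmean
            refine le_trans (lintegral_mono_set fun x hx => ?_) (h1.trans ?_)
            · have : x ∉ B Q := fun h => hx (Set.mem_iUnion.2 ⟨Q, h⟩)
              simp only [hB, Metric.mem_closedBall, not_le, dist_eq_norm] at this
              exact this.le
            · gcongr
              calc ∫⁻ x, ‖(q Q).indicator (fun x => f x - c Q) x‖ₑ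
                  ≤ ∫⁻ x in q Q, (‖f x‖ₑ + ‖c Q‖ₑ) := by
                    rw [← lintegral_indicator (hqm Q)]
                    refine lintegral_mono fun x => ?_
                    by_cases hx : x ∈ q Q
                    · simp only [Set.indicator_of_mem hx]
                      exact enorm_sub_le
                    · simp [hx]
                _ = (∫⁻ x in q Q, ‖f x‖ₑ) + ‖c Q‖ₑ * volume (q Q) := by
                    rw [lintegral_add_right _ measurable_const, setLIntegral_const]
                _ ≤ _ := by
                    rw [two_mul]
                    gcongr
                    exact hcQ Q
        _ = C₁ * 2 * ∑ Q ∈ t, ∫⁻ y in q Q, ‖f y‖ₑ := by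
            rw [Finset.mul_sum]
            exact Finset.sum_congr rfl fun Q _ => by ring
        _ ≤ _ := by gcongr
    have hsplit : volume {x | s ≤ ‖opFun T b x‖ₑ} ≤
        volume H + (volume.restrict Hᶜ) {x | s ≤ ‖opFun T b x‖ₑ} := by
      rw [Measure.restrict_apply' hHm.compl]
      refine le_trans (measure_mono fun x hx => ?_) (measure_union_le _ _)
      by_cases hxH : x ∈ H
      · exact Or.inl hxH
      · exact Or.inr ⟨hx, hxH⟩
    calc s * volume {x | s ≤ ‖opFun T b x‖ₑ} ≤ s * volume H +
          s * (volume.restrict Hᶜ) {x | s ≤ ‖opFun T b x‖ₑ} := by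
          rw [← mul_add]
          gcongr
      _ ≤ C₂ * I + C₁ * 2 * I := by
          refine add_le_add hvolH (le_trans ?_ hfar)
          exact mul_meas_ge_le_lintegral₀ (memLp_opFun T b).1.enorm.restrict s
      _ = _ := by ring
  calc s * volume {x | 3 * s < ‖opFun T f x‖ₑ} ≤ s * (volume {x | s ≤ ‖opFun T g x‖ₑ} +
      volume {x | s ≤ ‖opFun T b x‖ₑ} + volume {x | s ≤ ‖opFun T e x‖ₑ}) := by gcongr
    _ ≤ ‖T‖ₑ ^ 2 * (2 ^ n * 2) * I + (C₂ + C₁ * 2) * I + η := by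
        rw [mul_add, mul_add]
        exact add_le_add (add_le_add hgood hbad) herr
    _ = _ := by
        rw [← add_mul]
        push_cast
        rfl

/-- An operator with a regular kernel is of weak type `(1,1)`. -/
theorem HasKernel.exists_weak_type_one (hn : 0 < n) (hK : HasKernel δ A K T) :
    ∃ C : ℝ≥0, ∀ f : Rn n → ℂ, MemLp f 2 volume → ∀ s : ℝ≥0∞, s ≠ ∞ →
      s * volume {x | s < ‖opFun T f x‖ₑ} ≤ C * ∫⁻ x, ‖f x‖ₑ := by
  obtain ⟨C, hC⟩ := hK.exists_weak_type_aux hn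
  -- The summand 1 keeps the constant nonzero, so that an infinite `‖f‖₁` makes the right-hand side
  -- infinite even if `C = 0`.
  refine ⟨3 * C + 1, fun f hf s hst => ?_⟩
  rcases eq_or_ne s 0 with rfl | hs0
  · simp
  rcases eq_or_ne (∫⁻ x, ‖f x‖ₑ) ∞ with hI | hI
  · rw [hI, ENNReal.mul_top (by simp)]
    exact le_top
  have h3 : s = 3 * (s / 3) := (ENNReal.mul_div_cancel (by norm_num) (by norm_num)).symm
  have := hC f hf hI (s / 3) (by simp [hs0]) (ENNReal.div_ne_top hst (by norm_num))
  rw [← h3] at this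
  calc s * volume {x | s < ‖opFun T f x‖ₑ} = 3 * (s / 3 * volume {x | s < ‖opFun T f x‖ₑ}) := by
        rw [← mul_assoc, ← h3]
    _ ≤ 3 * (C * ∫⁻ x, ‖f x‖ₑ) := by gcongr
    _ ≤ _ := by
        rw [← mul_assoc]
        gcongr
        push_cast
        exact le_self_add

end WeakType

/-! ### Interpolation -/

section Interpolation

variable {n : ℕ} {δ A : ℝ} {K K' : Rn n → Rn n → ℂ} {T : L2 n →L[ℂ] L2 n}

theorem measurable_opFun (T : L2 n →L[ℂ] L2 n) (f : Rn n → ℂ) : Measurable (opFun T f) := by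
  unfold opFun
  split_ifs with h
  · exact (Lp.stronglyMeasurable _).measurable
  · exact measurable_const

theorem sq_mul_volume_opFun_le (T : L2 n →L[ℂ] L2 n) (f : Rn n → ℂ) (s : ℝ≥0∞) :
    s ^ 2 * volume {x | s < ‖opFun T f x‖ₑ} ≤ ‖T‖ₑ ^ 2 * ∫⁻ x, ‖f x‖ₑ ^ 2 := by
  have h1 := mul_meas_ge_le_lintegral₀ (μ := volume) (f := fun x => ‖opFun T f x‖ₑ ^ 2)
    ((memLp_opFun T f).1.enorm.pow_const 2) (s ^ 2)
  have h2 : {x | s < ‖opFun T f x‖ₑ} ⊆ {x | s ^ 2 ≤ ‖opFun T f x‖ₑ ^ 2} := fun x hx => by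
    simp only [Set.mem_ofPred_eq] at hx ⊢
    gcongr
  exact (mul_le_mul_right (measure_mono h2) _).trans (h1.trans (lintegral_opFun_sq_le T f))

/-- The restricted strong type estimate below `L²`. -/
theorem HasKernel.exists_restricted_type (hn : 0 < n) (hK : HasKernel δ A K T) {ρ : ℝ}
    (h1 : 1 < ρ) (h2 : ρ < 2) : ∃ C : ℝ≥0, ∀ (g : Rn n → ℂ) (E : Set (Rn n)), MemLp g 2 volume →
      (∀ x, ‖g x‖ ≤ 1) → (∀ x, x ∉ E → g x = 0) → MeasurableSet E →
      ∫⁻ x, ‖opFun T g x‖ₑ ^ ρ ≤ C * volume E := by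
  obtain ⟨C₁, hC₁⟩ := hK.exists_weak_type_one hn
  -- In the layer-cake formula for the `ρ`-th power, levels up to 1 are estimated by weak type
  -- `(1,1)` and levels above 1 by the `L²` bound. The two remaining integrals converge because `ρ >
  -- 1` and `ρ < 2` respectively.
  have hJ₁ : ∫⁻ t in Set.Ioc (0 : ℝ) 1, ENNReal.ofReal (t ^ (ρ - 2)) < ∞ := by
    have := (intervalIntegral.intervalIntegrable_rpow' (a := 0) (b := 1) (r := ρ - 2)
      (by linarith)).1
    exact this.lintegral_lt_top
  have hJ₂ : ∫⁻ t in Set.Ioi (1 : ℝ), ENNReal.ofReal (t ^ (ρ - 3)) < ∞ :=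
    (integrableOn_Ioi_rpow_of_lt (a := ρ - 3) (c := 1) (by linarith) one_pos).lintegral_lt_top
  set J₁ := ∫⁻ t in Set.Ioc (0 : ℝ) 1, ENNReal.ofReal (t ^ (ρ - 2))
  set J₂ := ∫⁻ t in Set.Ioi (1 : ℝ), ENNReal.ofReal (t ^ (ρ - 3))
  set D := ENNReal.ofReal ρ * (C₁ * J₁ + ‖T‖ₑ ^ 2 * J₂) with hD
  have hDt : D ≠ ∞ := by
    refine ENNReal.mul_ne_top ENNReal.ofReal_ne_top (ENNReal.add_ne_top.2 ⟨?_, ?_⟩)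
    · exact ENNReal.mul_ne_top ENNReal.coe_ne_top hJ₁.ne
    · exact ENNReal.mul_ne_top (ENNReal.pow_ne_top enorm_ne_top) hJ₂.ne
  refine ⟨D.toNNReal, fun g E hg hg1 hgE hE => ?_⟩
  rw [ENNReal.coe_toNNReal hDt]
  have hle : ∀ x, ‖g x‖ₑ ≤ E.indicator (fun _ => 1) x := fun x => by
    by_cases hx : x ∈ E
    · rw [Set.indicator_of_mem hx, ← ofReal_norm]
      exact ENNReal.ofReal_le_one.2 (hg1 x)
    · simp [hgE x hx]
  have hint : ∫⁻ x, ‖g x‖ₑ ≤ volume E := by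
    refine (lintegral_mono hle).trans (le_of_eq ?_)
    rw [lintegral_indicator hE, setLIntegral_one]
  have hint2 : ∫⁻ x, ‖g x‖ₑ ^ 2 ≤ volume E := by
    refine le_trans (lintegral_mono fun x => ?_) hint
    have h1 : ‖g x‖ₑ ≤ 1 := by
      rw [← ofReal_norm]
      exact ENNReal.ofReal_le_one.2 (hg1 x)
    rw [sq]
    exact mul_le_of_le_one_left' h1
  have hlayer := lintegral_rpow_eq_lintegral_meas_lt_mul (volume : Measure (Rn n))
    (f := fun x => ‖opFun T g x‖) (ae_of_all _ fun x => norm_nonneg _)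
    (measurable_opFun T g).norm.aemeasurable (p := ρ) (by linarith)
  have e1 : ∀ x, ‖opFun T g x‖ₑ ^ ρ = ENNReal.ofReal (‖opFun T g x‖ ^ ρ) := fun x => by
    rw [← ofReal_norm, ENNReal.ofReal_rpow_of_nonneg (norm_nonneg _) (by linarith)]
  simp_rw [e1]
  rw [hlayer, hD, mul_assoc]
  gcongr
  have hset : ∀ t : ℝ, 0 < t → {x | t < ‖opFun T g x‖} =
      {x | ENNReal.ofReal t < ‖opFun T g x‖ₑ} := fun t ht => by
    ext x
    simp only [Set.mem_ofPred_eq]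
    rw [← ofReal_norm, ENNReal.ofReal_lt_ofReal_iff_of_nonneg ht.le]
  rw [← Set.Ioc_union_Ioi_eq_Ioi zero_le_one,
    lintegral_union measurableSet_Ioi (Set.Ioc_disjoint_Ioi le_rfl), add_mul]
  refine add_le_add ?_ ?_
  · rw [mul_right_comm, ← lintegral_const_mul _ (by fun_prop)]
    refine setLIntegral_mono' measurableSet_Ioc fun t ht => ?_
    have hw := (hC₁ g hg (ENNReal.ofReal t) ENNReal.ofReal_ne_top).trans
      (mul_le_mul_right hint _)
    rw [hset t ht.1]
    have : t ^ (ρ - 1) = t * t ^ (ρ - 2) := by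
      rw [← Real.rpow_one_add' ht.1.le (by linarith)]
      congr 1; ring
    rw [this, ENNReal.ofReal_mul ht.1.le, ← mul_assoc, mul_comm (volume _)]
    gcongr
  · rw [mul_right_comm, ← lintegral_const_mul _ (by fun_prop)]
    refine setLIntegral_mono' measurableSet_Ioi fun t ht => ?_
    have ht0 : 0 < t := zero_lt_one.trans ht
    have hw := (sq_mul_volume_opFun_le T g (ENNReal.ofReal t)).trans
      (mul_le_mul_right hint2 _)
    rw [hset t ht0]
    have : t ^ (ρ - 1) = t ^ 2 * t ^ (ρ - 3) := by
      rw [← Real.rpow_natCast, ← Real.rpow_add ht0]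
      congr 1; push_cast; ring
    rw [this, ENNReal.ofReal_mul (by positivity), ← mul_assoc, mul_comm (volume _),
      ENNReal.ofReal_pow ht0.le]
    gcongr

/-- The weak type estimate above `L²`, by duality. -/
theorem HasKernel.exists_weak_type_of_adjoint (hn : 0 < n)
    (hK : HasKernel δ A K (ContinuousLinearMap.adjoint T)) {p : ℝ} (hp : 2 < p) :
    ∃ C : ℝ≥0, ∀ f : Rn n → ℂ, MemLp f 2 volume → ∀ s : ℝ≥0∞, s ≠ ∞ →
      s ^ p * volume {x | s < ‖opFun T f x‖ₑ} ≤ C * ∫⁻ x, ‖f x‖ₑ ^ p := by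
  set ρ := p.conjExponent with hρ
  have hconj : p.HolderConjugate ρ := Real.HolderConjugate.conjExponent (by linarith)
  have hρ1 : 1 < ρ := hconj.symm.lt
  have hρ2 : ρ < 2 := by
    rw [hρ, Real.conjExponent, div_lt_iff₀ (by linarith)]
    linarith
  obtain ⟨C, hC⟩ := hK.exists_restricted_type hn hρ1 hρ2
  have hp0 : 0 < p := by linarith
  have hρ0 : 0 < ρ := by linarith
  refine ⟨C ^ (p / ρ), fun f hf s hst => ?_⟩
  rcases eq_or_ne s 0 with rfl | hs0
  · simp [ENNReal.zero_rpow_of_pos hp0]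
  set h := opFun T f with hh
  have hhm : Measurable h := measurable_opFun T f
  set E := {x | s < ‖h x‖ₑ} with hE
  have hEm : MeasurableSet E := measurableSet_lt measurable_const hhm.enorm
  -- Finiteness, from Chebyshev in `L²`, is what later permits cancelling a power of `volume E`.
  have hEt : volume E ≠ ∞ := by
    intro hcon
    have := sq_mul_volume_opFun_le T f s
    rw [← hh, ← hE, hcon, ENNReal.mul_top (by simp [hs0]), lintegral_sq_eq_eLpNorm, top_le_iff] at this
    exact ENNReal.mul_ne_top (ENNReal.pow_ne_top enorm_ne_top) (ENNReal.pow_ne_top hf.2.ne) this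
  rcases eq_or_ne (volume E) 0 with hE0 | hE0
  · rw [hE0]; simp
  -- The phase of `T f` on its level set: pairing `T f` with `g` gives the integral of `|T f|` over
  -- `E`, while `g` is admissible in the restricted estimate for the adjoint.
  set g : Rn n → ℂ := E.indicator fun x => h x / ‖h x‖ with hg
  have hgm : Measurable g :=
    Measurable.indicator (hhm.div (Complex.measurable_ofReal.comp hhm.norm)) hEm
  have hg1 : ∀ x, ‖g x‖ ≤ 1 := fun x => by
    by_cases hx : x ∈ E
    · simp only [hg, Set.indicator_of_mem hx, norm_div, Complex.norm_real, norm_norm]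
      exact div_self_le_one _
    · simp [hg, hx]
  have hgE : ∀ x, x ∉ E → g x = 0 := fun x hx => by simp [hg, hx]
  have hgL : MemLp g 2 volume := by
    have h1 : MemLp (E.indicator fun _ => (1 : ℂ)) 2 volume :=
      memLp_indicator_const _ hEm _ (Or.inr hEt)
    refine h1.mono hgm.aestronglyMeasurable (ae_of_all _ fun x => ?_)
    by_cases hx : x ∈ E
    · simpa [hx] using hg1 x
    · simp [hgE x hx]
  have hpair : ∀ x, h x * conj (g x) = ((E.indicator (fun x => ‖h x‖) x : ℝ) : ℂ) := fun x => by
    by_cases hx : x ∈ E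
    · simp only [hg, Set.indicator_of_mem hx, map_div₀, Complex.conj_ofReal]
      rw [mul_div_assoc', Complex.mul_conj, Complex.normSq_eq_norm_sq]
      rcases eq_or_ne ‖h x‖ 0 with h0 | h0
      · simp [h0]
      · have : (‖h x‖ : ℂ) ≠ 0 := by exact_mod_cast h0
        push_cast
        field_simp
    · simp [hg, hx]
  have hint : Integrable fun x => h x * conj (g x) := integrable_mul_conj (memLp_opFun T f) hgL
  have step1 : s * volume E ≤ ∫⁻ x, ‖f x‖ₑ * ‖opFun (ContinuousLinearMap.adjoint T) g x‖ₑ := by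
    calc s * volume E = ∫⁻ _ in E, s := by rw [setLIntegral_const]
      _ ≤ ∫⁻ x in E, ‖h x‖ₑ := setLIntegral_mono' hEm fun x hx => (le_of_lt hx)
      _ = ∫⁻ x, ENNReal.ofReal (E.indicator (fun x => ‖h x‖) x) := by
          rw [← lintegral_indicator hEm]
          refine lintegral_congr fun x => ?_
          by_cases hx : x ∈ E <;> simp [hx]
      _ = ENNReal.ofReal (∫ x, E.indicator (fun x => ‖h x‖) x) := by
          rw [ofReal_integral_eq_lintegral_ofReal]
          · have := hint.norm
            refine this.congr (ae_of_all _ fun x => ?_)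
            simp only [hpair, Complex.norm_real]
            exact Real.norm_of_nonneg (Set.indicator_nonneg (fun _ _ => norm_nonneg _) _)
          · exact ae_of_all _ fun x => Set.indicator_nonneg (fun _ _ => norm_nonneg _) _
      _ ≤ ‖∫ x, h x * conj (g x)‖ₑ := by
          simp_rw [hpair]
          rw [integral_complex_ofReal, ← ofReal_norm, Complex.norm_real]
          exact ENNReal.ofReal_le_ofReal (le_abs_self _)
      _ = ‖∫ x, f x * conj (opFun (ContinuousLinearMap.adjoint T) g x)‖ₑ := by
          rw [integral_opFun_mul_conj T hf hgL]
      _ ≤ _ := by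
          refine (enorm_integral_le_lintegral_enorm _).trans (le_of_eq ?_)
          refine lintegral_congr fun x => ?_
          rw [enorm_mul, RCLike.enorm_conj]
  set F := ∫⁻ x, ‖f x‖ₑ ^ p with hF
  have step2 : s * volume E ≤ F ^ (1 / p) * (C * volume E) ^ (1 / ρ) := by
    refine step1.trans ((ENNReal.lintegral_mul_le_Lp_mul_Lq volume hconj hf.1.enorm
      (measurable_opFun _ g).enorm.aemeasurable).trans ?_)
    gcongr
    exact hC g E hgL hg1 hgE hEm
  have step3 : s * volume E ^ (1 / p) ≤ F ^ (1 / p) * (C : ℝ≥0∞) ^ (1 / ρ) := by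
    have e : volume E = volume E ^ (1 / p) * volume E ^ (1 / ρ) := by
      rw [← ENNReal.rpow_add _ _ hE0 hEt, one_div, one_div, hconj.inv_add_inv_eq_one,
        ENNReal.rpow_one]
    rw [ENNReal.mul_rpow_of_nonneg _ _ (by positivity), ← mul_assoc] at step2
    nth_rw 1 [e] at step2
    rw [← mul_assoc] at step2
    exact (ENNReal.mul_le_mul_iff_left (by simp [hE0, hEt])
      (ENNReal.rpow_ne_top_of_nonneg (by positivity) hEt)).1 step2
  calc s ^ p * volume E = (s * volume E ^ (1 / p)) ^ p := by
        rw [ENNReal.mul_rpow_of_nonneg _ _ hp0.le, ← ENNReal.rpow_mul, one_div_mul_cancel hp0.ne',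
          ENNReal.rpow_one]
    _ ≤ (F ^ (1 / p) * (C : ℝ≥0∞) ^ (1 / ρ)) ^ p := by gcongr
    _ = _ := by
        rw [ENNReal.mul_rpow_of_nonneg _ _ hp0.le, ← ENNReal.rpow_mul, one_div_mul_cancel hp0.ne',
          ENNReal.rpow_one, ← ENNReal.rpow_mul, mul_comm]
        congr 1
        rw [ENNReal.coe_rpow_of_nonneg _ (by positivity)]
        congr 1
        ring

/-- For any `s` above `(B/τ)^{1/p}` the hypothesis gives `μ {|u| > s} ≤ B / s^p ≤ τ`. -/
theorem rearrangement_le_of_weak_type {X : Type*} [MeasurableSpace X] {μ : Measure X} {u : X → ℂ}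
    {p : ℝ} (hp : 0 < p) {B : ℝ≥0∞}
    (h : ∀ s : ℝ≥0∞, s ≠ ∞ → s ^ p * μ {x | s < ‖u x‖ₑ} ≤ B) {τ : ℝ≥0∞} (hτ : τ ≠ 0)
    (hτt : τ ≠ ∞) : rearrangement u μ τ ≤ (B / τ) ^ (1 / p) := by
  refine le_of_forall_gt_imp_ge_of_dense fun s hs => ?_
  rcases eq_or_ne s ∞ with rfl | hst
  · exact le_top
  refine rearrangement_le_iff.2 ?_
  have hs0 : s ≠ 0 := (pos_of_gt hs).ne'
  have h1 : B / τ ≤ s ^ p := by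
    calc B / τ = ((B / τ) ^ (1 / p)) ^ p := by
          rw [← ENNReal.rpow_mul, one_div_mul_cancel hp.ne', ENNReal.rpow_one]
      _ ≤ s ^ p := by gcongr
  rw [ENNReal.div_le_iff hτ hτt] at h1
  have hsp0 : s ^ p ≠ 0 := by simp [hs0, hst]
  have hspt : s ^ p ≠ ∞ := ENNReal.rpow_ne_top_of_nonneg hp.le hst
  exact (ENNReal.mul_le_mul_iff_right hsp0 hspt).1 ((h s hst).trans h1)

/-- Each term satisfies `x_i^p ≤ x_i (∑ x)^{p-1}`. -/
theorem tsum_rpow_le_rpow_tsum {ι : Type*} (x : ι → ℝ≥0∞) {p : ℝ} (hp : 1 ≤ p) :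
    ∑' i, x i ^ p ≤ (∑' i, x i) ^ p := by
  have e : ∀ y : ℝ≥0∞, y ^ p = y * y ^ (p - 1) := fun y => by
    conv_lhs => rw [show p = 1 + (p - 1) by ring,
      ENNReal.rpow_add_of_nonneg _ _ zero_le_one (by linarith), ENNReal.rpow_one]
  rw [e, ← ENNReal.tsum_mul_right]
  refine ENNReal.tsum_le_tsum fun i => ?_
  rw [e]
  have : 0 ≤ p - 1 := by linarith
  gcongr
  exact ENNReal.le_tsum i

/-- The weights in the rearrangement inequality for operators of weak types `(1,1)`, `(p,p)`. -/
def dilWeight (p : ℝ) : ℕ ⊕ ℕ → ℝ≥0∞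
  | Sum.inl i => (2⁻¹) ^ i
  | Sum.inr i => ((2 : ℝ≥0∞) ^ (1 / p)) ^ i

/-- The dilations in the rearrangement inequality. -/
def dilFactor : ℕ ⊕ ℕ → ℝ
  | Sum.inl i => (2⁻¹) ^ (i + 1)
  | Sum.inr i => 2 ^ i

theorem dilFactor_pos (k : ℕ ⊕ ℕ) : 0 < dilFactor k := by
  cases k <;> simp only [dilFactor] <;> positivity

/-- The superposition of dilations of the rearrangement of `f` that controls `T f`. -/
def dilSum (p : ℝ) (f : Rn n → ℂ) (τ : ℝ) : ℝ≥0∞ :=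
  ∑' k, dilWeight p k * rearrangement f volume (ENNReal.ofReal (dilFactor k * τ))

theorem dilSum_eq (p : ℝ) (f : Rn n → ℂ) (τ : ℝ) : dilSum p f τ =
    (∑' i : ℕ, (2⁻¹) ^ i * rearrangement f volume (ENNReal.ofReal ((2⁻¹) ^ (i + 1) * τ))) +
    ∑' i : ℕ, ((2 : ℝ≥0∞) ^ (1 / p)) ^ i *
      rearrangement f volume (ENNReal.ofReal (2 ^ i * τ)) :=
  ENNReal.summable.tsum_sum ENNReal.summable

theorem dilSum_mono {p : ℝ} {f g : Rn n → ℂ} (h : ∀ x, ‖f x‖ₑ ≤ ‖g x‖ₑ) (τ : ℝ) :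
    dilSum p f τ ≤ dilSum p g τ :=
  ENNReal.tsum_le_tsum fun k => by
    gcongr
    exact rearrangement_mono_ae (ae_of_all _ h) _

/-- Here the exponent must lie strictly between the two weak types. The sum from the large part has
ratio `2^{1/p - 1}`, which needs `p > 1`; the sum from the small part has ratio `2^{1/p₁ - 1/p}`,
which needs `p < p₁`. -/
theorem tsum_dilWeight_lt_top {p p₁ : ℝ} (hp : 1 < p) (hpp : p < p₁) :
    ∑' k, dilWeight p₁ k * ENNReal.ofReal (dilFactor k) ^ (-(1 / p)) < ∞ := by
  have hs : ∑' k, dilWeight p₁ k * ENNReal.ofReal (dilFactor k) ^ (-(1 / p)) =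
      (∑' i : ℕ, (2⁻¹ : ℝ≥0∞) ^ i * ENNReal.ofReal ((2⁻¹) ^ (i + 1)) ^ (-(1 / p))) +
      ∑' i : ℕ, ((2 : ℝ≥0∞) ^ (1 / p₁)) ^ i * ENNReal.ofReal (2 ^ i) ^ (-(1 / p)) :=
    ENNReal.summable.tsum_sum ENNReal.summable
  have geom : ∀ c : ℝ, c < 0 → ∑' i : ℕ, ((2 : ℝ≥0∞) ^ c) ^ i < ∞ := fun c hc => by
    rw [ENNReal.tsum_geometric, ENNReal.inv_lt_top, tsub_pos_iff_lt]
    exact ENNReal.rpow_lt_one_of_one_lt_of_neg (by norm_num) hc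
  rw [hs]
  refine ENNReal.add_lt_top.2 ⟨?_, ?_⟩
  · have e : ∀ i : ℕ, (2⁻¹ : ℝ≥0∞) ^ i * ENNReal.ofReal ((2⁻¹) ^ (i + 1)) ^ (-(1 / p)) =
        2 ^ (1 / p) * ((2 : ℝ≥0∞) ^ (1 / p - 1)) ^ i := fun i => by
      rw [ENNReal.ofReal_pow (by norm_num), ENNReal.ofReal_inv_of_pos two_pos, ENNReal.ofReal_ofNat,
        ← ENNReal.rpow_neg_one, ← ENNReal.rpow_natCast, ← ENNReal.rpow_natCast _ (i + 1),
        ← ENNReal.rpow_natCast _ i,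
        ← ENNReal.rpow_mul, ← ENNReal.rpow_mul, ← ENNReal.rpow_mul, ← ENNReal.rpow_mul,
        ← ENNReal.rpow_add _ _ (by simp) (by simp), ← ENNReal.rpow_add _ _ (by simp) (by simp)]
      congr 1
      push_cast
      ring
    simp_rw [e]
    rw [ENNReal.tsum_mul_left]
    refine ENNReal.mul_lt_top (ENNReal.rpow_lt_top_of_nonneg (by positivity) (by simp)) (geom _ ?_)
    rw [sub_neg, div_lt_one (by linarith)]
    exact hp
  · have e : ∀ i : ℕ, ((2 : ℝ≥0∞) ^ (1 / p₁)) ^ i * ENNReal.ofReal (2 ^ i) ^ (-(1 / p)) =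
        ((2 : ℝ≥0∞) ^ (1 / p₁ - 1 / p)) ^ i := fun i => by
      rw [ENNReal.ofReal_pow (by norm_num), ENNReal.ofReal_ofNat,
        ← ENNReal.rpow_natCast, ← ENNReal.rpow_natCast, ← ENNReal.rpow_natCast _ i,
        ← ENNReal.rpow_mul, ← ENNReal.rpow_mul, ← ENNReal.rpow_mul,
        ← ENNReal.rpow_add _ _ (by simp) (by simp)]
      congr 1
      ring
    simp_rw [e]
    refine geom _ ?_
    rw [sub_neg]
    exact one_div_lt_one_div_of_lt (by linarith) hpp

theorem exists_lorentzNorm_le_of_dilSum {p p₁ : ℝ} {q : ℝ≥0∞} (hp : 1 < p) (hpp : p < p₁)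
    (hq : 1 ≤ q) (C : ℝ≥0) : ∃ C' : ℝ≥0, ∀ f g : Rn n → ℂ,
      (∀ τ : ℝ, 0 < τ → rearrangement g volume (ENNReal.ofReal (2 * τ)) ≤ C * dilSum p₁ f τ) →
      lorentzNorm p q g volume ≤ C' * lorentzNorm p q f volume := by
  have hfin := tsum_dilWeight_lt_top hp hpp
  set S := ∑' k, dilWeight p₁ k * ENNReal.ofReal (dilFactor k) ^ (-(1 / p))
  have hw : ∀ k, (C : ℝ≥0∞) * dilWeight p₁ k ≠ ∞ := fun k => by
    refine ENNReal.mul_ne_top ENNReal.coe_ne_top ?_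
    cases k
    · exact ENNReal.pow_ne_top (by simp)
    · refine ENNReal.pow_ne_top (ENNReal.rpow_ne_top_of_nonneg ?_ (by simp))
      have : 0 < p₁ := by linarith
      positivity
  refine ⟨(2 ^ (1 / p) * (C * S)).toNNReal, fun f g h => ?_⟩
  rw [ENNReal.coe_toNNReal (ENNReal.mul_ne_top (ENNReal.rpow_ne_top_of_nonneg
    (by have : 0 < p := by linarith
        positivity) (by simp))
    (ENNReal.mul_ne_top ENNReal.coe_ne_top hfin.ne))]
  have := lorentzNorm_le_of_rearrangement_le (p := p) hq (f := f) (μ := volume) (g := g)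
    (ν := volume) hw dilFactor_pos (fun τ hτ => (h τ hτ).trans (le_of_eq ?_))
  · simp_rw [mul_assoc (C : ℝ≥0∞)] at this
    rwa [ENNReal.tsum_mul_left] at this
  · rw [dilSum, ← ENNReal.tsum_mul_left]
    simp_rw [mul_assoc]

/-- With `a i = f^*(2^{-i} τ)`, almost every point of the large part lies in some layer `a i < |f| ≤
a (i+1)`, because the sets `{|f| > a i}` have measure at most `2^{-i} τ` and so a null intersection.
-/
theorem lintegral_large_part_le {f : Rn n → ℂ} (hf : Measurable f) (τ : ℝ) :
    ∫⁻ x, ‖{x | rearrangement f volume (ENNReal.ofReal τ) < ‖f x‖ₑ}.indicator f x‖ₑ ≤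
      ENNReal.ofReal τ * ∑' i : ℕ, (2⁻¹) ^ i *
        rearrangement f volume (ENNReal.ofReal ((2⁻¹) ^ (i + 1) * τ)) := by
  classical
  set a : ℕ → ℝ≥0∞ := fun i => rearrangement f volume (ENNReal.ofReal ((2⁻¹) ^ i * τ)) with ha
  set E : ℕ → Set (Rn n) := fun i => {x | a i < ‖f x‖ₑ} with hE
  have hEm : ∀ i, MeasurableSet (E i) := fun i => measurableSet_lt measurable_const hf.enorm
  have hEv : ∀ i, volume (E i) ≤ ENNReal.ofReal τ * (2⁻¹) ^ i := fun i => by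
    refine (measure_rearrangement_lt_le f volume _).trans (le_of_eq ?_)
    rw [ENNReal.ofReal_mul (by positivity), ENNReal.ofReal_pow (by positivity),
      ENNReal.ofReal_inv_of_pos two_pos, ENNReal.ofReal_ofNat, mul_comm]
  have hnull : ∀ᵐ x, ∃ i, ‖f x‖ₑ ≤ a i := by
    have h0 : volume (⋂ i, E i) = 0 := by
      have hlim : Tendsto (fun i : ℕ => ENNReal.ofReal τ * (2⁻¹) ^ i) atTop (𝓝 0) := by
        have := ENNReal.Tendsto.const_mul (ENNReal.tendsto_pow_atTop_nhds_zero_of_lt_one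
          (show (2⁻¹ : ℝ≥0∞) < 1 by simp)) (Or.inr (ENNReal.ofReal_ne_top (r := τ)))
        rwa [mul_zero] at this
      refine le_antisymm (ge_of_tendsto' hlim fun i => ?_) zero_le
      exact (measure_mono (Set.iInter_subset E i)).trans (hEv i)
    filter_upwards [measure_eq_zero_iff_ae_notMem.1 h0] with x hx
    simpa [hE] using hx
  have ha0 : a 0 = rearrangement f volume (ENNReal.ofReal τ) := by simp [ha]
  calc _ ≤ ∫⁻ x, ∑' i, (E i).indicator (fun _ => a (i + 1)) x := by
        refine lintegral_mono_ae ?_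
        filter_upwards [hnull] with x hx
        rw [← ha0]
        by_cases hx0 : a 0 < ‖f x‖ₑ
        · have hmem : x ∈ {x | a 0 < ‖f x‖ₑ} := hx0
          rw [Set.indicator_of_mem hmem]
          have hne : Nat.find hx ≠ 0 := fun h => by
            have := Nat.find_spec hx
            rw [h] at this
            exact absurd hx0 (not_lt.2 this)
          obtain ⟨i, hi⟩ := Nat.exists_eq_succ_of_ne_zero hne
          have h1 : ‖f x‖ₑ ≤ a (i + 1) := by
            have := Nat.find_spec hx
            rwa [hi] at this
          have h2 : x ∈ E i := not_le.1 (Nat.find_min hx (by omega))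
          refine le_trans ?_ (ENNReal.le_tsum i)
          rwa [Set.indicator_of_mem h2]
        · have hmem : x ∉ {x | a 0 < ‖f x‖ₑ} := hx0
          rw [Set.indicator_of_notMem hmem]
          simp
    _ = ∑' i, a (i + 1) * volume (E i) := by
        rw [lintegral_tsum fun i => (measurable_const.indicator (hEm i)).aemeasurable]
        exact tsum_congr fun i => by rw [lintegral_indicator (hEm i), setLIntegral_const]
    _ ≤ ∑' i, a (i + 1) * (ENNReal.ofReal τ * (2⁻¹) ^ i) := by
        gcongr with i
        exact hEv i
    _ = _ := by
        rw [← ENNReal.tsum_mul_left]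
        exact tsum_congr fun i => by ring

/-- The same layering in the other direction, with `a i = f^*(2^i τ)`: the layer `a (i+1) < |f| ≤ a
i` has measure at most `2^{i+1} τ`. Finally an `ℓ^p` sum is bounded by an `ℓ¹` sum, which makes the
estimate linear in `f^*`. -/
theorem lintegral_small_part_le {f : Rn n → ℂ} (hf : Measurable f) {E₀ : Set (Rn n)}
    (hE₀ : volume E₀ ≠ ∞) (hf0 : ∀ x, x ∉ E₀ → f x = 0) {p : ℝ} (hp : 1 ≤ p) {τ : ℝ}
    (hτ : 0 < τ) :
    ∫⁻ x, ‖{x | rearrangement f volume (ENNReal.ofReal τ) < ‖f x‖ₑ}ᶜ.indicator f x‖ₑ ^ p ≤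
      ENNReal.ofReal τ * (2 ^ (1 / p) * ∑' i : ℕ, ((2 : ℝ≥0∞) ^ (1 / p)) ^ i *
        rearrangement f volume (ENNReal.ofReal (2 ^ i * τ))) ^ p := by
  classical
  have hp0 : 0 < p := by linarith
  set a : ℕ → ℝ≥0∞ := fun i => rearrangement f volume (ENNReal.ofReal (2 ^ i * τ)) with ha
  set E : ℕ → Set (Rn n) := fun i => {x | a i < ‖f x‖ₑ} with hE
  have hEm : ∀ i, MeasurableSet (E i) := fun i => measurableSet_lt measurable_const hf.enorm
  have hEv : ∀ i, volume (E i) ≤ ENNReal.ofReal τ * 2 ^ i := fun i => by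
    refine (measure_rearrangement_lt_le f volume _).trans (le_of_eq ?_)
    rw [ENNReal.ofReal_mul (by positivity), ENNReal.ofReal_pow (by positivity),
      ENNReal.ofReal_ofNat, mul_comm]
  -- The rearrangement vanishes beyond the measure of `E₀`, so every point with `f x ≠ 0` belongs to
  -- some layer.
  have hzero : ∃ i, a i = 0 := by
    obtain ⟨N, hN⟩ := exists_nat_ge ((volume E₀).toReal / τ)
    refine ⟨N, le_antisymm (rearrangement_le_iff.2 ?_) zero_le⟩
    refine (measure_mono (t := E₀) fun x hx => ?_).trans ?_
    · by_contra hc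
      simp [hf0 x hc] at hx
    · rw [← ENNReal.ofReal_toReal hE₀]
      refine ENNReal.ofReal_le_ofReal ?_
      rw [div_le_iff₀ hτ] at hN
      refine hN.trans ?_
      gcongr
      exact_mod_cast Nat.lt_two_pow_self.le
  have ha0 : a 0 = rearrangement f volume (ENNReal.ofReal τ) := by simp [ha]
  calc _ ≤ ∫⁻ x, ∑' i, (E (i + 1)).indicator (fun _ => a i ^ p) x := by
        refine lintegral_mono fun x => ?_
        rw [← ha0]
        by_cases hx0 : a 0 < ‖f x‖ₑ
        · have hmem : x ∉ {x | a 0 < ‖f x‖ₑ}ᶜ := fun h => h hx0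
          rw [Set.indicator_of_notMem hmem]
          simp [hp0]
        · have hmem : x ∈ {x | a 0 < ‖f x‖ₑ}ᶜ := hx0
          rw [Set.indicator_of_mem hmem]
          rcases eq_or_ne (f x) 0 with hfx | hfx
          · simp [hfx, hp0]
          have hx : ∃ i, a i < ‖f x‖ₑ := by
            obtain ⟨i, hi⟩ := hzero
            exact ⟨i, by rw [hi]; simpa using hfx⟩
          have hne : Nat.find hx ≠ 0 := fun h => by
            have := Nat.find_spec hx
            rw [h] at this
            exact hx0 this
          obtain ⟨i, hi⟩ := Nat.exists_eq_succ_of_ne_zero hne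
          have h1 : x ∈ E (i + 1) := by
            have := Nat.find_spec hx
            rwa [hi] at this
          have h2 : ‖f x‖ₑ ≤ a i := not_lt.1 (Nat.find_min hx (by omega))
          refine le_trans ?_ (ENNReal.le_tsum i)
          rw [Set.indicator_of_mem h1]
          gcongr
    _ = ∑' i, a i ^ p * volume (E (i + 1)) := by
        rw [lintegral_tsum fun i => (measurable_const.indicator (hEm _)).aemeasurable]
        exact tsum_congr fun i => by rw [lintegral_indicator (hEm _), setLIntegral_const]
    _ ≤ ∑' i, a i ^ p * (ENNReal.ofReal τ * 2 ^ (i + 1)) := by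
        gcongr with i
        exact hEv _
    _ = ENNReal.ofReal τ * ∑' i, (2 ^ (1 / p) * (((2 : ℝ≥0∞) ^ (1 / p)) ^ i * a i)) ^ p := by
        rw [← ENNReal.tsum_mul_left]
        refine tsum_congr fun i => ?_
        have h2 : (((2 : ℝ≥0∞) ^ (1 / p)) ^ (i + 1)) ^ p = 2 ^ (i + 1) := by
          rw [← ENNReal.rpow_natCast, ← ENNReal.rpow_mul, ← ENNReal.rpow_mul,
            show 1 / p * (((i + 1 : ℕ) : ℝ) * p) = ((i + 1 : ℕ) : ℝ) by field_simp,
            ENNReal.rpow_natCast]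
        rw [← mul_assoc ((2 : ℝ≥0∞) ^ (1 / p)), ← pow_succ',
          ENNReal.mul_rpow_of_nonneg _ _ hp0.le, h2]
        ring
    _ ≤ _ := by
        gcongr
        refine (tsum_rpow_le_rpow_tsum _ hp).trans (le_of_eq ?_)
        rw [ENNReal.tsum_mul_left]

/-- The rearrangement inequality for an operator with a kernel that is regular in both variables. -/
theorem HasKernel.exists_rearrangement_le (hn : 0 < n) (hK : HasKernel δ A K T)
    (hK' : HasKernel δ A K' (ContinuousLinearMap.adjoint T)) {p : ℝ} (hp : 2 < p) :
    ∃ C : ℝ≥0, ∀ (f : Rn n → ℂ) (E₀ : Set (Rn n)), Measurable f → MemLp f 2 volume →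
      volume E₀ ≠ ∞ → (∀ x, x ∉ E₀ → f x = 0) → ∀ τ : ℝ, 0 < τ →
      rearrangement (opFun T f) volume (ENNReal.ofReal (2 * τ)) ≤ C * dilSum p f τ := by
  obtain ⟨C₁, hC₁⟩ := hK.exists_weak_type_one hn
  obtain ⟨C₂, hC₂⟩ := hK'.exists_weak_type_of_adjoint hn hp
  have hp0 : 0 < p := by linarith
  set D : ℝ≥0 := C₂ ^ (1 / p) * 2 ^ (1 / p) with hD
  refine ⟨C₁ + D, fun f E₀ hfm hf hE₀ hf0 τ hτ => ?_⟩
  -- The function is cut at height `f^*(τ)`. The large part goes through weak type `(1,1)`, the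
  -- small part through weak type `(p,p)`, each at `τ`, so that the sum is estimated at `2τ`.
  set H := {x | rearrangement f volume (ENNReal.ofReal τ) < ‖f x‖ₑ} with hH
  have hHm : MeasurableSet H := measurableSet_lt measurable_const hfm.enorm
  have h1 : MemLp (H.indicator f) 2 volume := hf.indicator hHm
  have h2 : MemLp (Hᶜ.indicator f) 2 volume := hf.indicator hHm.compl
  have hτ0 : ENNReal.ofReal τ ≠ 0 := by simpa using hτ
  have hTf : opFun T f =ᵐ[volume] opFun T (H.indicator f) + opFun T (Hᶜ.indicator f) := by
    have := opFun_add T h1 h2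
    rwa [Set.indicator_self_add_compl] at this
  rw [rearrangement_congr_ae hTf, two_mul, ENNReal.ofReal_add hτ.le hτ.le]
  refine (rearrangement_add_le _ _ _ _ _).trans ?_
  rw [dilSum_eq]
  set S₁ := ∑' i : ℕ, (2⁻¹) ^ i *
    rearrangement f volume (ENNReal.ofReal ((2⁻¹) ^ (i + 1) * τ)) with hS₁
  set S₂ := ∑' i : ℕ, ((2 : ℝ≥0∞) ^ (1 / p)) ^ i *
      rearrangement f volume (ENNReal.ofReal (2 ^ i * τ)) with hS₂
  have b1 : rearrangement (opFun T (H.indicator f)) volume (ENNReal.ofReal τ) ≤ C₁ * S₁ := by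
    have := rearrangement_le_of_weak_type (u := opFun T (H.indicator f)) (μ := volume) (p := 1)
      one_pos (B := C₁ * (ENNReal.ofReal τ * S₁)) (fun s hs => by
        rw [ENNReal.rpow_one]
        refine (hC₁ _ h1 s hs).trans ?_
        gcongr
        exact lintegral_large_part_le hfm τ) hτ0 ENNReal.ofReal_ne_top
    refine this.trans (le_of_eq ?_)
    rw [div_one, ENNReal.rpow_one, mul_left_comm, mul_comm (ENNReal.ofReal τ),
      ENNReal.mul_div_cancel_right hτ0 ENNReal.ofReal_ne_top]
  have b2 : rearrangement (opFun T (Hᶜ.indicator f)) volume (ENNReal.ofReal τ) ≤ D * S₂ := by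
    have := rearrangement_le_of_weak_type (u := opFun T (Hᶜ.indicator f)) (μ := volume) (p := p)
      hp0 (B := C₂ * (ENNReal.ofReal τ * (2 ^ (1 / p) * S₂) ^ p)) (fun s hs => by
        refine (hC₂ _ h2 s hs).trans ?_
        gcongr
        exact lintegral_small_part_le hfm hE₀ hf0 (by linarith) hτ) hτ0 ENNReal.ofReal_ne_top
    refine this.trans (le_of_eq ?_)
    rw [mul_left_comm, mul_comm (ENNReal.ofReal τ),
      ENNReal.mul_div_cancel_right hτ0 ENNReal.ofReal_ne_top,
      ENNReal.mul_rpow_of_nonneg _ _ (by positivity), ← ENNReal.rpow_mul,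
      mul_one_div_cancel hp0.ne', ENNReal.rpow_one, ← mul_assoc, hD]
    push_cast
    rw [ENNReal.coe_rpow_of_nonneg _ (by positivity), ENNReal.coe_rpow_of_nonneg _ (by positivity)]
    simp
  calc _ ≤ C₁ * S₁ + D * S₂ := add_le_add b1 b2
    _ ≤ (C₁ + D) * S₁ + (C₁ + D) * S₂ := by
        gcongr
        · exact le_self_add
        · exact le_add_self
    _ = _ := by
        rw [← mul_add]
        push_cast
        rfl

end Interpolation

/-! ### Operators defined by duality -/

section Transform

theorem ae_summable_norm {X ι : Type*} [MeasurableSpace X] {μ : Measure X} [Countable ι]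
    {F : ι → X → ℂ} (hF : ∀ i, AEStronglyMeasurable (F i) μ)
    (h : ∑' i, ∫⁻ x, ‖F i x‖ₑ ∂μ ≠ ∞) : ∀ᵐ x ∂μ, Summable fun i => ‖F i x‖ := by
  rw [← lintegral_tsum fun i => (hF i).enorm] at h
  filter_upwards [ae_lt_top' (AEMeasurable.tsum fun i => (hF i).enorm) h] with x hx
  have := ENNReal.summable_toReal hx.ne
  simpa using this

theorem integrable_tsum {X ι : Type*} [MeasurableSpace X] {μ : Measure X} [Countable ι]
    {F : ι → X → ℂ} (hF : ∀ i, AEStronglyMeasurable (F i) μ)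
    (h : ∑' i, ∫⁻ x, ‖F i x‖ₑ ∂μ ≠ ∞) : Integrable (fun x => ∑' i, F i x) μ := by
  have hs := ae_summable_norm hF h
  refine ⟨aestronglyMeasurable_of_tendsto_ae atTop
    (f := fun (s : Finset ι) x => ∑ i ∈ s, F i x) (fun s => ?_) ?_, ?_⟩
  · exact Finset.aestronglyMeasurable_fun_sum s fun i _ => hF i
  · filter_upwards [hs] with x hx using hx.of_norm.hasSum
  · rw [← lintegral_tsum fun i => (hF i).enorm] at h
    refine lt_of_le_of_lt (lintegral_mono_ae ?_) (lt_top_iff_ne_top.2 h)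
    filter_upwards [hs] with x hx
    exact enorm_tsum_le_tsum_enorm

variable {n : ℕ} {δ A : ℝ} {K K' : Rn n → Rn n → ℂ} {T : L2 n →L[ℂ] L2 n}
  {f g f' g' ψ : Rn n → ℂ} {E Q : Set (Rn n)}

/-- Bounded measurable functions with bounded support. -/
structure TestFun {n : ℕ} (ψ : Rn n → ℂ) : Prop where
  meas : Measurable ψ
  bdd : ∃ M, ∀ x, ‖ψ x‖ ≤ M
  supp : ∃ E, Bornology.IsBounded E ∧ ∀ x, x ∉ E → ψ x = 0

theorem TestFun.memLp (h : TestFun ψ) (p : ℝ≥0∞) : MemLp ψ p volume := by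
  obtain ⟨M, hM⟩ := h.bdd
  obtain ⟨E, hE, h0⟩ := h.supp
  exact memLp_two_of_bounded_support hE h.meas.aestronglyMeasurable hM h0 p

theorem TestFun.integrable (h : TestFun ψ) : Integrable ψ := memLp_one_iff_integrable.1 (h.memLp 1)

theorem TestFun.conj (h : TestFun ψ) : TestFun fun x => conj (ψ x) where
  meas := Complex.continuous_conj.measurable.comp h.meas
  bdd := by simpa using h.bdd
  supp := by simpa using h.supp

theorem TestFun.indicator (h : TestFun ψ) (hQ : MeasurableSet Q) : TestFun (Q.indicator ψ) where
  meas := h.meas.indicator hQ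
  bdd := by
    obtain ⟨M, hM⟩ := h.bdd
    exact ⟨M, fun x => (norm_indicator_le_norm_self _ _).trans (hM x)⟩
  supp := by
    obtain ⟨E, hE, h0⟩ := h.supp
    exact ⟨E, hE, fun x hx => by simp [h0 x hx]⟩

theorem testFun_indicator_one (hQ : MeasurableSet Q) (hb : Bornology.IsBounded Q) :
    TestFun (Q.indicator fun _ => (1 : ℂ)) where
  meas := measurable_const.indicator hQ
  bdd := ⟨1, fun x => (norm_indicator_le_norm_self _ _).trans (by simp)⟩
  supp := ⟨Q, hb, fun x hx => Set.indicator_of_notMem hx _⟩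

theorem testFun_of_hasCompactSupport (φ : 𝓢(Rn n, ℂ)) (h : HasCompactSupport φ) :
    TestFun (φ : Rn n → ℂ) where
  meas := φ.continuous.measurable
  bdd := h.exists_bound_of_continuous φ.continuous
  supp := ⟨tsupport φ, h.isCompact.isBounded, fun _ hx => image_eq_zero_of_notMem_tsupport hx⟩

/-- `g` is, on `Q`, the image of `f` under `T`, in the sense of duality. -/
def IsTransformOn {n : ℕ} (T : L2 n →L[ℂ] L2 n) (Q : Set (Rn n)) (f g : Rn n → ℂ) : Prop :=
  ∀ ψ : Rn n → ℂ, TestFun ψ → (∀ x, x ∉ Q → ψ x = 0) →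
    Integrable (fun x => g x * conj (ψ x)) ∧
    Integrable (fun x => f x * conj (opFun (ContinuousLinearMap.adjoint T) ψ x)) ∧
    ∫ x, g x * conj (ψ x) = ∫ x, f x * conj (opFun (ContinuousLinearMap.adjoint T) ψ x)

/-- `g` is the image of `f` under `T`, in the sense of duality. -/
abbrev IsTransform {n : ℕ} (T : L2 n →L[ℂ] L2 n) (f g : Rn n → ℂ) : Prop :=
  IsTransformOn T Set.univ f g

theorem IsTransformOn.mono {Q' : Set (Rn n)} (h : IsTransformOn T Q f g) (hQ : Q' ⊆ Q) :
    IsTransformOn T Q' f g :=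
  fun ψ hψ h0 => h ψ hψ fun x hx => h0 x fun hx' => hx (hQ hx')

theorem IsTransformOn.congr (h : IsTransformOn T Q f g) (hf : f =ᵐ[volume] f')
    (hg : ∀ᵐ x, x ∈ Q → g x = g' x) : IsTransformOn T Q f' g' := by
  intro ψ hψ h0
  obtain ⟨h1, h2, h3⟩ := h ψ hψ h0
  have e1 : (fun x => g x * conj (ψ x)) =ᵐ[volume] fun x => g' x * conj (ψ x) := by
    filter_upwards [hg] with x hx
    by_cases hxQ : x ∈ Q
    · rw [hx hxQ]
    · simp [h0 x hxQ]
  have e2 : (fun x => f x * conj (opFun (ContinuousLinearMap.adjoint T) ψ x)) =ᵐ[volume]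
      fun x => f' x * conj (opFun (ContinuousLinearMap.adjoint T) ψ x) := by
    filter_upwards [hf] with x hx
    rw [hx]
  exact ⟨h1.congr e1, h2.congr e2, by rw [← integral_congr_ae e1, ← integral_congr_ae e2, h3]⟩

theorem IsTransformOn.add (h : IsTransformOn T Q f g) (h' : IsTransformOn T Q f' g') :
    IsTransformOn T Q (f + f') (g + g') := by
  intro ψ hψ h0
  obtain ⟨h1, h2, h3⟩ := h ψ hψ h0
  obtain ⟨h1', h2', h3'⟩ := h' ψ hψ h0
  simp only [Pi.add_apply, add_mul]
  exact ⟨h1.add h1', h2.add h2', by rw [integral_add h1 h1', integral_add h2 h2', h3, h3']⟩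

theorem IsTransformOn.smul (h : IsTransformOn T Q f g) (c : ℂ) :
    IsTransformOn T Q (c • f) (c • g) := by
  intro ψ hψ h0
  obtain ⟨h1, h2, h3⟩ := h ψ hψ h0
  simp only [Pi.smul_apply, smul_eq_mul, mul_assoc]
  exact ⟨h1.const_mul c, h2.const_mul c, by rw [integral_const_mul, integral_const_mul, h3]⟩

theorem isTransform_opFun (hf : MemLp f 2 volume) : IsTransform T f (opFun T f) :=
  fun _ hψ _ => ⟨integrable_mul_conj (memLp_opFun T f) (hψ.memLp 2),
    integrable_mul_conj hf (memLp_opFun _ _), integral_opFun_mul_conj T hf (hψ.memLp 2)⟩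

/-- Indicators of measurable subsets of `Q` are test functions, so all integrals of `g - g'` over
such subsets vanish. Nonsmooth test functions are allowed in `IsTransformOn` for arguments of this
kind. -/
theorem IsTransformOn.ae_eq_of_isBounded (h : IsTransformOn T Q f g)
    (h' : IsTransformOn T Q f g') (hQ : MeasurableSet Q) (hb : Bornology.IsBounded Q) :
    ∀ᵐ x, x ∈ Q → g x = g' x := by
  have key : ∀ s, MeasurableSet s → Integrable (s.indicator (Q.indicator (g - g'))) ∧
      ∫ x, s.indicator (Q.indicator (g - g')) x = 0 := by
    intro s hs
    have hψ := (testFun_indicator_one hQ hb).indicator hs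
    have h0 : ∀ x, x ∉ Q → s.indicator (Q.indicator fun _ => (1 : ℂ)) x = 0 := fun x hx => by
      simp [hx]
    obtain ⟨h1, h2, h3⟩ := h _ hψ h0
    obtain ⟨h1', h2', h3'⟩ := h' _ hψ h0
    have e : s.indicator (Q.indicator (g - g')) = fun x =>
        g x * conj (s.indicator (Q.indicator fun _ => (1 : ℂ)) x) -
        g' x * conj (s.indicator (Q.indicator fun _ => (1 : ℂ)) x) := by
      ext x
      by_cases hs : x ∈ s <;> by_cases hq : x ∈ Q <;> simp [hs, hq]
    rw [e]
    exact ⟨h1.sub h1', by rw [integral_sub h1 h1', h3, h3', sub_self]⟩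
  have hint : Integrable (Q.indicator (g - g')) := by
    simpa using (key Set.univ MeasurableSet.univ).1
  have hz := hint.ae_eq_zero_of_forall_setIntegral_eq_zero fun s hs _ => by
    rw [← integral_indicator hs]
    exact (key s hs).2
  filter_upwards [hz] with x hx hxQ
  rw [Set.indicator_of_mem hxQ] at hx
  exact sub_eq_zero.1 hx

theorem IsTransformOn.ae_eq (h : IsTransformOn T Q f g) (h' : IsTransformOn T Q f g')
    (hQ : MeasurableSet Q) : ∀ᵐ x, x ∈ Q → g x = g' x := by
  have : ∀ k : ℕ, ∀ᵐ x, x ∈ Q ∩ Metric.ball (0 : Rn n) k → g x = g' x := fun k =>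
    (h.mono Set.inter_subset_left).ae_eq_of_isBounded (h'.mono Set.inter_subset_left)
      (hQ.inter measurableSet_ball) (Metric.isBounded_ball.subset Set.inter_subset_right)
  filter_upwards [ae_all_iff.2 this] with x hx hxQ
  obtain ⟨k, hk⟩ := exists_nat_gt ‖x‖
  exact hx k ⟨hxQ, by simpa using hk⟩

theorem IsTransform.ae_eq (h : IsTransform T f g) (h' : IsTransform T f g') :
    g =ᵐ[volume] g' := by
  filter_upwards [IsTransformOn.ae_eq h h' MeasurableSet.univ] with x hx using hx trivial

theorem IsTransform.integrableOn (h : IsTransform T f g) (hQ : MeasurableSet Q)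
    (hb : Bornology.IsBounded Q) : IntegrableOn g Q := by
  have := (h _ (testFun_indicator_one hQ hb) (by simp)).1
  rw [← integrable_indicator_iff hQ]
  refine this.congr (ae_of_all _ fun x => ?_)
  by_cases hx : x ∈ Q <;> simp [hx]

theorem IsTransform.aestronglyMeasurable (h : IsTransform T f g) :
    AEStronglyMeasurable g volume := by
  have : volume = volume.restrict (⋃ k : ℕ, Metric.ball (0 : Rn n) k) := by
    rw [Metric.iUnion_ball_nat, Measure.restrict_univ]
  rw [this, aestronglyMeasurable_iUnion_iff]
  exact fun k => (h.integrableOn measurableSet_ball Metric.isBounded_ball).1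

/-- The image of an absolutely convergent sum. -/
theorem isTransform_tsum {ι : Type*} [Countable ι] {F G : ι → Rn n → ℂ}
    (h : ∀ i, IsTransform T (F i) (G i))
    (hG : ∀ R : ℝ, ∑' i, ∫⁻ x in Metric.ball 0 R, ‖G i x‖ₑ ≠ ∞)
    (hF : ∀ ψ, TestFun ψ →
      ∑' i, ∫⁻ x, ‖F i x‖ₑ * ‖opFun (ContinuousLinearMap.adjoint T) ψ x‖ₑ ≠ ∞) :
    IsTransform T (fun x => ∑' i, F i x) (fun x => ∑' i, G i x) := by
  intro ψ hψ h0
  have hG' : ∑' i, ∫⁻ x, ‖G i x * conj (ψ x)‖ₑ ≠ ∞ := by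
    obtain ⟨M, hM⟩ := hψ.bdd
    obtain ⟨E, hE, hE0⟩ := hψ.supp
    obtain ⟨R, hR⟩ := hE.subset_ball 0
    refine ne_top_of_le_ne_top (ENNReal.mul_ne_top (hG R) (ENNReal.ofReal_ne_top (r := M))) ?_
    rw [← ENNReal.tsum_mul_right]
    refine ENNReal.tsum_le_tsum fun i => ?_
    rw [← lintegral_mul_const' _ _ ENNReal.ofReal_ne_top,
      ← lintegral_indicator measurableSet_ball]
    refine lintegral_mono fun x => ?_
    by_cases hx : x ∈ E
    · rw [Set.indicator_of_mem (hR hx), enorm_mul, RCLike.enorm_conj]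
      gcongr
      rw [← ofReal_norm]
      exact ENNReal.ofReal_le_ofReal (hM x)
    · simp [hE0 x hx]
  have hF' : ∑' i, ∫⁻ x, ‖F i x * conj (opFun (ContinuousLinearMap.adjoint T) ψ x)‖ₑ ≠ ∞ := by
    simpa only [enorm_mul, RCLike.enorm_conj] using hF ψ hψ
  have h1 := fun i => (h i ψ hψ h0).1
  have h2 := fun i => (h i ψ hψ h0).2.1
  simp_rw [← tsum_mul_right]
  refine ⟨integrable_tsum (fun i => (h1 i).1) hG', integrable_tsum (fun i => (h2 i).1) hF', ?_⟩
  rw [integral_tsum (fun i => (h1 i).1) hG', integral_tsum (fun i => (h2 i).1) hF']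
  exact tsum_congr fun i => (h i ψ hψ h0).2.2

/-- Fubini moves the kernel onto the test function. As the test function stays at distance `ε` from
the points where `f ≠ 0`, the inner integral is `T†ψ` by the kernel formula for the adjoint. -/
theorem isTransformOn_kernel (hK : Measurable (Function.uncurry K))
    (hK' : HasKernel δ A (fun x y => conj (K y x)) (ContinuousLinearMap.adjoint T))
    (hf : AEStronglyMeasurable f volume) {W : Rn n → ℝ} {ε : ℝ} (hε : 0 < ε)
    (hW : Integrable fun y => W y * ‖f y‖)
    (h : ∀ x y, x ∈ Q → f y ≠ 0 → ε ≤ dist y x ∧ ‖K x y‖ ≤ W y) :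
    IsTransformOn T Q f fun x => ∫ y, K x y * f y := by
  intro ψ hψ h0
  obtain ⟨E, hE, hE0⟩ := hψ.supp
  obtain ⟨h1, h2, h3⟩ := integral_kernel_swap hK hf hW hψ.conj.integrable fun x y hx hy =>
    (h x y (by_contra fun hxQ => hx (by simp [h0 x hxQ])) hy).2
  have hrepr := hK'.repr ψ (E ∩ Q) ε (hψ.memLp 2) (hE.subset Set.inter_subset_left)
    (fun x hx => by
      by_cases hxE : x ∈ E
      · exact h0 x fun hxQ => hx ⟨hxE, hxQ⟩
      · exact hE0 x hxE) hε
  have e : (fun y => f y * ∫ x, K x y * conj (ψ x)) =ᵐ[volume]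
      fun y => f y * conj (opFun (ContinuousLinearMap.adjoint T) ψ y) := by
    filter_upwards [hrepr] with y hy
    by_cases hfy : f y = 0
    · simp [hfy]
    rw [hy fun x hx => (h x y hx.2 hfy).1, ← integral_conj]
    simp
  exact ⟨h1, h2.congr e, by rw [h3, integral_congr_ae e]⟩

end Transform

/-! ### Extension to functions of bounded support in Lorentz spaces. -/

section LocalExtension

variable {n : ℕ} {δ A : ℝ} {K K' : Rn n → Rn n → ℂ} {T : L2 n →L[ℂ] L2 n}
  {f g f' g' ψ : Rn n → ℂ} {p : ℝ} {q : ℝ≥0∞}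

/-- A test function has bounded support, so unit dyadic cubes cut it into finitely many test
functions, each living on one cube. -/
theorem isTransform_of_forall_dyadicCube (h : ∀ Q, IsTransformOn T (dyadicCube Q) f g) :
    IsTransform T f g := by
  classical
  intro ψ hψ _
  obtain ⟨E, hE, hE0⟩ := hψ.supp
  obtain ⟨R, hR⟩ := hE.subset_closedBall 0
  set S : Finset (Fin n → ℤ) := Fintype.piFinset fun _ => Finset.Icc ⌊-R⌋ ⌊R⌋ with hS
  set Ψ : (Fin n → ℤ) → Rn n → ℂ := fun m => (dyadicCube ((0 : ℤ), m)).indicator ψ with hΨ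
  have hΨt : ∀ m, TestFun (Ψ m) := fun m => hψ.indicator (measurableSet_dyadicCube _)
  have hT := fun m => h (0, m) (Ψ m) (hΨt m) fun x hx => Set.indicator_of_notMem hx _
  have hsum : ψ = ∑ m ∈ S, Ψ m := by
    ext x
    rw [Finset.sum_apply]
    have hother : ∀ m, m ≠ cubeIdx 0 x → Ψ m x = 0 := fun m hm =>
      Set.indicator_of_notMem (fun hx => hm (mem_dyadicCube_iff.1 hx).symm) _
    by_cases hx : x ∈ E
    · rw [Finset.sum_eq_single (cubeIdx 0 x) (fun m _ hm => hother m hm)]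
      · exact (Set.indicator_of_mem (mem_dyadicCube_cubeIdx 0 x) ψ).symm
      · intro hxS
        refine absurd (Fintype.mem_piFinset.2 fun i => ?_) hxS
        have hxi : |x i| ≤ R := by
          have h1 := hR hx
          rw [mem_closedBall_zero_iff] at h1
          exact (PiLp.norm_apply_le x i).trans h1
        rw [abs_le] at hxi
        simp only [cubeIdx, zpow_zero, one_mul, Finset.mem_Icc]
        exact ⟨Int.floor_le_floor hxi.1, Int.floor_le_floor hxi.2⟩
    · rw [hE0 x hx]
      refine (Finset.sum_eq_zero fun m _ => ?_).symm
      simp [hΨ, hE0 x hx]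
  have e1 : (fun x => g x * conj (ψ x)) = fun x => ∑ m ∈ S, g x * conj (Ψ m x) := by
    ext x
    conv_lhs => rw [hsum]
    rw [Finset.sum_apply, map_sum, Finset.mul_sum]
  have e2 : (fun x => f x * conj (opFun (ContinuousLinearMap.adjoint T) ψ x)) =ᵐ[volume]
      fun x => ∑ m ∈ S, f x * conj (opFun (ContinuousLinearMap.adjoint T) (Ψ m) x) := by
    have := opFun_sum (ContinuousLinearMap.adjoint T) S (F := Ψ) fun m _ => (hΨt m).memLp 2
    rw [← hsum] at this
    filter_upwards [this] with x hx
    rw [hx, Finset.sum_apply, map_sum, Finset.mul_sum]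
  refine ⟨?_, ?_, ?_⟩
  · rw [e1]
    exact integrable_finsetSum _ fun m _ => (hT m).1
  · exact (integrable_finsetSum _ fun m _ => (hT m).2.1).congr e2.symm
  · rw [e1, integral_congr_ae e2, integral_finsetSum _ fun m _ => (hT m).1,
      integral_finsetSum _ fun m _ => (hT m).2.1]
    exact Finset.sum_congr rfl fun m _ => (hT m).2.2

/-- An operator with a kernel that is regular in both variables. -/
structure IsCZ {n : ℕ} (δ A : ℝ) (K : Rn n → Rn n → ℂ) (T : L2 n →L[ℂ] L2 n) : Prop where
  kernel : HasKernel δ A K T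
  adjoint_kernel : HasKernel δ A (fun x y => conj (K y x)) (ContinuousLinearMap.adjoint T)

theorem IsCZ.adjoint (h : IsCZ δ A K T) :
    IsCZ δ A (fun x y => conj (K y x)) (ContinuousLinearMap.adjoint T) where
  kernel := h.adjoint_kernel
  adjoint_kernel := by
    simpa only [Complex.conj_conj, ContinuousLinearMap.adjoint_adjoint] using h.kernel

theorem lorentzNorm_restrict_le (f : Rn n → ℂ) {B : Set (Rn n)} (hB : MeasurableSet B) :
    lorentzNorm p q f (volume.restrict B) ≤ lorentzNorm p q f volume := by
  rw [← lorentzNorm_indicator hB]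
  refine lorentzNorm_mono_ae (ae_of_all _ fun x => ?_)
  by_cases hx : x ∈ B <;> simp [hx]

/-- Hölder's inequality against the constant 1 on `B`, whose dual Lorentz norm is a multiple of
`volume B ^ (1 - 1/p)`. -/
theorem exists_lintegral_le_lorentzNorm (hp : 1 < p) (hq : 1 ≤ q) : ∃ C : ℝ≥0,
    ∀ (n : ℕ) (f : Rn n → ℂ) (B : Set (Rn n)), AEMeasurable f (volume.restrict B) →
      volume B ≠ ∞ → ∫⁻ x in B, ‖f x‖ₑ ≤
        C * volume B ^ (1 - 1 / p) * lorentzNorm p q f (volume.restrict B) := by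
  have hpc := Real.HolderConjugate.conjExponent hp
  have hqc : ENNReal.HolderConjugate q q.conjExponent := ENNReal.HolderConjugate.conjExponent hq
  obtain ⟨C, hC⟩ := exists_lorentzNorm_le_of_bounded (p := p.conjExponent)
    (q := q.conjExponent) hpc.symm.lt.le (by simp [ENNReal.conjExponent])
  refine ⟨C, fun n f B hf hB => ?_⟩
  have h1 := lintegral_mul_le_lorentzNorm (q := q) (q' := q.conjExponent) hpc hf
    (aemeasurable_const (b := (1 : ℂ)))
  have h2 := hC (volume.restrict B) (fun _ => (1 : ℂ)) 1 Set.univ (by simp) (by simpa using hB)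
    (by simp) (by simp)
  simp only [enorm_one, mul_one] at h1
  refine h1.trans ((mul_le_mul_right h2 _).trans (le_of_eq ?_))
  rw [Measure.restrict_apply_univ, one_div p.conjExponent, ← hpc.one_sub_inv, mul_one, one_div,
    mul_comm]

theorem TestFun.lorentzNorm_ne_top (hψ : TestFun ψ) (hp : 1 ≤ p) (hq : 1 ≤ q) :
    lorentzNorm p q ψ volume ≠ ∞ := by
  obtain ⟨M, hM⟩ := hψ.bdd
  obtain ⟨E, hE, hE0⟩ := hψ.supp
  obtain ⟨C, hC⟩ := exists_lorentzNorm_le_of_bounded hp hq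
  have hv : volume E ≠ ∞ := hE.measure_lt_top.ne
  refine ne_top_of_le_ne_top ?_ (hC volume ψ (ENNReal.ofReal M) E ENNReal.ofReal_ne_top hv
    (ae_of_all _ fun x => ?_) (ae_of_all _ hE0))
  · exact ENNReal.mul_ne_top (ENNReal.mul_ne_top ENNReal.coe_ne_top ENNReal.ofReal_ne_top)
      (ENNReal.rpow_ne_top_of_nonneg (by positivity) hv)
  · rw [← ofReal_norm]
    exact ENNReal.ofReal_le_ofReal (hM x)

theorem IsCZ.exists_lorentzNorm_opFun_le (hn : 0 < n) (h : IsCZ δ A K T) (hp : 1 < p)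
    (hq : 1 ≤ q) : ∃ C : ℝ≥0, ∀ ψ : Rn n → ℂ, TestFun ψ →
      lorentzNorm p q (opFun T ψ) volume ≤ C * lorentzNorm p q ψ volume := by
  -- The upper exponent `max p 2 + 1` exceeds 2, as the duality argument needs, and `p`, as the
  -- interpolation needs.
  obtain ⟨C, hC⟩ := h.kernel.exists_rearrangement_le hn h.adjoint_kernel (p := max p 2 + 1)
    (by linarith [le_max_right p 2])
  obtain ⟨C', hC'⟩ := exists_lorentzNorm_le_of_dilSum (n := n) (p₁ := max p 2 + 1) hp
    (by linarith [le_max_left p 2]) hq C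
  refine ⟨C', fun ψ hψ => hC' _ _ ?_⟩
  obtain ⟨E, hE, hE0⟩ := hψ.supp
  exact hC ψ E hψ.meas (hψ.memLp 2) hE.measure_lt_top.ne hE0

theorem measure_lt_enorm_le (hp : 1 ≤ p) (hq : 1 ≤ q) {s : ℝ≥0∞} (hs : s ≠ 0) (hs' : s ≠ ∞) :
    volume {x | s < ‖f x‖ₑ} ≤ (4 * lorentzNorm p q f volume / s) ^ p := by
  have hp0 : 0 < p := by linarith
  refine le_of_forall_lt_imp_le_of_dense fun a ha => ?_
  rcases eq_or_ne a 0 with rfl | ha0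
  · exact zero_le
  have hat : a ≠ ∞ := ha.ne_top
  have h1 := rpow_mul_rearrangement_le_lorentzNorm (f := f) (μ := volume) hp hq
    (ENNReal.toReal_pos ha0 hat)
  rw [ENNReal.ofReal_toReal hat] at h1
  have h2 : a ^ (1 / p) * s ≤ 4 * lorentzNorm p q f volume :=
    le_trans (mul_le_mul_right (lt_rearrangement_iff.2 ha).le _) h1
  rw [← ENNReal.le_div_iff_mul_le (Or.inl hs) (Or.inl hs')] at h2
  calc a = (a ^ (1 / p)) ^ p := by
        rw [← ENNReal.rpow_mul, one_div_mul_cancel hp0.ne', ENNReal.rpow_one]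
    _ ≤ _ := by gcongr

/-- Fatou's lemma for rearrangements: where `|g| > s`, all `|F N|` from some index on exceed `s`,
and the sets for the successive indices increase. -/
theorem rearrangement_le_of_tendsto {F : ℕ → Rn n → ℂ} {τ s : ℝ≥0∞}
    (hF : ∀ N, rearrangement (F N) volume τ ≤ s)
    (hlim : ∀ᵐ x, Tendsto (fun N => F N x) atTop (𝓝 (g x))) :
    rearrangement g volume τ ≤ s := by
  rw [rearrangement_le_iff]
  set U : ℕ → Set (Rn n) := fun M => {x | ∀ N, M ≤ N → s < ‖F N x‖ₑ} with hU
  have hmono : Monotone U := fun a b hab x hx => by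
    have hx' : ∀ N, a ≤ N → s < ‖F N x‖ₑ := hx
    have : ∀ N, b ≤ N → s < ‖F N x‖ₑ := fun N hN => hx' N (hab.trans hN)
    exact this
  have hle : volume {x | s < ‖g x‖ₑ} ≤ volume (⋃ M, U M) := by
    refine measure_mono_ae ?_
    filter_upwards [hlim] with x hx
    refine fun hgx => ?_
    have hgx' : s < ‖g x‖ₑ := hgx
    obtain ⟨M, hM⟩ := eventually_atTop.1 ((hx.enorm).eventually (lt_mem_nhds hgx'))
    exact Set.mem_iUnion.2 ⟨M, hM⟩
  refine hle.trans ?_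
  rw [hmono.measure_iUnion]
  refine iSup_le fun M => (measure_mono ?_).trans (rearrangement_le_iff.1 (hF M))
  intro x hx
  have hx' : ∀ N, M ≤ N → s < ‖F N x‖ₑ := hx
  exact hx' M le_rfl

/-- The sets `{2 ^ (i - 1) < |f| ≤ 2 ^ i}` (and `{|f| ≤ 1}` for `i = 0`). -/
def levelSet (f : Rn n → ℂ) : ℕ → Set (Rn n) := disjointed fun i => {x | ‖f x‖ₑ ≤ 2 ^ i}

theorem levelSet_subset (f : Rn n → ℂ) (i : ℕ) {x : Rn n} (hx : x ∈ levelSet f i) :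
    ‖f x‖ₑ ≤ 2 ^ i := disjointed_subset (fun i => {x | ‖f x‖ₑ ≤ 2 ^ i}) i hx

theorem lt_of_mem_levelSet_succ {f : Rn n → ℂ} {i : ℕ} {x : Rn n} (hx : x ∈ levelSet f (i + 1)) :
    2 ^ i < ‖f x‖ₑ := by
  have hm : Monotone fun i : ℕ => {x | ‖f x‖ₑ ≤ 2 ^ i} := fun a b hab x hx => by
    have hx' : ‖f x‖ₑ ≤ 2 ^ a := hx
    have : ‖f x‖ₑ ≤ 2 ^ b := hx'.trans (pow_le_pow_right₀ (by norm_num) hab)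
    exact this
  rw [levelSet, ← Order.succ_eq_add_one, hm.disjointed_succ (not_isMax i)] at hx
  have h2 : ¬ ‖f x‖ₑ ≤ 2 ^ i := hx.2
  exact not_le.1 h2

theorem measurableSet_levelSet (hf : Measurable f) (i : ℕ) : MeasurableSet (levelSet f i) :=
  MeasurableSet.disjointed (fun _ => measurableSet_le hf.enorm measurable_const) i

theorem disjoint_levelSet (f : Rn n → ℂ) : Pairwise (Function.onFun Disjoint (levelSet f)) :=
  disjoint_disjointed _

theorem iUnion_levelSet (f : Rn n → ℂ) : ⋃ i, levelSet f i = Set.univ := by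
  rw [levelSet, iUnion_disjointed, Set.eq_univ_iff_forall]
  intro x
  obtain ⟨k, hk⟩ := exists_nat_gt ‖f x‖
  refine Set.mem_iUnion.2 ⟨k, ?_⟩
  have : ‖f x‖ₑ ≤ 2 ^ k := by
    rw [← ofReal_norm, ← ENNReal.ofReal_ofNat, ← ENNReal.ofReal_pow (by norm_num)]
    exact ENNReal.ofReal_le_ofReal (hk.le.trans (by exact_mod_cast Nat.lt_two_pow_self.le))
  exact this

theorem tsum_indicator_levelSet (f : Rn n → ℂ) (x : Rn n) :
    ∑' i, (levelSet f i).indicator f x = f x := by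
  obtain ⟨i, hi⟩ := Set.mem_iUnion.1 ((iUnion_levelSet f).symm ▸ Set.mem_univ x)
  rw [tsum_eq_single i fun j hj => Set.indicator_of_notMem
    (fun hxj => Set.disjoint_left.1 (disjoint_levelSet f hj) hxj hi) f,
    Set.indicator_of_mem hi]

theorem enorm_sum_indicator_levelSet_le (f : Rn n → ℂ) (s : Finset ℕ) (x : Rn n) :
    ‖∑ i ∈ s, (levelSet f i).indicator f x‖ₑ ≤ ‖f x‖ₑ := by
  classical
  obtain ⟨i, hi⟩ := Set.mem_iUnion.1 ((iUnion_levelSet f).symm ▸ Set.mem_univ x)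
  have h0 : ∀ j, j ≠ i → (levelSet f j).indicator f x = 0 := fun j hj =>
    Set.indicator_of_notMem (fun hxj => Set.disjoint_left.1 (disjoint_levelSet f hj) hxj hi) f
  rw [Finset.sum_congr rfl (g := fun j => if j = i then f x else 0) fun j _ => by
    by_cases hj : j = i
    · rw [hj, Set.indicator_of_mem hi, if_pos rfl]
    · rw [h0 j hj, if_neg hj], Finset.sum_ite_eq']
  split_ifs <;> simp

theorem testFun_indicator_levelSet {E : Set (Rn n)} (hf : Measurable f)
    (hE : Bornology.IsBounded E) (h0 : ∀ x, x ∉ E → f x = 0) (i : ℕ) :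
    TestFun ((levelSet f i).indicator f) where
  meas := hf.indicator (measurableSet_levelSet hf i)
  bdd := by
    refine ⟨2 ^ i, fun x => ?_⟩
    by_cases hx : x ∈ levelSet f i
    · rw [Set.indicator_of_mem hx]
      have := levelSet_subset f i hx
      rwa [← ofReal_norm, ← ENNReal.ofReal_ofNat, ← ENNReal.ofReal_pow (by norm_num),
        ENNReal.ofReal_le_ofReal_iff (by positivity)] at this
    · rw [Set.indicator_of_notMem hx, norm_zero]
      positivity
  supp := ⟨E, hE, fun x hx => by simp [h0 x hx]⟩

/-- On this level set `|f|` is at most `2^{i+1}`, and by Chebyshev in `L^{p,q}` the set has measure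
at most `(4‖f‖/2^i)^p`. For `p₂ < p` the resulting bound decays geometrically in `i`. -/
theorem exists_lorentzNorm_indicator_levelSet_le {p₂ : ℝ} {q₂ : ℝ≥0∞} (hp : 1 ≤ p) (hq : 1 ≤ q)
    (hp₂ : 1 ≤ p₂) (hq₂ : 1 ≤ q₂) : ∃ C : ℝ≥0, ∀ f : Rn n → ℂ, Measurable f →
      lorentzNorm p q f volume ≠ ∞ → ∀ i,
      lorentzNorm p₂ q₂ ((levelSet f (i + 1)).indicator f) volume ≤
        C * (4 * lorentzNorm p q f volume) ^ (p / p₂) * (2 ^ (1 - p / p₂)) ^ i := by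
  obtain ⟨C, hC⟩ := exists_lorentzNorm_le_of_bounded hp₂ hq₂
  refine ⟨2 * C, fun f hf hN i => ?_⟩
  have h2 : (2 : ℝ≥0∞) ^ i ≠ 0 := by positivity
  have h2' : (2 : ℝ≥0∞) ^ i ≠ ∞ := ENNReal.pow_ne_top (by simp)
  have hp0 : 0 < p := by linarith
  have hp20 : 0 < p₂ := by linarith
  have hv := measure_lt_enorm_le (f := f) hp hq h2 h2'
  have hN4 : 4 * lorentzNorm p q f volume ≠ ∞ := ENNReal.mul_ne_top (by simp) hN
  have hv' : volume {x | 2 ^ i < ‖f x‖ₑ} ≠ ∞ := ne_top_of_le_ne_top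
    (ENNReal.rpow_ne_top_of_nonneg hp0.le (ENNReal.div_ne_top hN4 h2)) hv
  calc _ ≤ C * 2 ^ (i + 1) * volume {x | 2 ^ i < ‖f x‖ₑ} ^ (1 / p₂) := by
        refine hC volume _ _ _ (ENNReal.pow_ne_top (by simp)) hv' (ae_of_all _ fun x => ?_)
          (ae_of_all _ fun x hx => Set.indicator_of_notMem
            (fun h => hx (lt_of_mem_levelSet_succ h)) f)
        by_cases hx : x ∈ levelSet f (i + 1)
        · rw [Set.indicator_of_mem hx]
          exact levelSet_subset f _ hx
        · simp [Set.indicator_of_notMem hx]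
    _ ≤ C * 2 ^ (i + 1) * ((4 * lorentzNorm p q f volume / 2 ^ i) ^ p) ^ (1 / p₂) := by gcongr
    _ = C * 2 ^ (i + 1) * ((4 * lorentzNorm p q f volume) ^ (p / p₂) * (2 ^ i) ^ (-(p / p₂))) := by
        rw [← ENNReal.rpow_mul, mul_one_div, div_eq_mul_inv (4 * _),
          ENNReal.mul_rpow_of_nonneg _ _ (by positivity), ENNReal.inv_rpow, ← ENNReal.rpow_neg]
    _ = _ := by
        have e : ((2 : ℝ≥0∞) ^ (1 - p / p₂)) ^ i = 2 ^ i * (2 ^ i) ^ (-(p / p₂)) := by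
          rw [sub_eq_add_neg, ENNReal.rpow_add _ _ (by simp) (by simp), ENNReal.rpow_one, mul_pow,
            ← ENNReal.rpow_natCast, ← ENNReal.rpow_natCast, ← ENNReal.rpow_mul,
            ← ENNReal.rpow_mul, mul_comm (-_)]
        rw [e]
        push_cast
        ring

/-- The extension of `T` to functions of bounded support in a Lorentz space. -/
theorem IsCZ.exists_isTransform (hn : 0 < n) (h : IsCZ δ A K T) (hp : 1 < p) (hq : 1 ≤ q) :
    ∃ C : ℝ≥0, ∀ (f : Rn n → ℂ) (E : Set (Rn n)), Measurable f → Bornology.IsBounded E →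
      (∀ x, x ∉ E → f x = 0) → lorentzNorm p q f volume ≠ ∞ →
      ∃ g, IsTransform T f g ∧ lorentzNorm p q g volume ≤ C * lorentzNorm p q f volume := by
  obtain ⟨C, hC⟩ := h.kernel.exists_rearrangement_le hn h.adjoint_kernel (p := max p 2 + 1)
    (by linarith [le_max_right p 2])
  obtain ⟨C', hC'⟩ := exists_lorentzNorm_le_of_dilSum (n := n) (p₁ := max p 2 + 1) hp
    (by linarith [le_max_left p 2]) hq C
  refine ⟨C', fun f E hf hE h0 hN => ?_⟩
  set F : ℕ → Rn n → ℂ := fun i => (levelSet f i).indicator f with hF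
  have hFt : ∀ i, TestFun (F i) := testFun_indicator_levelSet hf hE h0
  have hG : ∀ R : ℝ, ∑' i, ∫⁻ x in Metric.ball 0 R, ‖opFun T (F i) x‖ₑ ≠ ∞ := by
    intro R
    -- Summability of the images is obtained in `L^{p₂,1}` with `1 < p₂ < p`, where the norms of the
    -- pieces decay geometrically; in `L^{p,q}` itself, for example with `q = ∞`, they need not be
    -- summable.
    have hp₂ : 1 < (1 + p) / 2 := by linarith
    obtain ⟨C₁, hC₁⟩ := exists_lintegral_le_lorentzNorm (q := 1) hp₂ le_rfl
    obtain ⟨C₂, hC₂⟩ := h.exists_lorentzNorm_opFun_le hn (q := 1) hp₂ le_rfl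
    obtain ⟨C₃, hC₃⟩ := exists_lorentzNorm_indicator_levelSet_le (n := n) (p := p) (q := q)
      (q₂ := 1) hp.le hq hp₂.le le_rfl
    have hB : volume (Metric.ball (0 : Rn n) R) ≠ ∞ := measure_ball_lt_top.ne
    have hle : ∀ i, ∫⁻ x in Metric.ball 0 R, ‖opFun T (F i) x‖ₑ ≤
        C₁ * volume (Metric.ball (0 : Rn n) R) ^ (1 - 1 / ((1 + p) / 2)) *
          (C₂ * lorentzNorm ((1 + p) / 2) 1 (F i) volume) := fun i => by
      refine (hC₁ n _ _ (measurable_opFun T _).aemeasurable hB).trans ?_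
      gcongr
      exact (lorentzNorm_restrict_le _ measurableSet_ball).trans (hC₂ _ (hFt i))
    refine ne_top_of_le_ne_top ?_ (ENNReal.tsum_le_tsum hle)
    rw [ENNReal.tsum_mul_left, ENNReal.tsum_mul_left, tsum_eq_zero_add' ENNReal.summable]
    refine ENNReal.mul_ne_top (ENNReal.mul_ne_top ENNReal.coe_ne_top
      (ENNReal.rpow_ne_top_of_nonneg ?_ hB)) (ENNReal.mul_ne_top ENNReal.coe_ne_top
      (ENNReal.add_ne_top.2 ⟨(hFt 0).lorentzNorm_ne_top hp₂.le le_rfl,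
        ne_top_of_le_ne_top ?_ (ENNReal.tsum_le_tsum (hC₃ f hf hN))⟩))
    · rw [sub_nonneg, div_le_one (by linarith)]
      exact hp₂.le
    · rw [ENNReal.tsum_mul_left, ENNReal.tsum_geometric]
      have hθ : 1 - p / ((1 + p) / 2) < 0 := by
        rw [sub_neg, lt_div_iff₀ (by linarith)]
        linarith
      refine ENNReal.mul_ne_top (ENNReal.mul_ne_top ENNReal.coe_ne_top
        (ENNReal.rpow_ne_top_of_nonneg (by positivity) (ENNReal.mul_ne_top (by simp) hN))) ?_
      rw [ENNReal.inv_ne_top, ← pos_iff_ne_zero, tsub_pos_iff_lt]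
      exact ENNReal.rpow_lt_one_of_one_lt_of_neg (by norm_num) hθ
  have hFs : ∀ ψ, TestFun ψ →
      ∑' i, ∫⁻ x, ‖F i x‖ₑ * ‖opFun (ContinuousLinearMap.adjoint T) ψ x‖ₑ ≠ ∞ := by
    intro ψ hψ
    have hpc := Real.HolderConjugate.conjExponent hp
    have hqc : ENNReal.HolderConjugate q q.conjExponent := ENNReal.HolderConjugate.conjExponent hq
    have hq' : 1 ≤ q.conjExponent := by simp [ENNReal.conjExponent]
    obtain ⟨C₂, hC₂⟩ := h.adjoint.exists_lorentzNorm_opFun_le hn hpc.symm.lt hq'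
    -- The pieces have disjoint supports, so the series of pairings is a single integral, finite by
    -- Hölder's inequality and the Lorentz bound for the adjoint.
    have e : ∑' i, ∫⁻ x, ‖F i x‖ₑ * ‖opFun (ContinuousLinearMap.adjoint T) ψ x‖ₑ =
        ∫⁻ x, ‖f x‖ₑ * ‖opFun (ContinuousLinearMap.adjoint T) ψ x‖ₑ := by
      rw [← setLIntegral_univ, ← iUnion_levelSet f,
        lintegral_iUnion (measurableSet_levelSet hf) (disjoint_levelSet f)]
      refine tsum_congr fun i => ?_
      rw [← lintegral_indicator (measurableSet_levelSet hf i)]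
      refine lintegral_congr fun x => ?_
      by_cases hx : x ∈ levelSet f i <;> simp [hF, hx]
    rw [e]
    refine ne_top_of_le_ne_top ?_ (lintegral_mul_le_lorentzNorm (q := q) (q' := q.conjExponent)
      hpc hf.aemeasurable (measurable_opFun _ _).aemeasurable)
    exact ENNReal.mul_ne_top hN (ne_top_of_le_ne_top (ENNReal.mul_ne_top ENNReal.coe_ne_top
      (hψ.lorentzNorm_ne_top hpc.symm.lt.le hq')) (hC₂ ψ hψ))
  have hT := isTransform_tsum (fun i => isTransform_opFun (T := T) ((hFt i).memLp 2)) hG hFs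
  simp only [hF, tsum_indicator_levelSet] at hT
  refine ⟨_, hT, hC' f _ fun τ hτ => ?_⟩
  -- The sharp norm does not come from adding norms of pieces: each partial sum is dominated by
  -- `|f|`, so the rearrangement inequality holds for it with a bound independent of `N` and passes
  -- to the limit.
  refine rearrangement_le_of_tendsto (F := fun N x => ∑ i ∈ Finset.range N, opFun T (F i) x)
    (fun N => ?_) ?_
  · have e : (fun x => ∑ i ∈ Finset.range N, opFun T (F i) x) =ᵐ[volume]
        opFun T (∑ i ∈ Finset.range N, F i) := by
      filter_upwards [opFun_sum T (Finset.range N) (F := F) fun i _ => (hFt i).memLp 2] with x hx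
      rw [hx, Finset.sum_apply]
    rw [rearrangement_congr_ae e]
    have hmeas : Measurable (∑ i ∈ Finset.range N, F i) := by
      have := Finset.measurable_sum (Finset.range N) fun i _ => (hFt i).meas
      convert this using 1
      ext x
      rw [Finset.sum_apply]
    refine (hC (∑ i ∈ Finset.range N, F i) E hmeas
      (memLp_finsetSum' _ fun i _ => (hFt i).memLp 2) hE.measure_lt_top.ne (fun x hx => ?_)
      τ hτ).trans ?_
    · rw [Finset.sum_apply]
      exact Finset.sum_eq_zero fun i _ => by simp [hF, h0 x hx]
    · refine mul_le_mul_right (dilSum_mono (fun x => ?_) τ) _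
      rw [Finset.sum_apply]
      exact enorm_sum_indicator_levelSet_le f _ x
  · have hs : ∀ k : ℕ, ∀ᵐ x, x ∈ Metric.ball (0 : Rn n) k →
        Summable fun i => ‖opFun T (F i) x‖ := fun k =>
      (ae_restrict_iff' measurableSet_ball).1 (ae_summable_norm
        (fun i => (measurable_opFun T (F i)).aestronglyMeasurable) (hG k))
    filter_upwards [ae_all_iff.2 hs] with x hx
    obtain ⟨k, hk⟩ := exists_nat_gt ‖x‖
    exact (hx k (by simpa using hk)).of_norm.hasSum.tendsto_sum_nat

end LocalExtension

/-! ### Bourgain-Morrey-Lorentz spaces -/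

section BourgainMorreyLorentz

variable {n : ℕ} {δ A : ℝ} {K : Rn n → Rn n → ℂ} {T : L2 n →L[ℂ] L2 n}
  {f g : Rn n → ℂ} {p t : ℝ} {q r : ℝ≥0∞}

/-- The coefficients in the norm of `M^{t,r}_{p,q}`. -/
def bmlCoeff (p : ℝ) (q : ℝ≥0∞) (t : ℝ) (f : Rn n → ℂ) (Q : DyadicIndex n) : ℝ≥0∞ :=
  volume (dyadicCube Q) ^ (1 / t - 1 / p) * lorentzNorm p q f (volume.restrict (dyadicCube Q))

theorem lorentzNorm_eq_bmlCoeff (f : Rn n → ℂ) (Q : DyadicIndex n) :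
    lorentzNorm p q f (volume.restrict (dyadicCube Q)) =
      volume (dyadicCube Q) ^ (1 / p - 1 / t) * bmlCoeff p q t f Q := by
  rw [bmlCoeff, ← mul_assoc, ← ENNReal.rpow_add _ _ (volume_dyadicCube_ne_zero Q)
    (volume_dyadicCube_ne_top Q)]
  simp

theorem exists_lintegral_le_bmlCoeff (hp : 1 < p) (hq : 1 ≤ q) (t : ℝ) : ∃ C : ℝ≥0,
    ∀ (n : ℕ) (f : Rn n → ℂ) (Q : DyadicIndex n), Measurable f →
      ∫⁻ x in dyadicCube Q, ‖f x‖ₑ ≤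
        C * volume (dyadicCube Q) ^ (1 - 1 / t) * bmlCoeff p q t f Q := by
  obtain ⟨C, hC⟩ := exists_lintegral_le_lorentzNorm hp hq
  refine ⟨C, fun n f Q hf => (hC n f _ hf.aemeasurable (volume_dyadicCube_ne_top Q)).trans
    (le_of_eq ?_)⟩
  rw [lorentzNorm_eq_bmlCoeff (t := t), ← mul_assoc, mul_assoc (C : ℝ≥0∞),
    ← ENNReal.rpow_add _ _ (volume_dyadicCube_ne_zero Q) (volume_dyadicCube_ne_top Q)]
  congr 3
  ring

theorem indicator_triple (f : Rn n → ℂ) (Q : DyadicIndex n) :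
    (triple Q).indicator f = ∑ e ∈ nbr n, (dyadicCube (shift e Q)).indicator f := by
  classical
  ext x
  rw [Finset.sum_apply]
  by_cases hx : x ∈ triple Q
  · obtain ⟨e, he, hxe⟩ := mem_triple_iff.1 hx
    rw [Finset.sum_eq_single_of_mem e he, Set.indicator_of_mem hx, Set.indicator_of_mem hxe]
    intro e' _ hne
    refine Set.indicator_of_notMem (fun hx' => hne ?_) f
    have h1 := mem_dyadicCube_iff.1 hx'
    have h2 := mem_dyadicCube_iff.1 hxe
    have h3 : (shift e' Q).2 = (shift e Q).2 := h1.symm.trans h2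
    simpa [shift] using h3
  · rw [Set.indicator_of_notMem hx, Finset.sum_eq_zero]
    exact fun e he => Set.indicator_of_notMem (fun hx' => hx (mem_triple_iff.2 ⟨e, he, hx'⟩)) f

theorem lorentzNorm_indicator_triple_le (hp : 0 < p) (hq : 1 ≤ q) (f : Rn n → ℂ)
    (Q : DyadicIndex n) : lorentzNorm p q ((triple Q).indicator f) volume ≤
      (2 ^ (1 / p)) ^ (nbr n).card * (volume (dyadicCube Q) ^ (1 / p - 1 / t) *
        ∑ e ∈ nbr n, bmlCoeff p q t f (shift e Q)) := by
  rw [indicator_triple]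
  refine (lorentzNorm_sum_le hq hp _ _ _).trans (le_of_eq ?_)
  congr 1
  rw [Finset.mul_sum]
  refine Finset.sum_congr rfl fun e _ => ?_
  rw [lorentzNorm_indicator (measurableSet_dyadicCube _), lorentzNorm_eq_bmlCoeff (t := t),
    volume_dyadicCube_eq_of_scale (show (shift e Q).1 = Q.1 from rfl)]

theorem lintegral_triple_le (f : Rn n → ℂ) (Q : DyadicIndex n) :
    ∫⁻ x in triple Q, ‖f x‖ₑ ≤ ∑ e ∈ nbr n, ∫⁻ x in dyadicCube (shift e Q), ‖f x‖ₑ := by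
  have e : triple Q = ⋃ e : nbr n, dyadicCube (shift e Q) := by
    ext x
    simp [mem_triple_iff]
  rw [e, ← Finset.sum_coe_sort]
  exact (lintegral_iUnion_le _ _).trans (le_of_eq (tsum_fintype _))

/-- The weighted sum over all ancestors of a cube and their neighbours. -/
def ancestorSum (t : ℝ) (a : DyadicIndex n → ℝ≥0∞) (Q : DyadicIndex n) : ℝ≥0∞ :=
  ∑' k : ℕ, ((2 : ℝ≥0∞) ^ (-(n / t : ℝ))) ^ k * ∑ e ∈ nbr n, a (shift e (ancestor k Q))

theorem sum_nbr_le_ancestorSum (t : ℝ) (a : DyadicIndex n → ℝ≥0∞) (Q : DyadicIndex n) :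
    ∑ e ∈ nbr n, a (shift e Q) ≤ ancestorSum t a Q := by
  refine le_trans (le_of_eq ?_) (ENNReal.le_tsum 0)
  rw [pow_zero, one_mul, ancestor_zero]

/-- This is the origin of the weights `2^{-nk/t}` in `ancestorSum`. -/
theorem volume_ancestor_rpow (Q : DyadicIndex n) (k : ℕ) (t : ℝ) :
    volume (dyadicCube (ancestor k Q)) ^ (-(1 / t)) =
      (2 ^ (-(n / t : ℝ))) ^ k * volume (dyadicCube Q) ^ (-(1 / t)) := by
  rw [volume_dyadicCube_of_scale_add (Q := Q) (R := ancestor k Q) (k := k) (by simp [ancestor]),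
    ENNReal.mul_rpow_of_ne_top (ENNReal.pow_ne_top (ENNReal.pow_ne_top (by simp)))
      (volume_dyadicCube_ne_top Q), ← pow_mul, ← ENNReal.rpow_natCast, ← ENNReal.rpow_mul,
    ← ENNReal.rpow_natCast, ← ENNReal.rpow_mul]
  congr 2
  push_cast
  ring

/-- At a point of the `k`-th annulus the weight is the inverse volume of the `k`-th ancestor.
Enlarging each annulus to the triple of that ancestor, the integral of `|f|` is at most its volume
to the power `1 - 1/t` times the neighbouring coefficients; altogether the volume to the power
`-1/t` remains. -/
theorem exists_lintegral_far_le_ancestorSum (hp : 1 < p) (hq : 1 ≤ q) (t : ℝ) : ∃ C : ℝ≥0,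
    ∀ (n : ℕ) (f : Rn n → ℂ) (Q : DyadicIndex n), Measurable f →
      ∫⁻ y in (triple Q)ᶜ, (volume (dyadicCube (ancestor (annulusIdx Q y) Q)))⁻¹ * ‖f y‖ₑ ≤
        C * volume (dyadicCube Q) ^ (-(1 / t)) * ancestorSum t (bmlCoeff p q t f) Q := by
  obtain ⟨C, hC⟩ := exists_lintegral_le_bmlCoeff hp hq t
  refine ⟨C, fun n f Q hf => ?_⟩
  set v : ℕ → ℝ≥0∞ := fun k => volume (dyadicCube (ancestor k Q)) with hv
  calc ∫⁻ y in (triple Q)ᶜ, (v (annulusIdx Q y))⁻¹ * ‖f y‖ₑ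
      ≤ ∫⁻ y, (v (annulusIdx Q y))⁻¹ * ‖f y‖ₑ := setLIntegral_le_lintegral _ _
    _ ≤ ∫⁻ y, ∑' k, (triple (ancestor k Q)).indicator (fun y => (v k)⁻¹ * ‖f y‖ₑ) y := by
        refine lintegral_mono fun y => le_trans (le_of_eq ?_) (ENNReal.le_tsum (annulusIdx Q y))
        rw [Set.indicator_of_mem (mem_triple_annulusIdx Q y)]
    _ = ∑' k, (v k)⁻¹ * ∫⁻ y in triple (ancestor k Q), ‖f y‖ₑ := by
        rw [lintegral_tsum fun k => ((hf.enorm.const_mul _).indicator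
          (measurableSet_triple _)).aemeasurable]
        refine tsum_congr fun k => ?_
        rw [lintegral_indicator (measurableSet_triple _), lintegral_const_mul _ hf.enorm]
    _ ≤ ∑' k, (v k)⁻¹ * ∑ e ∈ nbr n, C * v k ^ (1 - 1 / t) *
          bmlCoeff p q t f (shift e (ancestor k Q)) := by
        gcongr with k
        refine (lintegral_triple_le f _).trans (Finset.sum_le_sum fun e _ => ?_)
        refine (hC n f _ hf).trans (le_of_eq ?_)
        rw [volume_dyadicCube_eq_of_scale (show (shift e (ancestor k Q)).1 = (ancestor k Q).1
          from rfl)]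
    _ = _ := by
        rw [ancestorSum, ← ENNReal.tsum_mul_left]
        refine tsum_congr fun k => ?_
        have h1 : (v k)⁻¹ * v k ^ (1 - 1 / t) = v k ^ (-(1 / t)) := by
          rw [← ENNReal.rpow_neg_one, ← ENNReal.rpow_add _ _ (volume_dyadicCube_ne_zero _)
            (volume_dyadicCube_ne_top _)]
          congr 1
          ring
        rw [← Finset.mul_sum, ← mul_assoc, mul_left_comm, h1, volume_ancestor_rpow]
        ring

/-- The size of the kernel between a cube and a point away from it. -/
theorem HasKernel.enorm_le_of_annulusIdx (hK : HasKernel δ A K T) {Q : DyadicIndex n} {x y : Rn n}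
    (hx : x ∈ dyadicCube Q) (hy : annulusIdx Q y ≠ 0) : ‖K x y‖ₑ ≤
      ENNReal.ofReal A * 2 ^ n * (volume (dyadicCube (ancestor (annulusIdx Q y) Q)))⁻¹ := by
  rw [mul_assoc]
  refine le_trans ?_ (mul_le_mul_right (inv_norm_pow_le_of_annulusIdx hx hy) _)
  rw [← ENNReal.ofReal_mul hK.const_pos.le, ← ofReal_norm, mul_one_div]
  exact ENNReal.ofReal_le_ofReal (hK.size x y)

/-- The operator on the part of a function away from a cube. -/
theorem IsCZ.isTransformOn_far (h : IsCZ δ A K T) (hf : Measurable f) (Q : DyadicIndex n)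
    {M : ℝ≥0∞} (hM : M ≠ ∞)
    (hfar : ∫⁻ y in (triple Q)ᶜ, (volume (dyadicCube (ancestor (annulusIdx Q y) Q)))⁻¹ * ‖f y‖ₑ
      ≤ M) :
    IsTransformOn T (dyadicCube Q) ((triple Q)ᶜ.indicator f)
      (fun x => ∫ y, K x y * (triple Q)ᶜ.indicator f y) ∧
    ∀ x ∈ dyadicCube Q, ‖∫ y, K x y * (triple Q)ᶜ.indicator f y‖ₑ ≤
      ENNReal.ofReal A * 2 ^ n * M := by
  have hmt := (measurableSet_triple Q).compl
  have hc : ENNReal.ofReal A * 2 ^ n ≠ ∞ :=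
    ENNReal.mul_ne_top ENNReal.ofReal_ne_top (ENNReal.pow_ne_top (by simp))
  set w : Rn n → ℝ≥0∞ := fun y => ENNReal.ofReal A * 2 ^ n *
    (volume (dyadicCube (ancestor (annulusIdx Q y) Q)))⁻¹ with hw
  have hwt : ∀ y, w y ≠ ∞ := fun y => ENNReal.mul_ne_top hc
    (ENNReal.inv_ne_top.2 (volume_dyadicCube_ne_zero _))
  have hwm : Measurable w := (measurable_from_nat (f := fun k => ENNReal.ofReal A * 2 ^ n *
    (volume (dyadicCube (ancestor k Q)))⁻¹)).comp (measurable_annulusIdx Q)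
  have hann : ∀ y, (triple Q)ᶜ.indicator f y ≠ 0 → y ∉ triple Q := fun y hy hyQ =>
    hy (Set.indicator_of_notMem (by simpa using hyQ) f)
  have hint : ∫⁻ y, w y * ‖(triple Q)ᶜ.indicator f y‖ₑ ≤ ENNReal.ofReal A * 2 ^ n * M := by
    refine le_trans (le_of_eq ?_) (mul_le_mul_right hfar _)
    rw [← lintegral_const_mul' _ _ hc, ← lintegral_indicator hmt]
    refine lintegral_congr fun y => ?_
    by_cases hy : y ∈ (triple Q)ᶜ
    · rw [Set.indicator_of_mem hy, Set.indicator_of_mem hy, hw, mul_assoc]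
    · rw [Set.indicator_of_notMem hy, Set.indicator_of_notMem hy]
      simp
  refine ⟨isTransformOn_kernel (W := fun y => (w y).toReal) (ε := 2 ^ (-Q.1)) h.kernel.meas
    h.adjoint_kernel (hf.indicator hmt).aestronglyMeasurable (by positivity) ⟨?_, ?_⟩ ?_, ?_⟩
  · exact (hwm.ennreal_toReal.mul (hf.indicator hmt).norm).aestronglyMeasurable
  · refine lt_of_le_of_lt (le_of_eq (lintegral_congr fun y => ?_))
      (hint.trans_lt (ENNReal.mul_lt_top hc.lt_top hM.lt_top))
    rw [enorm_mul, Real.enorm_eq_ofReal ENNReal.toReal_nonneg, ENNReal.ofReal_toReal (hwt y),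
      enorm_norm]
  · intro x y hx hy
    have hyQ := hann y hy
    refine ⟨?_, ?_⟩
    · rw [dist_eq_norm, norm_sub_rev]
      exact le_dist_of_notMem_triple hx hyQ
    · have := h.kernel.enorm_le_of_annulusIdx hx (fun h0 => hyQ (annulusIdx_eq_zero_iff.1 h0))
      rw [← toReal_enorm]
      exact ENNReal.toReal_mono (hwt y) this
  · intro x hx
    refine (enorm_integral_le_lintegral_enorm _).trans (le_trans (lintegral_mono fun y => ?_) hint)
    rw [enorm_mul]
    by_cases hy : (triple Q)ᶜ.indicator f y = 0
    · simp [hy]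
    · exact mul_le_mul_left (h.kernel.enorm_le_of_annulusIdx hx
        (fun h0 => hann y hy (annulusIdx_eq_zero_iff.1 h0))) _

/-- On the triple of `Q` the function has bounded support and finite Lorentz norm, so the local
extension applies. The remainder has an image given by the kernel and bounded on `Q`, and a bounded
function on `Q` has Lorentz norm controlled by `volume Q ^ (1/p)`. All powers of the volume cancel.
-/
theorem IsCZ.exists_isTransformOn (hn : 0 < n) (h : IsCZ δ A K T) (hp : 1 < p) (hq : 1 ≤ q)
    (t : ℝ) : ∃ C : ℝ≥0, ∀ (f : Rn n → ℂ) (Q : DyadicIndex n), Measurable f →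
      ancestorSum t (bmlCoeff p q t f) Q ≠ ∞ →
      ∃ g, IsTransformOn T (dyadicCube Q) f g ∧
        bmlCoeff p q t g Q ≤ C * ancestorSum t (bmlCoeff p q t f) Q := by
  obtain ⟨C₁, hC₁⟩ := h.exists_isTransform hn hp hq
  obtain ⟨C₂, hC₂⟩ := exists_lintegral_far_le_ancestorSum hp hq t
  obtain ⟨C₃, hC₃⟩ := exists_lorentzNorm_le_of_bounded hp.le hq
  have hp0 : 0 < p := by linarith
  set D : ℝ≥0 := 2 ^ (1 / p) * (C₁ * (2 ^ (1 / p)) ^ (nbr n).card +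
    C₃ * (A.toNNReal * 2 ^ n * C₂)) with hD
  refine ⟨D, fun f Q hf hfin => ?_⟩
  set S := ancestorSum t (bmlCoeff p q t f) Q with hS
  set V := volume (dyadicCube Q) with hV
  have hV0 : V ≠ 0 := volume_dyadicCube_ne_zero Q
  have hVt : V ≠ ∞ := volume_dyadicCube_ne_top Q
  have hnear : lorentzNorm p q ((triple Q).indicator f) volume ≤
      (2 ^ (1 / p)) ^ (nbr n).card * (V ^ (1 / p - 1 / t) * S) :=
    (lorentzNorm_indicator_triple_le hp0 hq f Q).trans
      (by gcongr; exact sum_nbr_le_ancestorSum t _ Q)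
  have h2p : (2 : ℝ≥0∞) ^ (1 / p) ≠ ∞ := ENNReal.rpow_ne_top_of_nonneg (by positivity) (by simp)
  have hVp : ∀ s : ℝ, V ^ s ≠ ∞ := fun s => ENNReal.rpow_ne_top_of_ne_zero hV0 hVt
  obtain ⟨g₁, hg₁, hg₁n⟩ := hC₁ ((triple Q).indicator f) (triple Q)
    (hf.indicator (measurableSet_triple Q)) (isBounded_triple Q)
    (fun x hx => Set.indicator_of_notMem hx f) (ne_top_of_le_ne_top (ENNReal.mul_ne_top
      (ENNReal.pow_ne_top h2p) (ENNReal.mul_ne_top (hVp _) hfin)) hnear)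
  obtain ⟨hg₂, hg₂n⟩ := h.isTransformOn_far hf Q (ENNReal.mul_ne_top (ENNReal.mul_ne_top
    ENNReal.coe_ne_top (hVp _)) hfin) (hC₂ n f Q hf)
  set g₂ : Rn n → ℂ := fun x => ∫ y, K x y * (triple Q)ᶜ.indicator f y with hg₂def
  refine ⟨g₁ + g₂, ?_, ?_⟩
  · have := (hg₁.mono (Set.subset_univ (dyadicCube Q))).add hg₂
    rwa [Set.indicator_self_add_compl] at this
  set M := ENNReal.ofReal A * 2 ^ n * (C₂ * V ^ (-(1 / t)) * S) with hMdef
  have hM : M ≠ ∞ := ENNReal.mul_ne_top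
    (ENNReal.mul_ne_top ENNReal.ofReal_ne_top (ENNReal.pow_ne_top (by simp)))
    (ENNReal.mul_ne_top (ENNReal.mul_ne_top ENNReal.coe_ne_top (hVp _)) hfin)
  have h2 : lorentzNorm p q g₂ (volume.restrict (dyadicCube Q)) ≤ C₃ * M * V ^ (1 / p) := by
    have := hC₃ (volume.restrict (dyadicCube Q)) g₂ M Set.univ hM
      (by simpa using hVt) ((ae_restrict_iff' (measurableSet_dyadicCube Q)).2
        (ae_of_all _ hg₂n)) (by simp)
    rwa [Measure.restrict_apply_univ] at this
  have h1 : lorentzNorm p q g₁ (volume.restrict (dyadicCube Q)) ≤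
      C₁ * ((2 ^ (1 / p)) ^ (nbr n).card * (V ^ (1 / p - 1 / t) * S)) :=
    (lorentzNorm_restrict_le _ (measurableSet_dyadicCube Q)).trans
      (hg₁n.trans (by gcongr))
  calc bmlCoeff p q t (g₁ + g₂) Q
      ≤ V ^ (1 / t - 1 / p) * (2 ^ (1 / p) * (C₁ * ((2 ^ (1 / p)) ^ (nbr n).card *
          (V ^ (1 / p - 1 / t) * S)) + C₃ * M * V ^ (1 / p))) := by
        rw [bmlCoeff]
        gcongr
        refine (lorentzNorm_add_le hq p g₁ g₂ _).trans ?_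
        gcongr
    _ = 2 ^ (1 / p) * (C₁ * (2 ^ (1 / p)) ^ (nbr n).card *
          (V ^ (1 / t - 1 / p) * V ^ (1 / p - 1 / t)) + C₃ * (ENNReal.ofReal A * 2 ^ n * C₂) *
          (V ^ (1 / t - 1 / p) * (V ^ (-(1 / t)) * V ^ (1 / p)))) * S := by
        rw [hMdef]
        ring
    _ = D * S := by
        rw [← ENNReal.rpow_add _ _ hV0 hVt, ← ENNReal.rpow_add _ _ hV0 hVt,
          ← ENNReal.rpow_add _ _ hV0 hVt, show 1 / t - 1 / p + (1 / p - 1 / t) = 0 by ring,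
          show 1 / t - 1 / p + (-(1 / t) + 1 / p) = 0 by ring, ENNReal.rpow_zero, mul_one, mul_one,
          hD]
        push_cast
        rw [ENNReal.coe_rpow_of_nonneg _ (by positivity)]
        rfl

/-- By uniqueness the local images agree on intersections of cubes, so those on the unit cubes
define one function that agrees with all of them. -/
theorem exists_glue {G : DyadicIndex n → Rn n → ℂ}
    (hG : ∀ Q, IsTransformOn T (dyadicCube Q) f (G Q)) :
    ∃ g, IsTransform T f g ∧ ∀ Q, ∀ᵐ x, x ∈ dyadicCube Q → G Q x = g x := by
  have key : ∀ Q, ∀ᵐ x, x ∈ dyadicCube Q → G Q x = G (0, cubeIdx 0 x) x := by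
    intro Q
    have : ∀ m : Fin n → ℤ, ∀ᵐ x, x ∈ dyadicCube Q ∩ dyadicCube ((0 : ℤ), m) →
        G Q x = G (0, m) x := fun m =>
      ((hG Q).mono Set.inter_subset_left).ae_eq_of_isBounded
        ((hG (0, m)).mono Set.inter_subset_right)
        ((measurableSet_dyadicCube _).inter (measurableSet_dyadicCube _))
        ((isBounded_dyadicCube Q).subset Set.inter_subset_left)
    filter_upwards [ae_all_iff.2 this] with x hx hxQ
    exact hx _ ⟨hxQ, mem_dyadicCube_cubeIdx 0 x⟩
  exact ⟨fun x => G (0, cubeIdx 0 x) x, isTransform_of_forall_dyadicCube fun Q =>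
    (hG Q).congr (ae_eq_refl f) (key Q), key⟩

/-- The extension of `T` to `M^{t,r}_{p,q}`. -/
theorem IsCZ.exists_isTransform_bml (hn : 0 < n) (h : IsCZ δ A K T) (hp : 1 < p) (hq : 1 ≤ q)
    (hr : 1 ≤ r) (ht : 1 / r.toReal < 1 / t) : ∃ C : ℝ≥0, ∀ f : Rn n → ℂ, Measurable f →
      ellNorm r (bmlCoeff p q t f) ≠ ∞ → ∃ g, IsTransform T f g ∧
        ellNorm r (bmlCoeff p q t g) ≤ C * ellNorm r (bmlCoeff p q t f) := by
  obtain ⟨C₁, hC₁⟩ := h.exists_isTransformOn hn hp hq t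
  obtain ⟨C₂, hC₂⟩ := exists_ellNorm_tsum_ancestor_le hn hr ht
  refine ⟨C₁ * C₂, fun f hf hN => ?_⟩
  have hsum : ellNorm r (ancestorSum t (bmlCoeff p q t f)) ≤
      C₂ * ellNorm r (bmlCoeff p q t f) := hC₂ _
  have hfin : ∀ Q, ancestorSum t (bmlCoeff p q t f) Q ≠ ∞ := fun Q =>
    ne_top_of_le_ne_top (ENNReal.mul_ne_top ENNReal.coe_ne_top hN)
      ((le_ellNorm hr _ Q).trans hsum)
  choose G hG hGn using fun Q => hC₁ f Q hf (hfin Q)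
  obtain ⟨g, hg, hgG⟩ := exists_glue hG
  refine ⟨g, hg, ?_⟩
  calc ellNorm r (bmlCoeff p q t g)
      ≤ ellNorm r (fun Q => C₁ * ancestorSum t (bmlCoeff p q t f) Q) := by
        refine ellNorm_mono fun Q => le_trans (le_of_eq ?_) (hGn Q)
        rw [bmlCoeff, bmlCoeff, lorentzNorm_congr_ae]
        refine (ae_restrict_iff' (measurableSet_dyadicCube Q)).2 ?_
        filter_upwards [hgG Q] with x hx hxQ
        exact (hx hxQ).symm
    _ ≤ _ := by
        rw [ellNorm_const_mul hr]
        push_cast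
        rw [mul_assoc]
        gcongr

end BourgainMorreyLorentz

/-! ### Block spaces -/

section Pairing

variable {n : ℕ} {δ A : ℝ} {K : Rn n → Rn n → ℂ} {T : L2 n →L[ℂ] L2 n}
  {f g ψ : Rn n → ℂ} {p p' t t' : ℝ} {q q' r r' : ℝ≥0∞}

/-- Needed when a piece is normalized to a block and its coefficient is zero. -/
theorem ae_eq_zero_of_lorentzNorm_eq_zero (hp : 1 ≤ p) (hq : 1 ≤ q)
    (h : lorentzNorm p q f volume = 0) : f =ᵐ[volume] 0 := by
  have hk : ∀ k : ℕ, ∀ᵐ x, ‖f x‖ₑ ≤ ((k : ℝ≥0∞) + 1)⁻¹ := fun k => by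
    have := measure_lt_enorm_le (f := f) hp hq (s := ((k : ℝ≥0∞) + 1)⁻¹) (by simp) (by simp)
    rw [h, mul_zero, ENNReal.zero_div, ENNReal.zero_rpow_of_pos (by linarith)] at this
    rw [ae_iff]
    simpa only [not_le, nonpos_iff_eq_zero] using this
  filter_upwards [ae_all_iff.2 hk] with x hx
  by_contra hne
  have h0 : ‖f x‖ₑ ≠ 0 := by simpa using hne
  obtain ⟨k, hk⟩ := ENNReal.exists_inv_nat_lt h0
  have := (hx k).trans_lt (lt_of_le_of_lt (ENNReal.inv_le_inv.2 (by simp)) hk)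
  exact lt_irrefl _ this

theorem tendsto_lintegral_tsum_sub_sum {X ι : Type*} [MeasurableSpace X] {μ : Measure X}
    [Countable ι] {F : ι → X → ℂ} (hF : ∀ i, AEStronglyMeasurable (F i) μ)
    (h : ∑' i, ∫⁻ x, ‖F i x‖ₑ ∂μ ≠ ∞) :
    Tendsto (fun s : Finset ι => ∫⁻ x, ‖∑' i, F i x - ∑ i ∈ s, F i x‖ₑ ∂μ) atTop (𝓝 0) := by
  classical
  refine tendsto_of_tendsto_of_tendsto_of_le_of_le tendsto_const_nhds
    (ENNReal.tendsto_tsum_compl_atTop_zero h) (fun _ => zero_le) fun s => ?_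
  dsimp only
  rw [← lintegral_tsum (f := fun (i : {i // i ∉ s}) x => ‖F i x‖ₑ) fun i => (hF i).enorm]
  refine lintegral_mono_ae ?_
  filter_upwards [ae_summable_norm hF h] with x hx
  have hs := hx.of_norm
  rw [← hs.sum_add_tsum_compl (s := s), add_sub_cancel_left]
  exact enorm_tsum_le_tsum_enorm

/-- The pairing between functions on dyadic cubes and `M^{t,r}_{p,q}`. -/
theorem tsum_lintegral_mul_le (hp : p.HolderConjugate p') [ENNReal.HolderConjugate q q']
    [ENNReal.HolderConjugate r r'] (ht : t.HolderConjugate t') {H : DyadicIndex n → Rn n → ℂ}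
    {ν : DyadicIndex n → ℝ≥0∞} (hH : ∀ Q, AEMeasurable (H Q) volume)
    (h0 : ∀ Q x, x ∉ dyadicCube Q → H Q x = 0)
    (hν : ∀ Q, lorentzNorm p' q' (H Q) volume ≤
      ν Q * volume (dyadicCube Q) ^ (1 / p' - 1 / t')) {u : Rn n → ℂ} (hu : AEMeasurable u volume) :
    ∑' Q, ∫⁻ x, ‖H Q x‖ₑ * ‖u x‖ₑ ≤ ellNorm r' ν * ellNorm r (bmlCoeff p q t u) := by
  have : ENNReal.HolderConjugate q' q := ENNReal.HolderConjugate.symm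
  have : ENNReal.HolderConjugate r' r := ENNReal.HolderConjugate.symm
  refine le_trans (ENNReal.tsum_le_tsum fun Q => ?_) (tsum_mul_le_ellNorm ν _)
  have hVt := volume_dyadicCube_ne_top Q
  have hV0 := volume_dyadicCube_ne_zero Q
  have e : ∫⁻ x, ‖H Q x‖ₑ * ‖u x‖ₑ = ∫⁻ x in dyadicCube Q, ‖H Q x‖ₑ * ‖u x‖ₑ := by
    rw [setLIntegral_eq_of_support_subset]
    intro x hx
    by_contra hxQ
    exact hx (by simp [h0 Q x hxQ])
  rw [e]
  refine (lintegral_mul_le_lorentzNorm (q := q') (q' := q) hp.symm (hH Q).restrict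
    hu.restrict).trans ?_
  calc _ ≤ ν Q * volume (dyadicCube Q) ^ (1 / p' - 1 / t') *
        (volume (dyadicCube Q) ^ (1 / p - 1 / t) * bmlCoeff p q t u Q) := by
        rw [lorentzNorm_eq_bmlCoeff (t := t) u]
        gcongr
        exact (lorentzNorm_restrict_le _ (measurableSet_dyadicCube Q)).trans (hν Q)
    _ = ν Q * bmlCoeff p q t u Q * volume (dyadicCube Q) ^ (1 / p' - 1 / t' + (1 / p - 1 / t)) := by
        rw [ENNReal.rpow_add _ _ hV0 hVt]
        ring
    _ = ν Q * bmlCoeff p q t u Q := by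
        have h1 := hp.inv_add_inv_eq_one
        have h2 := ht.inv_add_inv_eq_one
        rw [show 1 / p' - 1 / t' + (1 / p - 1 / t) = 0 by
          simp only [one_div]; linarith, ENNReal.rpow_zero, mul_one]

theorem tsum_volume_inter (j : ℤ) {E : Set (Rn n)} (hE : MeasurableSet E) :
    ∑' m : Fin n → ℤ, volume (dyadicCube (j, m) ∩ E) = volume E := by
  rw [← measure_iUnion]
  · congr 1
    ext x
    simp only [Set.mem_iUnion, Set.mem_inter_iff]
    exact ⟨fun ⟨_, h⟩ => h.2, fun h => ⟨_, mem_dyadicCube_cubeIdx j x, h⟩⟩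
  · intro m m' hmm
    refine Set.disjoint_left.2 fun x hx hx' => hmm ?_
    exact (mem_dyadicCube_iff.1 hx.1).symm.trans (mem_dyadicCube_iff.1 hx'.1)
  · exact fun m => (measurableSet_dyadicCube _).inter hE

theorem volume_dyadicCube_nat (k : ℕ) (m : Fin n → ℤ) :
    volume (dyadicCube ((k : ℤ), m)) = ((2 ^ n) ^ k)⁻¹ := by
  have h0 : volume (dyadicCube ((0 : ℤ), m)) = 1 := by simp [volume_dyadicCube]
  have := volume_dyadicCube_of_scale_add (Q := ((k : ℤ), m)) (R := ((0 : ℤ), m)) (k := k) (by simp)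
  rw [h0] at this
  exact ENNReal.eq_inv_of_mul_eq_one_left (by rw [mul_comm]; exact this.symm)

theorem volume_dyadicCube_neg (k : ℕ) (m : Fin n → ℤ) :
    volume (dyadicCube (-(k : ℤ), m)) = (2 ^ n) ^ k := by
  have h0 : volume (dyadicCube ((0 : ℤ), m)) = 1 := by simp [volume_dyadicCube]
  have := volume_dyadicCube_of_scale_add (Q := ((0 : ℤ), m)) (R := (-(k : ℤ), m)) (k := k) (by simp)
  rwa [h0, mul_one] at this

theorem tsum_two_pow_rpow_ne_top (hn : 0 < n) {θ : ℝ} (hθ : θ < 0) :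
    ∑' k : ℕ, (((2 : ℝ≥0∞) ^ n) ^ k) ^ θ ≠ ∞ := by
  have e : ∀ k : ℕ, (((2 : ℝ≥0∞) ^ n) ^ k) ^ θ = ((2 ^ n) ^ θ) ^ k := fun k => by
    rw [← ENNReal.rpow_natCast (2 ^ n) k, ← ENNReal.rpow_mul, mul_comm, ENNReal.rpow_mul,
      ENNReal.rpow_natCast]
  simp_rw [e]
  rw [ENNReal.tsum_geometric, ENNReal.inv_ne_top, ← pos_iff_ne_zero, tsub_pos_iff_lt]
  exact ENNReal.rpow_lt_one_of_one_lt_of_neg (one_lt_pow₀ (by norm_num) hn.ne') hθ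

theorem rpow_le_mul_rpow_sub_one {a b : ℝ≥0∞} {θ : ℝ} (hab : a ≤ b) (hb : b ≠ ∞) (hθ : 1 ≤ θ) :
    a ^ θ ≤ a * b ^ (θ - 1) := by
  rcases eq_or_ne a 0 with rfl | ha
  · rw [ENNReal.zero_rpow_of_pos (by linarith)]
    exact zero_le
  calc a ^ θ = a * a ^ (θ - 1) := by
        nth_rewrite 2 [← ENNReal.rpow_one a]
        rw [← ENNReal.rpow_add _ _ ha (ne_top_of_le_ne_top hb hab), add_sub_cancel]
    _ ≤ _ := by
        gcongr

/-- This is the norm of an indicator in `M^{t,r}_{p,q}`, up to a constant. As `r ≥ p`, one factor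
`|Q ∩ E|` is kept and summed over the cubes of one scale; the other powers are bounded through `|Q|`
for small cubes and through `|E|` for large ones. The sum over small scales converges because `t <
r`, the one over large scales because `p < t`. For `r = ∞` no summation occurs and `p ≤ t` suffices.
-/
theorem ellNorm_volume_inter_ne_top (hn : 0 < n) (hp : 1 < p)
    (hptr : (p < t ∧ ENNReal.ofReal t < r ∧ r < ∞) ∨ (p ≤ t ∧ r = ∞)) {E : Set (Rn n)}
    (hE : MeasurableSet E) (hEt : volume E ≠ ∞) :
    ellNorm r (fun Q : DyadicIndex n => volume (dyadicCube Q) ^ (1 / t - 1 / p) *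
      volume (dyadicCube Q ∩ E) ^ (1 / p)) ≠ ∞ := by
  have hp0 : 0 < p := by linarith
  rcases hptr with ⟨hpt, htr, hr⟩ | ⟨hpt, rfl⟩
  · have ht0 : 0 < t := by linarith
    have htr' : t < r.toReal := (ENNReal.ofReal_lt_iff_lt_toReal ht0.le hr.ne).1 htr
    set ρ := r.toReal with hρ
    have hρ0 : 0 < ρ := by linarith
    have hρp : 1 ≤ ρ / p := by rw [le_div_iff₀ hp0]; linarith
    rw [ellNorm, if_neg hr.ne, ← hρ]
    refine ENNReal.rpow_ne_top_of_nonneg (by positivity) ?_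
    have hpow : ∀ Q : DyadicIndex n, (volume (dyadicCube Q) ^ (1 / t - 1 / p) *
        volume (dyadicCube Q ∩ E) ^ (1 / p)) ^ ρ =
        volume (dyadicCube Q) ^ (ρ / t - ρ / p) * volume (dyadicCube Q ∩ E) ^ (ρ / p) := by
      intro Q
      rw [ENNReal.mul_rpow_of_nonneg _ _ hρ0.le, ← ENNReal.rpow_mul, ← ENNReal.rpow_mul]
      congr 2 <;> ring
    simp_rw [hpow]
    rw [show ∀ a : DyadicIndex n → ℝ≥0∞, ∑' Q, a Q = ∑' (j : ℤ) (m : Fin n → ℤ), a (j, m) from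
      fun a => ENNReal.tsum_prod (f := fun j m => a (j, m)),
      tsum_of_nat_of_neg_add_one ENNReal.summable ENNReal.summable]
    refine ENNReal.add_ne_top.2 ⟨?_, ?_⟩
    -- Cubes of side `2^{-k}`, `k ≥ 0`.
    · refine ne_top_of_le_ne_top (ENNReal.mul_ne_top (tsum_two_pow_rpow_ne_top hn
        (θ := 1 - ρ / t) ?_) hEt) ?_
      · rw [sub_neg, lt_div_iff₀ ht0]
        linarith
      rw [← ENNReal.tsum_mul_right]
      refine ENNReal.tsum_le_tsum fun k => ?_
      calc _ ≤ ∑' m : Fin n → ℤ, ((2 ^ n) ^ k) ^ (1 - ρ / t) *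
            volume (dyadicCube ((k : ℤ), m) ∩ E) := by
            refine ENNReal.tsum_le_tsum fun m => ?_
            have hV0 := volume_dyadicCube_ne_zero ((k : ℤ), m)
            have hVt := volume_dyadicCube_ne_top ((k : ℤ), m)
            refine (mul_le_mul_right (rpow_le_mul_rpow_sub_one
              (measure_mono Set.inter_subset_left) hVt hρp) _).trans (le_of_eq ?_)
            rw [mul_left_comm, ← ENNReal.rpow_add _ _ hV0 hVt, mul_comm]
            congr 1
            rw [volume_dyadicCube_nat, ENNReal.inv_rpow, ← ENNReal.rpow_neg]
            congr 1
            ring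
        _ = _ := by rw [ENNReal.tsum_mul_left, tsum_volume_inter _ hE]
    -- Cubes of side `2^k` with `k ≥ 1`.
    · refine ne_top_of_le_ne_top (ENNReal.mul_ne_top (tsum_two_pow_rpow_ne_top hn
        (θ := ρ / t - ρ / p) ?_) (ENNReal.mul_ne_top hEt (ENNReal.rpow_ne_top_of_nonneg
        (sub_nonneg.2 hρp) hEt))) ?_
      · rw [sub_neg]
        gcongr
      rw [← ENNReal.tsum_mul_right]
      have hle : ∀ k : ℕ, ∑' m : Fin n → ℤ, volume (dyadicCube (-(k : ℤ), m)) ^ (ρ / t - ρ / p) *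
          volume (dyadicCube (-(k : ℤ), m) ∩ E) ^ (ρ / p) ≤
          ((2 ^ n) ^ k) ^ (ρ / t - ρ / p) * (volume E * volume E ^ (ρ / p - 1)) := by
        intro k
        rw [← tsum_volume_inter (-(k : ℤ)) hE, ← ENNReal.tsum_mul_right, ← ENNReal.tsum_mul_left]
        refine ENNReal.tsum_le_tsum fun m => ?_
        rw [volume_dyadicCube_neg, tsum_volume_inter (-(k : ℤ)) hE]
        gcongr
        exact rpow_le_mul_rpow_sub_one (measure_mono Set.inter_subset_right) hEt hρp
      have hcast : ∀ k : ℕ, -((k : ℤ) + 1) = -((k + 1 : ℕ) : ℤ) := fun k => by push_cast; ring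
      simp_rw [hcast]
      exact (ENNReal.tsum_le_tsum fun k => hle (k + 1)).trans
        (ENNReal.tsum_comp_le_tsum_of_injective (add_left_injective 1) _)
  · have ht0 : 0 < t := by linarith
    rw [ellNorm, if_pos rfl]
    refine ne_top_of_le_ne_top (b := max 1 (volume E ^ (1 / p))) (by
      simp only [ne_eq, max_eq_top, ENNReal.one_ne_top, false_or]
      exact ENNReal.rpow_ne_top_of_nonneg (by positivity) hEt) (iSup_le fun Q => ?_)
    have hV0 := volume_dyadicCube_ne_zero Q
    have hVt := volume_dyadicCube_ne_top Q
    rcases le_total (volume (dyadicCube Q)) 1 with h1 | h1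
    · refine le_trans ?_ (le_max_left _ _)
      calc _ ≤ volume (dyadicCube Q) ^ (1 / t - 1 / p) * volume (dyadicCube Q) ^ (1 / p) := by
            gcongr
            exact Set.inter_subset_left
        _ = volume (dyadicCube Q) ^ (1 / t) := by
            rw [← ENNReal.rpow_add _ _ hV0 hVt, sub_add_cancel]
        _ ≤ 1 := ENNReal.rpow_le_one h1 (by positivity)
    · refine le_trans ?_ (le_max_right _ _)
      have h2 : volume (dyadicCube Q) ^ (1 / t - 1 / p) ≤ 1 := by
        rw [← ENNReal.rpow_zero (x := volume (dyadicCube Q))]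
        refine ENNReal.rpow_le_rpow_of_exponent_le h1 ?_
        rw [sub_nonpos]
        gcongr
      calc _ ≤ 1 * volume E ^ (1 / p) := by
            gcongr
            exact Set.inter_subset_right
        _ = _ := one_mul _

/-- Test functions belong to `M^{t,r}_{p,q}`. -/
theorem TestFun.ellNorm_bmlCoeff_ne_top (hψ : TestFun ψ) (hn : 0 < n) (hp : 1 < p) (hq : 1 ≤ q)
    (hr : 1 ≤ r) (hptr : (p < t ∧ ENNReal.ofReal t < r ∧ r < ∞) ∨ (p ≤ t ∧ r = ∞)) :
    ellNorm r (bmlCoeff p q t ψ) ≠ ∞ := by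
  obtain ⟨M, hM⟩ := hψ.bdd
  obtain ⟨E₀, hE₀, hE0⟩ := hψ.supp
  obtain ⟨R, hR⟩ := hE₀.subset_ball 0
  obtain ⟨C, hC⟩ := exists_lorentzNorm_le_of_bounded hp.le hq
  set E := Metric.ball (0 : Rn n) R with hE
  have hEm : MeasurableSet E := measurableSet_ball
  have hEt : volume E ≠ ∞ := measure_ball_lt_top.ne
  refine ne_top_of_le_ne_top (ENNReal.mul_ne_top (ENNReal.mul_ne_top (ENNReal.coe_ne_top (r := C))
    (ENNReal.ofReal_ne_top (r := M))) (ellNorm_volume_inter_ne_top hn hp hptr hEm hEt)) ?_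
  rw [← ellNorm_const_mul hr]
  refine ellNorm_mono fun Q => ?_
  have h1 := hC (volume.restrict (dyadicCube Q)) ψ (ENNReal.ofReal M) E ENNReal.ofReal_ne_top
    (ne_top_of_le_ne_top hEt (Measure.restrict_apply_le _ _)) (ae_of_all _ fun x => by
      rw [← ofReal_norm]
      exact ENNReal.ofReal_le_ofReal (hM x))
    (ae_of_all _ fun x hx => hE0 x fun hx' => hx (hR hx'))
  rw [Measure.restrict_apply hEm, Set.inter_comm] at h1
  rw [bmlCoeff, mul_left_comm]
  exact mul_le_mul_right h1 _

end Pairing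

/-! ### Regrouping the images of blocks according to distance. -/

section Regroup

variable {n : ℕ} {δ A : ℝ} {K : Rn n → Rn n → ℂ} {T : L2 n →L[ℂ] L2 n}
  {f g : Rn n → ℂ} {p p' t t' : ℝ} {q q' r r' : ℝ≥0∞}

theorem volume_rpow_eq_ancestor (Q : DyadicIndex n) (k : ℕ) (t : ℝ) :
    volume (dyadicCube Q) ^ (1 / t) =
      (2 ^ (-(n / t : ℝ))) ^ k * volume (dyadicCube (ancestor k Q)) ^ (1 / t) := by
  have h := volume_ancestor_rpow Q k (-t)
  rw [show -(1 / -t) = 1 / t by rw [div_neg, neg_neg], show -((n : ℝ) / -t) = n / t by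
    rw [div_neg, neg_neg]] at h
  rw [h, ← mul_assoc, ← mul_pow, ← ENNReal.rpow_add _ _ (by simp) (by simp)]
  simp

/-- The image of a function living on a cube, away from that cube. -/
theorem IsCZ.ae_enorm_le_of_annulusIdx (h : IsCZ δ A K T) {Q : DyadicIndex n} (hf : Measurable f)
    (hint : ∫⁻ x, ‖f x‖ₑ ≠ ∞) (h0 : ∀ x, x ∉ dyadicCube Q → f x = 0) (hg : IsTransform T f g) :
    ∀ᵐ x, annulusIdx Q x ≠ 0 → ‖g x‖ₑ ≤ ENNReal.ofReal A * 2 ^ n *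
      (volume (dyadicCube (ancestor (annulusIdx Q x) Q)))⁻¹ * ∫⁻ y, ‖f y‖ₑ := by
  have hmem : ∀ y, f y ≠ 0 → y ∈ dyadicCube Q := fun y hy => by_contra fun hyQ => hy (h0 y hyQ)
  have hε : (0 : ℝ) < 2 ^ (-Q.1) := by positivity
  have hk : IsTransformOn T (triple Q)ᶜ f fun x => ∫ y, K x y * f y := by
    refine isTransformOn_kernel (W := fun _ => A / (2 ^ (-Q.1)) ^ n) h.kernel.meas h.adjoint_kernel
      hf.aestronglyMeasurable hε ?_ fun x y hx hy => ?_
    · exact Integrable.const_mul (Integrable.norm ⟨hf.aestronglyMeasurable, hint.lt_top⟩) _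
    · have hd : (2 : ℝ) ^ (-Q.1) ≤ dist y x := by
        rw [dist_eq_norm]
        exact le_dist_of_notMem_triple (hmem y hy) hx
      exact ⟨hd, h.kernel.norm_le hε (by rwa [dist_comm])⟩
  filter_upwards [(hg.mono (Set.subset_univ _)).ae_eq hk (measurableSet_triple Q).compl]
    with x hx hx0
  rw [hx fun hxQ => hx0 (annulusIdx_eq_zero_iff.2 hxQ), ← lintegral_const_mul _ hf.enorm]
  refine (enorm_integral_le_lintegral_enorm _).trans (lintegral_mono fun y => ?_)
  rw [enorm_mul]
  by_cases hy : f y = 0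
  · simp [hy]
  · refine mul_le_mul_left ?_ _
    have := h.adjoint_kernel.enorm_le_of_annulusIdx (hmem y hy) hx0
    rwa [RCLike.enorm_conj] at this

/-- The dyadic cube containing `x`, of the scale of the distance from `x` to `Q`. -/
def annulusCube (Q : DyadicIndex n) (x : Rn n) : DyadicIndex n :=
  (Q.1 - annulusIdx Q x, cubeIdx (Q.1 - annulusIdx Q x) x)

theorem annulusCube_eq_iff {Q R : DyadicIndex n} {x : Rn n} :
    annulusCube Q x = R ↔ (annulusIdx Q x : ℤ) = Q.1 - R.1 ∧ x ∈ dyadicCube R := by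
  rw [mem_dyadicCube_iff, annulusCube, Prod.ext_iff]
  constructor
  · rintro ⟨h1, h2⟩
    dsimp only at h1 h2
    rw [h1] at h2
    exact ⟨by omega, h2⟩
  · rintro ⟨h1, h2⟩
    have h3 : Q.1 - annulusIdx Q x = R.1 := by omega
    dsimp only
    rw [h3]
    exact ⟨rfl, h2⟩

theorem measurableSet_annulusCube_eq (Q R : DyadicIndex n) :
    MeasurableSet {x | annulusCube Q x = R} := by
  simp only [annulusCube_eq_iff]
  exact ((measurable_annulusIdx Q) (MeasurableSet.of_discrete
    (s := {k : ℕ | (k : ℤ) = Q.1 - R.1}))).inter (measurableSet_dyadicCube R)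

/-- The cube `R` has the scale of the `k`-th ancestor of `Q` and contains a point of its triple, so
it is a neighbour of that ancestor. Read backwards, `Q` is a `k`-th descendant of a neighbour of
`R`. -/
theorem exists_child_of_annulusCube_eq {Q R : DyadicIndex n} {x : Rn n}
    (h : annulusCube Q x = R) :
    ∃ e ∈ nbr n, ∃ d, child (annulusIdx Q x) d (shift e R) = Q := by
  obtain ⟨h1, h2⟩ := annulusCube_eq_iff.1 h
  obtain ⟨e, he, hx⟩ := mem_triple_iff.1 (mem_triple_annulusIdx Q x)
  have hR : R = shift e (ancestor (annulusIdx Q x) Q) :=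
    eq_of_mem h2 hx (by simp only [shift, ancestor]; omega)
  refine ⟨-e, neg_mem_nbr he, ((childEquiv n (annulusIdx Q x)).symm Q).2, ?_⟩
  rw [hR, shift_neg_shift]
  exact (childEquiv n (annulusIdx Q x)).apply_symm_apply Q

/-- The weighted sum over all descendants of a cube and its neighbours. -/
def childSum (t : ℝ) (a : DyadicIndex n → ℝ≥0∞) (R : DyadicIndex n) : ℝ≥0∞ :=
  ∑' k : ℕ, ((2 : ℝ≥0∞) ^ (-(n / t : ℝ))) ^ k * ∑ e ∈ nbr n, ∑ d, a (child k d (shift e R))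

theorem child_zero (d : Fin n → Fin (2 ^ 0)) (R : DyadicIndex n) : child 0 d R = R := by
  refine Prod.ext (by simp [child]) ?_
  ext i
  simp [child]

theorem sum_nbr_le_childSum (t : ℝ) (a : DyadicIndex n → ℝ≥0∞) (R : DyadicIndex n) :
    ∑ e ∈ nbr n, a (shift e R) ≤ childSum t a R := by
  refine le_trans (le_of_eq ?_) (ENNReal.le_tsum 0)
  rw [pow_zero, one_mul]
  refine Finset.sum_congr rfl fun e _ => ?_
  simp only [child_zero, Finset.sum_const, Finset.card_univ, Fintype.card_pi, Fintype.card_fin]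
  simp

-- At a fixed point, the cubes that contribute to `R` are enumerated by generation, neighbour and
-- descendant; the condition on `annulusIdx` is kept, since the decay of the kernel is read off from
-- it.
open Classical in
theorem tsum_annulusCube_le (c : DyadicIndex n → ℝ≥0∞) (R : DyadicIndex n) (x : Rn n) :
    ∑' Q, (if annulusCube Q x = R then c Q else 0) ≤ ∑' k : ℕ, ∑ e ∈ nbr n, ∑ d,
      (if annulusIdx (child k d (shift e R)) x = k then c (child k d (shift e R)) else 0) := by
  have hle : ∀ Q, (if annulusCube Q x = R then c Q else 0) ≤ ∑' k : ℕ, ∑ e ∈ nbr n, ∑ d,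
      (if Q = child k d (shift e R) then (if annulusIdx (child k d (shift e R)) x = k
        then c (child k d (shift e R)) else 0) else 0) := by
    intro Q
    split_ifs with hQ
    · obtain ⟨e, he, d, hd⟩ := exists_child_of_annulusCube_eq hQ
      refine le_trans ?_ (ENNReal.le_tsum (annulusIdx Q x))
      refine le_trans ?_ (Finset.single_le_sum (fun _ _ => zero_le) he)
      refine le_trans ?_ (Finset.single_le_sum (fun _ _ => zero_le) (Finset.mem_univ d))
      rw [hd, if_pos rfl, if_pos rfl]
    · exact zero_le
  refine (ENNReal.tsum_le_tsum hle).trans (le_of_eq ?_)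
  rw [ENNReal.tsum_comm]
  refine tsum_congr fun k => ?_
  rw [Summable.tsum_finsetSum fun _ _ => ENNReal.summable]
  refine Finset.sum_congr rfl fun e _ => ?_
  rw [Summable.tsum_finsetSum fun _ _ => ENNReal.summable]
  refine Finset.sum_congr rfl fun d _ => ?_
  rw [tsum_ite_eq]

open Classical in
/-- The contributions of all cubes to a cube `R` at their distance are controlled on `R`. -/
theorem exists_majorant (hp : 1 < p') (hq : 1 ≤ q') (ht : t.HolderConjugate t') (C₁ C₂ : ℝ≥0) :
    ∃ D : ℝ≥0, ∀ (c : DyadicIndex n → ℂ) (G : DyadicIndex n → Rn n → ℂ),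
      (∀ Q, Measurable (G Q)) →
      (∀ Q, lorentzNorm p' q' (G Q) volume ≤ C₁ * volume (dyadicCube Q) ^ (1 / p' - 1 / t')) →
      (∀ Q, ∀ᵐ x, annulusIdx Q x ≠ 0 → ‖G Q x‖ₑ ≤ C₂ *
        (volume (dyadicCube (ancestor (annulusIdx Q x) Q)))⁻¹ * volume (dyadicCube Q) ^ (1 / t)) →
      (∀ R, childSum t (fun Q => ‖c Q‖ₑ) R ≠ ∞) →
      ∃ H : DyadicIndex n → Rn n → ℂ, (∀ R, Measurable (H R)) ∧
        (∀ R x, x ∉ dyadicCube R → H R x = 0) ∧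
        (∀ R, lorentzNorm p' q' (H R) volume ≤ D * childSum t (fun Q => ‖c Q‖ₑ) R *
          volume (dyadicCube R) ^ (1 / p' - 1 / t')) ∧
        ∀ R, ∀ᵐ x, ∑' Q, (if annulusCube Q x = R then ‖c Q * G Q x‖ₑ else 0) ≤ ‖H R x‖ₑ := by
  obtain ⟨C₃, hC₃⟩ := exists_lorentzNorm_le_of_bounded hp.le hq
  have hp0 : 0 < p' := by linarith
  refine ⟨2 ^ (1 / p') * ((2 ^ (1 / p')) ^ (nbr n).card * C₁ + C₃ * C₂),
    fun c G hGm hnear hfar hfin => ?_⟩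
  set μ := childSum t (fun Q => ‖c Q‖ₑ) with hμ
  -- A constant bounding on `R` the contributions of generations `k ≥ 1`, which are pointwise
  -- bounded by the decay of the kernel.
  set M : DyadicIndex n → ℝ≥0∞ := fun R =>
    C₂ * volume (dyadicCube R) ^ (1 / t - 1) * μ R with hM
  have hMt : ∀ R, M R ≠ ∞ := fun R => ENNReal.mul_ne_top (ENNReal.mul_ne_top ENNReal.coe_ne_top
    (ENNReal.rpow_ne_top_of_ne_zero (volume_dyadicCube_ne_zero R) (volume_dyadicCube_ne_top R)))
    (hfin R)
  -- The contributions of generation 0, from `R` and its neighbours, controlled only in the Lorentz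
  -- norm. Absolute values prevent cancellation, as `N` serves as a majorant.
  set N : DyadicIndex n → Rn n → ℂ := fun R => ∑ e ∈ nbr n,
    fun x => ((‖c (shift e R) * G (shift e R) x‖ : ℝ) : ℂ) with hN
  have hNx : ∀ R x, N R x = ((∑ e ∈ nbr n, ‖c (shift e R) * G (shift e R) x‖ : ℝ) : ℂ) :=
    fun R x => by simp [hN]
  have hNm : ∀ R, Measurable (N R) := fun R => by
    rw [show N R = fun x => ((∑ e ∈ nbr n, ‖c (shift e R) * G (shift e R) x‖ : ℝ) : ℂ) from
      funext (hNx R)]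
    exact Complex.measurable_ofReal.comp (Finset.measurable_fun_sum _ fun e _ =>
      ((hGm _).const_mul _).norm)
  refine ⟨fun R => (dyadicCube R).indicator (N R + fun _ => (((M R).toReal : ℝ) : ℂ)),
    fun R => ((hNm R).add measurable_const).indicator (measurableSet_dyadicCube R),
    fun R x hx => Set.indicator_of_notMem hx _, fun R => ?_, fun R => ?_⟩
  · set V := volume (dyadicCube R) with hV
    have hV0 : V ≠ 0 := volume_dyadicCube_ne_zero R
    have hVt : V ≠ ∞ := volume_dyadicCube_ne_top R
    rw [lorentzNorm_indicator (measurableSet_dyadicCube R)]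
    have h1 : lorentzNorm p' q' (N R) (volume.restrict (dyadicCube R)) ≤
        (2 ^ (1 / p')) ^ (nbr n).card * (C₁ * V ^ (1 / p' - 1 / t') * μ R) := by
      refine (lorentzNorm_sum_le hq hp0 _ _ _).trans (mul_le_mul_right ?_ _)
      calc _ ≤ ∑ e ∈ nbr n, C₁ * V ^ (1 / p' - 1 / t') * ‖c (shift e R)‖ₑ := by
            refine Finset.sum_le_sum fun e _ => ?_
            calc _ ≤ lorentzNorm p' q' (c (shift e R) • G (shift e R)) volume := by
                  refine (lorentzNorm_restrict_le _ (measurableSet_dyadicCube R)).trans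
                    (lorentzNorm_mono_ae (ae_of_all _ fun x => le_of_eq ?_))
                  rw [← ofReal_norm, Complex.norm_real, norm_norm, ofReal_norm, Pi.smul_apply,
                    smul_eq_mul]
              _ ≤ ‖c (shift e R)‖ₑ * (C₁ * V ^ (1 / p' - 1 / t')) := by
                  refine (lorentzNorm_const_smul_le hq _ _ _).trans (mul_le_mul_right ?_ _)
                  refine (hnear _).trans (le_of_eq ?_)
                  rw [volume_dyadicCube_eq_of_scale (show (shift e R).1 = R.1 from rfl)]
              _ = _ := mul_comm _ _
        _ ≤ _ := by
            rw [← Finset.mul_sum]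
            exact mul_le_mul_right (sum_nbr_le_childSum t (fun Q => ‖c Q‖ₑ) R) _
    have h2 : lorentzNorm p' q' (fun _ : Rn n => (((M R).toReal : ℝ) : ℂ))
        (volume.restrict (dyadicCube R)) ≤ C₃ * M R * V ^ (1 / p') := by
      have := hC₃ (volume.restrict (dyadicCube R)) (fun _ => (((M R).toReal : ℝ) : ℂ)) (M R)
        Set.univ (hMt R) (by simpa using hVt) (ae_of_all _ fun x => by
          rw [← ofReal_norm, Complex.norm_real, Real.norm_of_nonneg ENNReal.toReal_nonneg,
            ENNReal.ofReal_toReal (hMt R)]) (by simp)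
      rwa [Measure.restrict_apply_univ] at this
    refine (lorentzNorm_add_le hq p' _ _ _).trans ((mul_le_mul_right (add_le_add h1 h2) _).trans
      (le_of_eq ?_))
    have e : V ^ (1 / t - 1) * V ^ (1 / p') = V ^ (1 / p' - 1 / t') := by
      rw [← ENNReal.rpow_add _ _ hV0 hVt]
      have h2 := ht.inv_add_inv_eq_one
      congr 1
      simp only [one_div]
      linarith
    rw [hM, show C₃ * (C₂ * V ^ (1 / t - 1) * μ R) * V ^ (1 / p') =
      C₃ * C₂ * (V ^ (1 / t - 1) * V ^ (1 / p')) * μ R by ring, e]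
    push_cast
    rw [ENNReal.coe_rpow_of_nonneg _ (by positivity)]
    push_cast
    ring
  · have hfar' := ae_all_iff.2 hfar
    filter_upwards [hfar'] with x hx
    by_cases hxR : x ∈ dyadicCube R
    swap
    · rw [Set.indicator_of_notMem hxR]
      simp only [enorm_zero, nonpos_iff_eq_zero, ENNReal.tsum_eq_zero]
      exact fun Q => if_neg fun h => hxR (annulusCube_eq_iff.1 h).2
    rw [Set.indicator_of_mem hxR, Pi.add_apply, hNx, ← Complex.ofReal_add, ← ofReal_norm,
      Complex.norm_real, Real.norm_of_nonneg (add_nonneg (Finset.sum_nonneg fun _ _ =>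
        norm_nonneg _) ENNReal.toReal_nonneg), ENNReal.ofReal_add (Finset.sum_nonneg fun _ _ =>
        norm_nonneg _) ENNReal.toReal_nonneg, ENNReal.ofReal_toReal (hMt R),
      ENNReal.ofReal_sum_of_nonneg fun _ _ => norm_nonneg _]
    simp only [ofReal_norm]
    refine (tsum_annulusCube_le (fun Q => ‖c Q * G Q x‖ₑ) R x).trans ?_
    rw [tsum_eq_zero_add' ENNReal.summable]
    refine add_le_add ?_ ?_
    · refine Finset.sum_le_sum fun e _ => ?_
      simp only [child_zero, Finset.sum_const, Finset.card_univ, Fintype.card_pi,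
        Fintype.card_fin]
      simp only [pow_zero, Finset.prod_const_one, one_smul]
      split_ifs
      · exact le_rfl
      · exact zero_le
    · change _ ≤ C₂ * volume (dyadicCube R) ^ (1 / t - 1) * ∑' k : ℕ,
        ((2 : ℝ≥0∞) ^ (-(n / t : ℝ))) ^ k * ∑ e ∈ nbr n, ∑ d, ‖c (child k d (shift e R))‖ₑ
      rw [← ENNReal.tsum_mul_left]
      -- Generation 0 is already in `N`; the series in `M` is restricted to the indices `k + 1`.
      refine le_trans ?_ (ENNReal.tsum_comp_le_tsum_of_injective (add_left_injective 1) _)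
      refine ENNReal.tsum_le_tsum fun k => ?_
      simp only [Finset.mul_sum]
      refine Finset.sum_le_sum fun e _ => Finset.sum_le_sum fun d _ => ?_
      split_ifs with hk
      swap
      · exact zero_le
      -- For a descendant `Q` of generation `k + 1` the ancestor has the volume of `R`, so the
      -- pointwise bound becomes `2^{-n(k+1)/t} |R|^{1/t - 1}`.
      have h1 := hx (child (k + 1) d (shift e R)) (by rw [hk]; exact Nat.succ_ne_zero k)
      rw [hk, volume_rpow_eq_ancestor _ (k + 1), ancestor_child,
        volume_dyadicCube_eq_of_scale (show (shift e R).1 = R.1 from rfl)] at h1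
      rw [enorm_mul]
      refine (mul_le_mul_right h1 _).trans (le_of_eq ?_)
      rw [sub_eq_add_neg, ENNReal.rpow_add _ _ (volume_dyadicCube_ne_zero R)
        (volume_dyadicCube_ne_top R), ENNReal.rpow_neg_one]
      ring

end Regroup

/-! ### The operator on block spaces. -/

section BlockSpace

variable {n : ℕ} {δ A : ℝ} {K : Rn n → Rn n → ℂ} {T : L2 n →L[ℂ] L2 n}
  {p p' t t' : ℝ} {q q' r r' : ℝ≥0∞}

theorem coeFn_sum_smul {ι : Type*} (s : Finset ι) (c : ι → ℂ) (b : ι → L0 n) :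
    ((∑ i ∈ s, c i • b i : L0 n) : Rn n → ℂ) =ᵐ[volume] fun x => ∑ i ∈ s, c i * b i x := by
  classical
  induction s using Finset.induction_on with
  | empty =>
    simp only [Finset.sum_empty]
    exact AEEqFun.coeFn_zero
  | insert i s hi ih =>
    rw [Finset.sum_insert hi]
    filter_upwards [ih, AEEqFun.coeFn_add (c i • b i) (∑ i ∈ s, c i • b i),
      AEEqFun.coeFn_smul (c i) (b i)] with x h1 h2 h3
    rw [h2, Pi.add_apply, h3, h1, Finset.sum_insert hi]
    simp

/-- Each piece is divided by its bound `ν R` to become a block. Absolute convergence on balls yields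
convergence of the finite partial sums in `L¹_loc`. -/
theorem blockNorm_le (hp : 1 ≤ p) (hq : 1 ≤ q) (hr : 1 ≤ r) {F : DyadicIndex n → Rn n → ℂ}
    {ν : DyadicIndex n → ℝ≥0∞} (hF : ∀ R, Measurable (F R))
    (h0 : ∀ R x, x ∉ dyadicCube R → F R x = 0)
    (hν : ∀ R, lorentzNorm p q (F R) volume ≤ ν R * volume (dyadicCube R) ^ (1 / p - 1 / t))
    (hfin : ellNorm r ν ≠ ∞)
    (hsum : ∀ ρ : ℝ, ∑' R, ∫⁻ x in Metric.ball 0 ρ, ‖F R x‖ₑ ≠ ∞) {g : L0 n}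
    (hg : g =ᵐ[volume] fun x => ∑' R, F R x) : blockNorm p q t r g ≤ ellNorm r ν := by
  have hνt : ∀ R, ν R ≠ ∞ := fun R => ne_top_of_le_ne_top hfin (le_ellNorm hr ν R)
  set c : DyadicIndex n → ℂ := fun R => (((ν R).toReal : ℝ) : ℂ) with hc
  have hcν : ∀ R, ‖c R‖ₑ = ν R := fun R => by
    rw [hc, ← ofReal_norm, Complex.norm_real, Real.norm_of_nonneg ENNReal.toReal_nonneg,
      ENNReal.ofReal_toReal (hνt R)]
  set b : DyadicIndex n → L0 n := fun R =>
    AEEqFun.mk ((c R)⁻¹ • F R) ((hF R).const_smul _).aestronglyMeasurable with hb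
  have hbF : ∀ R, b R =ᵐ[volume] (c R)⁻¹ • F R := fun R => AEEqFun.coeFn_mk _ _
  have hcb : ∀ R, ∀ᵐ x, c R * b R x = F R x := fun R => by
    by_cases hcR : c R = 0
    -- A zero coefficient has inverse 0, so its block is 0; the representation stays correct because
    -- the piece itself vanishes almost everywhere.
    · have hz : lorentzNorm p q (F R) volume = 0 := by
        have := hν R
        rwa [← hcν, hcR, enorm_zero, zero_mul, nonpos_iff_eq_zero] at this
      filter_upwards [ae_eq_zero_of_lorentzNorm_eq_zero hp hq hz] with x hx
      rw [hx, hcR, zero_mul, Pi.zero_apply]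
    · filter_upwards [hbF R] with x hx
      rw [hx, Pi.smul_apply, smul_eq_mul, mul_inv_cancel_left₀ hcR]
  have hdec : IsBlockDecomposition p q t r g c b := by
    refine ⟨?_, fun R => ⟨?_, ?_⟩, fun E hE => ?_⟩
    · simpa only [hcν] using hfin.lt_top
    · filter_upwards [hbF R] with x hx hxR
      rw [hx, Pi.smul_apply, h0 R x hxR, smul_zero]
    · rw [lorentzNorm_congr_ae (hbF R)]
      refine (lorentzNorm_const_smul_le hq _ _ _).trans ?_
      refine (mul_le_mul_right (hν R) _).trans ?_
      rw [← mul_assoc, ← hcν, ← enorm_mul]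
      refine (mul_le_mul_left (?_ : _ ≤ (1 : ℝ≥0∞)) _).trans (le_of_eq (one_mul _))
      by_cases hcR : c R = 0
      · simp [hcR]
      · simp [hcR]
    · obtain ⟨ρ, hρ⟩ := hE.isBounded.subset_ball 0
      have h1 : ∑' R, ∫⁻ x in E, ‖F R x‖ₑ ≠ ∞ := ne_top_of_le_ne_top (hsum ρ)
        (ENNReal.tsum_le_tsum fun R => lintegral_mono_set hρ)
      refine (tendsto_lintegral_tsum_sub_sum (fun R => (hF R).aestronglyMeasurable) h1).congr
        fun s => lintegral_congr_ae (ae_restrict_of_ae ?_)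
      filter_upwards [AEEqFun.coeFn_sub g (∑ R ∈ s, c R • b R), hg, coeFn_sum_smul s c b,
        ae_all_iff.2 hcb] with x h1 h2 h3 h4
      rw [h1, Pi.sub_apply, h2, h3]
      simp only [h4]
  calc blockNorm p q t r g ≤ ellNorm r fun R => ‖c R‖ₑ :=
        iInf_le_of_le c (iInf_le_of_le b (iInf_le_of_le hdec le_rfl))
    _ = ellNorm r ν := by simp only [hcν]

/-- The limit in `L¹_loc` and the pointwise sum are both limits of the same partial sums in `L¹` of
every ball. -/
theorem IsBlockDecomposition.ae_eq_tsum {f : L0 n} {c : DyadicIndex n → ℂ}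
    {b : DyadicIndex n → L0 n} (h : IsBlockDecomposition p q t r f c b)
    (hsum : ∀ ρ : ℝ, ∑' R, ∫⁻ x in Metric.ball 0 ρ, ‖c R * b R x‖ₑ ≠ ∞) :
    f =ᵐ[volume] fun x => ∑' R, c R * b R x := by
  have hm : ∀ R, AEStronglyMeasurable (fun x => c R * b R x) volume := fun R =>
    (b R).aestronglyMeasurable.const_mul _
  have key : ∀ k : ℕ, ∀ᵐ x, x ∈ Metric.closedBall (0 : Rn n) k → f x = ∑' R, c R * b R x := by
    intro k
    set E := Metric.closedBall (0 : Rn n) k with hE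
    have h1 : ∑' R, ∫⁻ x in E, ‖c R * b R x‖ₑ ≠ ∞ := ne_top_of_le_ne_top (hsum (k + 1))
      (ENNReal.tsum_le_tsum fun R => lintegral_mono_set
        (Metric.closedBall_subset_ball (by linarith)))
    have hm' := fun R => (hm R).restrict (s := E)
    have h2 := tendsto_lintegral_tsum_sub_sum hm' h1
    have h3 := h.converges E (isCompact_closedBall _ _)
    have hle : ∀ s : Finset (DyadicIndex n), ∫⁻ x in E, ‖f x - ∑' R, c R * b R x‖ₑ ≤
        (∫⁻ x in E, ‖(f - ∑ R ∈ s, c R • b R : L0 n) x‖ₑ) +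
        ∫⁻ x in E, ‖∑' R, c R * b R x - ∑ R ∈ s, c R * b R x‖ₑ := by
      intro s
      rw [← lintegral_add_left' (AEEqFun.aestronglyMeasurable _).enorm.restrict]
      refine lintegral_mono_ae (ae_restrict_of_ae ?_)
      filter_upwards [AEEqFun.coeFn_sub f (∑ R ∈ s, c R • b R), coeFn_sum_smul s c b] with x e1 e2
      rw [e1, Pi.sub_apply, e2]
      calc _ = ‖(f x - ∑ R ∈ s, c R * b R x) - (∑' R, c R * b R x - ∑ R ∈ s, c R * b R x)‖ₑ := by
            rw [sub_sub_sub_cancel_right]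
        _ ≤ _ := enorm_sub_le
    have h4 : ∫⁻ x in E, ‖f x - ∑' R, c R * b R x‖ₑ = 0 := by
      have := ge_of_tendsto' (h3.add h2) hle
      simpa using this
    have h5 := (lintegral_eq_zero_iff'
      ((f.aestronglyMeasurable.restrict.sub (integrable_tsum hm' h1).1).enorm)).1 h4
    filter_upwards [(ae_restrict_iff' Metric.isClosed_closedBall.measurableSet).1 h5] with x hx hxE
    have := hx hxE
    simpa [sub_eq_zero] using this
  filter_upwards [ae_all_iff.2 key] with x hx
  obtain ⟨k, hk⟩ := exists_nat_gt ‖x‖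
  exact hx k (by simpa using hk.le)

theorem ellNorm_bmlCoeff_congr {f g : Rn n → ℂ} (h : f =ᵐ[volume] g) :
    ellNorm r (bmlCoeff p q t f) = ellNorm r (bmlCoeff p q t g) := by
  have : bmlCoeff p q t f = bmlCoeff p q t g := by
    ext Q
    rw [bmlCoeff, bmlCoeff, lorentzNorm_congr_ae (ae_restrict_of_ae h)]
  rw [this]

open Classical in
/-- The extension of `T` to the block space. -/
theorem IsCZ.exists_isTransform_block (hn : 0 < n) (h : IsCZ δ A K T)
    (hp : p.HolderConjugate p') (ht : t.HolderConjugate t') (hq : 1 ≤ q) (hq' : 1 ≤ q')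
    (hr : 1 ≤ r) (hr' : 1 ≤ r') (hr't : r' ≠ ∞)
    [ENNReal.HolderConjugate q q'] [ENNReal.HolderConjugate r r']
    (hptr : (p < t ∧ ENNReal.ofReal t < r ∧ r < ∞) ∨ (p ≤ t ∧ r = ∞))
    (hrt : 1 / r.toReal < 1 / t) (hrt' : 1 - 1 / r'.toReal < 1 / t) :
    ∃ C : ℝ≥0, ∀ (f : L0 n) (c : DyadicIndex n → ℂ) (b : DyadicIndex n → L0 n),
      IsBlockDecomposition p' q' t' r' f c b →
      ∃ g : L0 n, IsTransform T f g ∧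
        blockNorm p' q' t' r' g ≤ C * ellNorm r' (fun Q => ‖c Q‖ₑ) := by
  obtain ⟨C₁, hC₁⟩ := h.exists_isTransform hn hp.symm.lt hq'
  obtain ⟨C₂, hC₂⟩ := exists_lintegral_le_lorentzNorm hp.symm.lt hq'
  -- The adjoint is extended to the space that pairs with the block space; this makes the pairings
  -- with `T†ψ` absolutely convergent.
  obtain ⟨C₃, hC₃⟩ := h.adjoint.exists_isTransform_bml hn hp.lt hq hr hrt
  obtain ⟨D, hD⟩ := exists_majorant (n := n) hp.symm.lt hq' ht C₁ (A.toNNReal * 2 ^ n * C₂)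
  obtain ⟨C₄, hC₄⟩ := exists_ellNorm_tsum_child_le hn hr' hr't hrt'
  refine ⟨D * C₄, fun f c b hdec => ?_⟩
  set a : DyadicIndex n → ℝ≥0∞ := fun Q => ‖c Q‖ₑ with ha
  have hat : ellNorm r' a ≠ ∞ := hdec.coeff.ne
  -- the blocks
  set β : DyadicIndex n → Rn n → ℂ := fun Q => (dyadicCube Q).indicator (b Q) with hβ
  have hβm : ∀ Q, Measurable (β Q) := fun Q => (b Q).measurable.indicator (measurableSet_dyadicCube Q)
  have hβ0 : ∀ Q x, x ∉ dyadicCube Q → β Q x = 0 := fun Q x hx => Set.indicator_of_notMem hx _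
  have hβb : ∀ Q, β Q =ᵐ[volume] b Q := fun Q => by
    filter_upwards [(hdec.block Q).1] with x hx
    by_cases hxQ : x ∈ dyadicCube Q
    · exact Set.indicator_of_mem hxQ _
    · rw [hβ0 Q x hxQ, hx hxQ]
  have hβn : ∀ Q, lorentzNorm p' q' (β Q) volume ≤ volume (dyadicCube Q) ^ (1 / p' - 1 / t') :=
    fun Q => by
      rw [lorentzNorm_congr_ae (hβb Q)]
      exact (hdec.block Q).2
  have hβt : ∀ Q, lorentzNorm p' q' (β Q) volume ≠ ∞ := fun Q => ne_top_of_le_ne_top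
    (ENNReal.rpow_ne_top_of_ne_zero (volume_dyadicCube_ne_zero Q) (volume_dyadicCube_ne_top Q))
    (hβn Q)
  have hβ1 : ∀ Q, ∫⁻ x, ‖β Q x‖ₑ ≤ C₂ * volume (dyadicCube Q) ^ (1 / t) := fun Q => by
    have hV0 := volume_dyadicCube_ne_zero Q
    have hVt := volume_dyadicCube_ne_top Q
    have e : ∫⁻ x, ‖β Q x‖ₑ = ∫⁻ x in dyadicCube Q, ‖β Q x‖ₑ := by
      rw [setLIntegral_eq_of_support_subset]
      intro x hx
      by_contra hxQ
      exact hx (by simp [hβ0 Q x hxQ])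
    rw [e]
    refine (hC₂ n _ _ (hβm Q).aemeasurable hVt).trans ?_
    refine (mul_le_mul_right ((lorentzNorm_restrict_le _ (measurableSet_dyadicCube Q)).trans
      (hβn Q)) _).trans (le_of_eq ?_)
    rw [mul_assoc, ← ENNReal.rpow_add _ _ hV0 hVt]
    have h2 := ht.inv_add_inv_eq_one
    congr 2
    simp only [one_div]
    linarith
  have hβ1t : ∀ Q, ∫⁻ x, ‖β Q x‖ₑ ≠ ∞ := fun Q => ne_top_of_le_ne_top (ENNReal.mul_ne_top
    ENNReal.coe_ne_top (ENNReal.rpow_ne_top_of_ne_zero (volume_dyadicCube_ne_zero Q)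
    (volume_dyadicCube_ne_top Q))) (hβ1 Q)
  -- their images
  have hG : ∀ Q, ∃ G, Measurable G ∧ IsTransform T (β Q) G ∧
      lorentzNorm p' q' G volume ≤ C₁ * volume (dyadicCube Q) ^ (1 / p' - 1 / t') := fun Q => by
    obtain ⟨G, hG, hGn⟩ := hC₁ (β Q) (dyadicCube Q) (hβm Q) (isBounded_dyadicCube Q) (hβ0 Q) (hβt Q)
    have hae := hG.aestronglyMeasurable.ae_eq_mk
    refine ⟨hG.aestronglyMeasurable.mk G, hG.aestronglyMeasurable.stronglyMeasurable_mk.measurable,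
      IsTransformOn.congr hG (ae_eq_refl _) (hae.mono fun x hx _ => hx), ?_⟩
    rw [← lorentzNorm_congr_ae hae]
    exact hGn.trans (mul_le_mul_right (hβn Q) _)
  choose G hGm hGT hGn using hG
  have hGfar : ∀ Q, ∀ᵐ x, annulusIdx Q x ≠ 0 → ‖G Q x‖ₑ ≤ (A.toNNReal * 2 ^ n * C₂ : ℝ≥0) *
      (volume (dyadicCube (ancestor (annulusIdx Q x) Q)))⁻¹ * volume (dyadicCube Q) ^ (1 / t) :=
    fun Q => by
      filter_upwards [h.ae_enorm_le_of_annulusIdx (hβm Q) (hβ1t Q) (hβ0 Q) (hGT Q)] with x hx hx0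
      refine (hx hx0).trans ((mul_le_mul_right (hβ1 Q) _).trans (le_of_eq ?_))
      push_cast
      rw [ENNReal.ofReal]
      ring
  have hμ : ellNorm r' (childSum t a) ≤ C₄ * ellNorm r' a := hC₄ a
  have hμt : ellNorm r' (childSum t a) ≠ ∞ :=
    ne_top_of_le_ne_top (ENNReal.mul_ne_top ENNReal.coe_ne_top hat) hμ
  obtain ⟨H, hHm, hH0, hHn, hHx⟩ := hD c G hGm hGn hGfar fun R =>
    ne_top_of_le_ne_top hμt (le_ellNorm hr' _ R)
  have hν : ellNorm r' (fun R => D * childSum t a R) ≤ (D * C₄ : ℝ≥0) * ellNorm r' a := by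
    rw [ellNorm_const_mul hr', ENNReal.coe_mul, mul_assoc]
    exact mul_le_mul_right hμ _
  have hνt : ellNorm r' (fun R => D * childSum t a R) ≠ ∞ :=
    ne_top_of_le_ne_top (ENNReal.mul_ne_top ENNReal.coe_ne_top hat) hν
  -- absolute convergence
  have hball : ∀ (F : DyadicIndex n → Rn n → ℂ) (ρ : ℝ),
      ∑' Q, ∫⁻ x, ‖F Q x‖ₑ * ‖(Metric.ball (0 : Rn n) ρ).indicator (fun _ => (1 : ℂ)) x‖ₑ =
      ∑' Q, ∫⁻ x in Metric.ball 0 ρ, ‖F Q x‖ₑ := fun F ρ => by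
    refine tsum_congr fun Q => ?_
    rw [← lintegral_indicator measurableSet_ball]
    refine lintegral_congr fun x => ?_
    by_cases hx : x ∈ Metric.ball (0 : Rn n) ρ <;> simp [hx]
  have hone : ∀ ρ : ℝ, TestFun ((Metric.ball (0 : Rn n) ρ).indicator fun _ => (1 : ℂ)) := fun ρ =>
    testFun_indicator_one measurableSet_ball Metric.isBounded_ball
  have hcβ : ∀ u : Rn n → ℂ, Measurable u → ellNorm r (bmlCoeff p q t u) ≠ ∞ →
      ∑' Q, ∫⁻ x, ‖c Q * β Q x‖ₑ * ‖u x‖ₑ ≠ ∞ := fun u hu hut =>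
    ne_top_of_le_ne_top (ENNReal.mul_ne_top hat hut) (tsum_lintegral_mul_le
      (H := fun Q x => c Q * β Q x) (ν := a) (q := q) (q' := q') hp ht
      (fun Q => ((hβm Q).const_mul _).aemeasurable) (fun Q x hx => by rw [hβ0 Q x hx, mul_zero])
      (fun Q => (lorentzNorm_const_smul_le hq' (c Q) (β Q) volume).trans
        (mul_le_mul_right (hβn Q) _)) hu.aemeasurable)
  have hHB : ∀ ρ : ℝ, ∑' R, ∫⁻ x in Metric.ball 0 ρ, ‖H R x‖ₑ ≠ ∞ := fun ρ => by
    rw [← hball]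
    exact ne_top_of_le_ne_top (ENNReal.mul_ne_top hνt ((hone ρ).ellNorm_bmlCoeff_ne_top hn hp.lt hq
      hr hptr)) (tsum_lintegral_mul_le (q := q) (q' := q') hp ht (fun R => (hHm R).aemeasurable)
      hH0 hHn (hone ρ).meas.aemeasurable)
  have hGB : ∀ ρ : ℝ, ∑' Q, ∫⁻ x in Metric.ball 0 ρ, ‖c Q * G Q x‖ₑ ≠ ∞ := fun ρ => by
    refine ne_top_of_le_ne_top (hHB ρ) ?_
    rw [← lintegral_tsum fun Q => ((hGm Q).const_mul _).enorm.aemeasurable,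
      ← lintegral_tsum fun R => (hHm R).enorm.aemeasurable]
    refine lintegral_mono_ae (ae_restrict_of_ae ?_)
    filter_upwards [ae_all_iff.2 hHx] with x hx
    -- At `x` every `Q` is assigned to exactly one `R`, so summing over `R` the terms assigned to it
    -- counts every `Q` once.
    calc ∑' Q, ‖c Q * G Q x‖ₑ
        = ∑' (Q) (R), (if annulusCube Q x = R then ‖c Q * G Q x‖ₑ else 0) := by
          refine tsum_congr fun Q => ?_
          rw [tsum_ite_eq']
      _ = ∑' (R) (Q), (if annulusCube Q x = R then ‖c Q * G Q x‖ₑ else 0) := ENNReal.tsum_comm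
      _ ≤ _ := ENNReal.tsum_le_tsum hx
  -- the image of the sum
  have hfβ : (f : Rn n → ℂ) =ᵐ[volume] fun x => ∑' Q, c Q * β Q x := by
    have e : ∀ᵐ x, ∀ Q, β Q x = b Q x := ae_all_iff.2 hβb
    have h1 : ∀ ρ : ℝ, ∑' Q, ∫⁻ x in Metric.ball 0 ρ, ‖c Q * b Q x‖ₑ ≠ ∞ := fun ρ => by
      have h2 := hcβ _ (hone ρ).meas ((hone ρ).ellNorm_bmlCoeff_ne_top hn hp.lt hq hr hptr)
      rw [hball (fun Q x => c Q * β Q x)] at h2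
      convert h2 using 3 with Q
      refine lintegral_congr_ae (ae_restrict_of_ae ?_)
      filter_upwards [hβb Q] with x hx
      rw [hx]
    filter_upwards [hdec.ae_eq_tsum h1, e] with x hx he
    simp only [hx, he]
  have hT : IsTransform T (fun x => ∑' Q, c Q * β Q x) fun x => ∑' Q, c Q * G Q x := by
    refine isTransform_tsum (fun Q => IsTransformOn.smul (hGT Q) (c Q)) hGB fun ψ hψ => ?_
    -- The `L²` image `T†ψ` and the image provided by the extension to `M^{t,r}_{p,q}` are both
    -- transforms of `ψ`, so they agree and `T†ψ` has finite norm.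
    obtain ⟨g, hg, hgn⟩ := hC₃ ψ hψ.meas (hψ.ellNorm_bmlCoeff_ne_top hn hp.lt hq hr hptr)
    refine hcβ _ (measurable_opFun _ _) ?_
    rw [ellNorm_bmlCoeff_congr ((isTransform_opFun (hψ.memLp 2)).ae_eq hg)]
    exact ne_top_of_le_ne_top (ENNReal.mul_ne_top ENNReal.coe_ne_top
      (hψ.ellNorm_bmlCoeff_ne_top hn hp.lt hq hr hptr)) hgn
  have hTm := hT.aestronglyMeasurable
  set g : L0 n := AEEqFun.mk _ hTm with hg
  have hgx : g =ᵐ[volume] fun x => ∑' Q, c Q * G Q x := AEEqFun.coeFn_mk _ _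
  refine ⟨g, IsTransformOn.congr hT hfβ.symm (hgx.mono fun x hx _ => hx.symm), ?_⟩
  -- its decomposition
  set F : DyadicIndex n → Rn n → ℂ := fun R x =>
    ∑' Q, (if annulusCube Q x = R then c Q * G Q x else 0) with hF
  have hFm : ∀ R, Measurable (F R) := fun R => Measurable.tsum fun Q =>
    Measurable.ite (measurableSet_annulusCube_eq Q R) ((hGm Q).const_mul _) measurable_const
  have hFH : ∀ R, ∀ᵐ x, ‖F R x‖ₑ ≤ ‖H R x‖ₑ := fun R => by
    filter_upwards [hHx R] with x hx
    refine enorm_tsum_le_tsum_enorm.trans (le_trans (le_of_eq (tsum_congr fun Q => ?_)) hx)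
    split_ifs <;> simp
  refine (blockNorm_le (F := F) hp.symm.lt.le hq' hr' hFm (fun R x hx => ?_)
    (fun R => (lorentzNorm_mono_ae (hFH R)).trans (hHn R)) hνt (fun ρ => ?_) ?_).trans hν
  · simp only [hF]
    exact (tsum_congr (g := fun _ => 0) fun Q => if_neg fun hQ =>
      hx (annulusCube_eq_iff.1 hQ).2).trans tsum_zero
  · refine ne_top_of_le_ne_top (hHB ρ) (ENNReal.tsum_le_tsum fun R =>
      lintegral_mono_ae (ae_restrict_of_ae (hFH R)))
  · have hs : ∀ k : ℕ, ∀ᵐ x, x ∈ Metric.ball (0 : Rn n) k → Summable fun Q => ‖c Q * G Q x‖ :=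
      fun k => (ae_restrict_iff' measurableSet_ball).1 (ae_summable_norm
        (fun Q => ((hGm Q).const_mul _).aestronglyMeasurable) (hGB k))
    filter_upwards [hgx, ae_all_iff.2 hs] with x hx hsx
    obtain ⟨k, hk⟩ := exists_nat_gt ‖x‖
    have hsum := (hsx k (by simpa using hk)).of_norm.hasSum
    -- For fixed `x` the absolutely convergent sum over `Q` is rearranged along the fibres of
    -- `annulusCube`, which yields the pieces `F R`.
    rw [hx, ← (hsum.tsum_fiberwise fun Q => annulusCube Q x).tsum_eq]
    refine tsum_congr fun R => ?_
    rw [tsum_subtype ((fun Q => annulusCube Q x) ⁻¹' {R}) fun Q => c Q * G Q x]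
    refine tsum_congr fun Q => ?_
    simp [Set.indicator_apply]

end BlockSpace

/-! ### Linear extensions from the construction of single images. -/

section Extension

variable {n : ℕ} {δ A : ℝ} {K : Rn n → Rn n → ℂ} {T : L2 n →L[ℂ] L2 n}
  {p t : ℝ} {q r : ℝ≥0∞}

open Classical in
/-- The extension of `T` by duality. -/
def dualExtension (T : L2 n →L[ℂ] L2 n) (f : L0 n) : L0 n :=
  if h : ∃ g : L0 n, IsTransform T f g then h.choose else 0

theorem isTransform_dualExtension {f : L0 n} (h : ∃ g : L0 n, IsTransform T f g) :
    IsTransform T f (dualExtension T f) := by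
  rw [dualExtension, dif_pos h]
  exact h.choose_spec

theorem dualExtension_eq {f g : L0 n} (h : IsTransform T f g) : dualExtension T f = g :=
  AEEqFun.ext ((isTransform_dualExtension ⟨g, h⟩).ae_eq h)

/-- The image is chosen for each `f` separately, but the duality relation determines it; additivity,
homogeneity, the norm bound and agreement with `L²` all follow by exhibiting one function that
satisfies the relation. -/
theorem exists_extension {N : L0 n → ℝ≥0∞} {C : ℝ≥0}
    (h : ∀ f, N f < ∞ → ∃ g : L0 n, IsTransform T f g ∧ N g ≤ C * N f) :
    ∃ S : L0 n → L0 n, IsBoundedLinearOn N S ∧ IsExtensionOn T N S := by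
  have hS : ∀ f, N f < ∞ → IsTransform T f (dualExtension T f) := fun f hf =>
    isTransform_dualExtension ((h f hf).imp fun _ hg => hg.1)
  refine ⟨dualExtension T, ⟨fun f g hf hg => ?_, fun c f hf => ?_, C, fun f hf => ?_⟩,
    ⟨fun f _ => ?_, fun f hf φ hφ => ?_⟩⟩
  · refine dualExtension_eq (IsTransformOn.congr ((hS f hf).add (hS g hg))
      (AEEqFun.coeFn_add f g).symm ?_)
    filter_upwards [AEEqFun.coeFn_add (dualExtension T f) (dualExtension T g)] with x hx _
    exact hx.symm
  · refine dualExtension_eq (IsTransformOn.congr ((hS f hf).smul c)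
      (AEEqFun.coeFn_smul c f).symm ?_)
    filter_upwards [AEEqFun.coeFn_smul c (dualExtension T f)] with x hx _
    exact hx.symm
  · obtain ⟨g, hg, hgN⟩ := h f hf
    rwa [dualExtension_eq hg]
  · refine dualExtension_eq ?_
    have := isTransform_opFun (T := T) (Lp.memLp f)
    rwa [opFun_coe] at this
  · have hψ := testFun_of_hasCompactSupport φ hφ
    have := hS f hf φ hψ (by simp)
    rwa [opFun_of_memLp _ (hψ.memLp 2)] at this

theorem IsCZ.exists_extension_bml (hn : 0 < n) (h : IsCZ δ A K T) (hp : 1 < p) (hq : 1 ≤ q)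
    (hr : 1 ≤ r) (hrt : 1 / r.toReal < 1 / t) :
    ∃ S : L0 n → L0 n, IsBoundedLinearOn (bmlNorm p q t r) S ∧
      IsExtensionOn T (bmlNorm p q t r) S := by
  obtain ⟨C, hC⟩ := h.exists_isTransform_bml hn hp hq hr hrt
  refine exists_extension (C := C) fun f hf => ?_
  obtain ⟨g, hg, hgn⟩ := hC f f.measurable hf.ne
  have hae : AEEqFun.mk g hg.aestronglyMeasurable =ᵐ[volume] g := AEEqFun.coeFn_mk _ _
  refine ⟨AEEqFun.mk g hg.aestronglyMeasurable, IsTransformOn.congr hg (ae_eq_refl _)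
    (hae.mono fun x hx _ => hx.symm), ?_⟩
  change ellNorm r (bmlCoeff p q t _) ≤ _
  rw [ellNorm_bmlCoeff_congr hae]
  exact hgn

/-- This covers infinite exponents as well, since `∞.toReal = 0` and division by zero give `1 / ∞ =
0`. -/
theorem one_sub_one_div_toReal {r r' : ℝ≥0∞} [h : ENNReal.HolderConjugate r r'] :
    1 - 1 / r'.toReal = 1 / r.toReal := by
  have h1 := ENNReal.HolderConjugate.inv_add_inv_eq_one r r'
  have h2 : r⁻¹ ≠ ∞ := fun h => by simp [h] at h1
  have h3 : r'⁻¹ ≠ ∞ := fun h => by simp [h] at h1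
  have h4 := congrArg ENNReal.toReal h1
  rw [ENNReal.toReal_add h2 h3, ENNReal.toReal_inv, ENNReal.toReal_inv, ENNReal.toReal_one] at h4
  rw [one_div, one_div]
  linarith

theorem IsCZ.exists_extension_block (hn : 0 < n) (h : IsCZ δ A K T) (hp : 1 < p) (ht : 1 < t)
    (hq : 1 ≤ q) (hr : 1 < r) (hrt : 1 / r.toReal < 1 / t)
    (hptr : (p < t ∧ ENNReal.ofReal t < r ∧ r < ∞) ∨ (p ≤ t ∧ r = ∞)) :
    ∃ S : L0 n → L0 n,
      IsBoundedLinearOn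
        (blockNorm p.conjExponent q.conjExponent t.conjExponent r.conjExponent) S ∧
      IsExtensionOn T
        (blockNorm p.conjExponent q.conjExponent t.conjExponent r.conjExponent) S := by
  have hqc : ENNReal.HolderConjugate q q.conjExponent := ENNReal.HolderConjugate.conjExponent hq
  have hrc : ENNReal.HolderConjugate r r.conjExponent :=
    ENNReal.HolderConjugate.conjExponent hr.le
  obtain ⟨C, hC⟩ := h.exists_isTransform_block (q := q) (q' := q.conjExponent) (r := r)
    (r' := r.conjExponent) hn (.conjExponent hp) (.conjExponent ht) hq
    (by simp [ENNReal.conjExponent]) hr.le (by simp [ENNReal.conjExponent])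
    (by simpa [ENNReal.conjExponent, tsub_eq_zero_iff_le] using hr) hptr hrt
    (by rwa [one_sub_one_div_toReal (r := r)])
  -- The constant `C + 1` is nonzero, so it can be divided out before passing to the infimum that
  -- defines the norm of `f`.
  refine exists_extension (C := C + 1) fun f hf => ?_
  obtain ⟨c, b, hdec⟩ : ∃ c b, IsBlockDecomposition p.conjExponent q.conjExponent t.conjExponent
      r.conjExponent f c b := by
    by_contra hne
    push Not at hne
    refine hf.ne ?_
    simp [blockNorm, hne]
  obtain ⟨g, hg, -⟩ := hC f c b hdec
  refine ⟨g, hg, ?_⟩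
  have hC0 : ((C + 1 : ℝ≥0) : ℝ≥0∞) ≠ 0 := by simp
  rw [mul_comm, ← ENNReal.div_le_iff hC0 ENNReal.coe_ne_top]
  refine le_iInf fun c => le_iInf fun b => le_iInf fun hdec => ?_
  -- Every decomposition produces an image with its own bound; by uniqueness all these images are
  -- `g`, so the infimum over decompositions may be taken.
  obtain ⟨g', hg', hgn⟩ := hC f c b hdec
  rw [show g = g' from AEEqFun.ext (hg.ae_eq hg'), ENNReal.div_le_iff hC0 ENNReal.coe_ne_top,
    mul_comm]
  refine hgn.trans (mul_le_mul_left ?_ _)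
  simp

end Extension

end BML

end

open BML in
theorem mainTheorem8 (n : ℕ) (hn : 0 < n)
    (p : ℝ) (q : ℝ≥0∞) (t : ℝ) (r : ℝ≥0∞)
    (hq : 1 ≤ q) (hp : 1 < p)
    (hptr : (p < t ∧ ENNReal.ofReal t < r ∧ r < ∞) ∨ (p ≤ t ∧ r = ∞))
    (K : Rn n → Rn n → ℂ) (T : 𝓢(Rn n, ℂ) →L[ℂ] 𝓢'(Rn n, ℂ)) (T₂ : L2 n →L[ℂ] L2 n)
    (hT : IsCalderonZygmund K T T₂) :
    (∃ S : L0 n → L0 n,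
      IsBoundedLinearOn (bmlNorm p q t r) S ∧ IsExtensionOn T₂ (bmlNorm p q t r) S) ∧
    (1 < q → q < ∞ →
      ∃ S : L0 n → L0 n,
        IsBoundedLinearOn
          (blockNorm p.conjExponent q.conjExponent t.conjExponent r.conjExponent) S ∧
        IsExtensionOn T₂
          (blockNorm p.conjExponent q.conjExponent t.conjExponent r.conjExponent) S) := by
  obtain ⟨δ, A, k, hk, hk'⟩ := hT.hasKernel hn
  have hcz : IsCZ δ A k T₂ := ⟨hk, hk'⟩
  have ht : 1 < t := by
    rcases hptr with h | h
    · linarith [h.1]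
    · linarith [h.1]
  have ht0 : 0 < t := by linarith
  have hr : 1 < r := by
    rcases hptr with ⟨_, h, _⟩ | ⟨_, rfl⟩
    · exact (ENNReal.one_lt_ofReal.2 ht).trans h
    · simp
  -- This form of `t < r` covers `r = ∞`, where the left-hand side is 0, and is the one needed for
  -- both geometric series.
  have hrt : 1 / r.toReal < 1 / t := by
    rcases hptr with ⟨_, h, h'⟩ | ⟨_, rfl⟩
    · exact one_div_lt_one_div_of_lt ht0 ((ENNReal.ofReal_lt_iff_lt_toReal ht0.le h'.ne).1 h)
    · simpa using ht0
  exact ⟨hcz.exists_extension_bml hn hp hq hr.le hrt,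
    fun _ _ => hcz.exists_extension_block hn hp ht hq hr hrt hptr⟩
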